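/- **Setting.** Let $N\ge 1$, $p=p_F:=1+\frac2N$, $0<\epsilon<\frac N2$, and on $\mathbf R^N$ let $$f_\epsilon(x):=|x|^{-N}\,\bigl|\log|x|\bigr|^{-\frac N2-1+\epsilon}\,\chi_{B(0,1/e)}(x).$$ For $0<\alpha<1$ and a nonnegative Radon measure $\mu$ on $\mathbf R^N$ consider the time-fractional problem (with the Caputo derivative) $\partial_t^\alpha u-\Delta u=u^p$, $u(0)=\mu$, in the following sense. Let $G(t,x)=(4\pi t)^{-N/2}e^{-|x|^2/(4t)}$, $e^{t\Delta}\mu(x)=\int_{\mathbf R^N}G(t,x-y)\,d\mu(y)$, and let $h_\alpha>0$ be the probability density on $(0,\infty)$ characterized by $\int_0^\infty h_\alpha(\theta)e^{z\theta}\,d\theta=\sum_{k\ge0}\frac{z^k}{\Gamma(\alpha k+1)}$ for all $z\in\mathbf C$. Put $$P_\alpha(t)\mu=\int_0^\infty h_\alpha(\theta)\,e^{t^\alpha\theta\Delta}\mu\,d\theta,\qquad S_\alpha(t)\mu=\int_0^\infty\theta h_\alpha(\theta)\,e^{t^\alpha\theta\Delta}\mu\,d\theta .$$ For $0<T<\infty$,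 a nonnegative measurable function $u$ on $(0,T]\times\mathbf R^N$ is a solution in $[0,T]\times\mathbf R^N$ if $$\infty>u(t,x)=[P_\alpha(t)\mu](x)+\alpha\int_0^t(t-s)^{\alpha-1}[S_\alpha(t-s)u(s)^p](x)\,ds$$ for almost all $t\in(0,T]$ and $x\in\mathbf R^N$; it is minimal if $u\le v$ almost everywhere for every solution $v$ in $[0,T]\times\mathbf R^N$. The life span is $$T_\alpha[\mu]:=\sup\{T'>0:\ \text{a minimal solution exists in }[0,T']\times\mathbf R^N\}\in[0,\infty].$$ A locally integrable function $\phi\ge 0$ is identified with the measure $\phi\,dx$. **Theorem 4.2.** There are constants $0<c<C$, depending only on $N$ and $\epsilon$, such that for each $\kappa>0$ there exists $\alpha(\kappa,\epsilon)\in(0,1)$ with $$-C\,\kappa^{\frac{2}{N-2\epsilon}}(1-\alpha)^{-\frac{N}{N-2\epsilon}}\ \le\ \log T_\alpha[\kappa f_\epsilon]\ \le\ -c\,\kappa^{\frac{2}{N-2\epsilon}}(1-\alpha)^{-\frac{N}{N-2\epsilon}}$$ for all $\alpha(\kappa,\epsilon)<\alpha<1$. In particular, $\lim_{\alpha\to1-0}T_\alpha[\kappa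 f_\epsilon]=0$ for all $\kappa>0$. -/

import Mathlib

open Real Set MeasureTheory Filter Topology
open scoped ENNReal

namespace TimeFracHeat

/-! ### The probability density `h_α` -/

/-- The kernel `A_α(u) = (sin(αu)^α sin((1-α)u)^(1-α) / sin u)^(1/(1-α))`, `0 < u < π`. -/
noncomputable def stableKernel (α u : ℝ) : ℝ :=
  (sin (α * u) ^ α * sin ((1 - α) * u) ^ (1 - α) / sin u) ^ (1 / (1 - α))

/-- The probability density `h_α` on `(0,∞)` (the M-Wright function), in the classical closed form
`h_α(θ) = θ^(α/(1-α)) / (π(1-α)) ∫_0^π A_α(u) exp(-A_α(u) θ^(1/(1-α))) du`.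
It is proved below, for `0 < α < 1`, that it is positive on `(0,∞)` (`subDensity_pos`) and that it
satisfies the identity which characterizes `h_α`, namely
`∫_0^∞ h_α(θ) exp(zθ) dθ = E_{α,1}(z)` for every `z ∈ ℂ` (`integral_subDensity_mul_exp`). -/
noncomputable def subDensity (α θ : ℝ) : ℝ :=
  1 / (π * (1 - α)) * θ ^ (α / (1 - α)) *
    ∫ u in Ioo 0 π, stableKernel α u * exp (-stableKernel α u * θ ^ (1 / (1 - α)))

/-- The Mittag-Leffler function `E_{α,β}(z) = ∑ z^k / Γ(αk+β)`. -/
noncomputable def mittagLeffler (α β z : ℂ) : ℂ :=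
  ∑' k : ℕ, z ^ k / Complex.Gamma (α * k + β)

/-! ### The equation -/

/-- `ℝ^N` with the Euclidean norm. -/
abbrev Space (N : ℕ) : Type := EuclideanSpace ℝ (Fin N)

/-- The Fujita exponent `p_F = 1 + 2/N`. -/
noncomputable def fujitaExponent (N : ℕ) : ℝ := 1 + 2 / N

/-- The Gauss kernel `G(t,x) = (4πt)^(-N/2) exp(-|x|²/(4t))`. -/
noncomputable def heatKernel {N : ℕ} (t : ℝ) (x : Space N) : ℝ :=
  1 / (4 * π * t) ^ ((N : ℝ) / 2) * exp (-‖x‖ ^ 2 / (4 * t))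

/-- `(e^{tΔ} μ)(x) = ∫ G(t,x-y) dμ(y)` for a nonnegative measure `μ`, with values in `[0,∞]`. -/
noncomputable def heatSemigroup {N : ℕ} (t : ℝ) (μ : Measure (Space N)) (x : Space N) : ℝ≥0∞ :=
  ∫⁻ y, ENNReal.ofReal (heatKernel t (x - y)) ∂μ

/-- `P_α(t) μ = ∫_0^∞ h_α(θ) e^{t^α θ Δ} μ dθ`. -/
noncomputable def opP {N : ℕ} (α t : ℝ) (μ : Measure (Space N)) (x : Space N) : ℝ≥0∞ :=
  ∫⁻ θ in Ioi (0 : ℝ), ENNReal.ofReal (subDensity α θ) * heatSemigroup (t ^ α * θ) μ x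

/-- `S_α(t) μ = ∫_0^∞ θ h_α(θ) e^{t^α θ Δ} μ dθ`. -/
noncomputable def opS {N : ℕ} (α t : ℝ) (μ : Measure (Space N)) (x : Space N) : ℝ≥0∞ :=
  ∫⁻ θ in Ioi (0 : ℝ), ENNReal.ofReal (θ * subDensity α θ) * heatSemigroup (t ^ α * θ) μ x

/-- The right-hand side of the integral equation,
`[P_α(t) μ](x) + α ∫_0^t (t-s)^(α-1) [S_α(t-s) u(s)^p](x) ds`, with values in `[0,∞]`;
the function `u(s)^p` is identified with the measure `u(s)^p dx`. -/
noncomputable def mildRHS {N : ℕ} (α p : ℝ) (μ : Measure (Space N)) (u : ℝ → Space N → ℝ≥0∞)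
    (t : ℝ) (x : Space N) : ℝ≥0∞ :=
  opP α t μ x + ENNReal.ofReal α * ∫⁻ s in Ioo 0 t, ENNReal.ofReal ((t - s) ^ (α - 1)) *
    opS α (t - s) (volume.withDensity fun y => u s y ^ p) x

/-- `u` is a (nonnegative) solution in `[0,T] × ℝ^N` of `∂_t^α u - Δu = u^p`, `u(0) = μ`. Only the
values of `u` on `(0,T] × ℝ^N` matter. -/
def IsSolution {N : ℕ} (α p : ℝ) (μ : Measure (Space N)) (T : ℝ)
    (u : ℝ → Space N → ℝ≥0∞) : Prop :=
  AEMeasurable (Function.uncurry u) ((volume.restrict (Ioc 0 T)).prod volume) ∧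
    ∀ᵐ t ∂(volume.restrict (Ioc 0 T)), ∀ᵐ x ∂(volume : Measure (Space N)),
      u t x < ∞ ∧ u t x = mildRHS α p μ u t x

/-- `u` is a solution in `[0,T] × ℝ^N` lying below every solution in `[0,T] × ℝ^N`. -/
def IsMinimalSolution {N : ℕ} (α p : ℝ) (μ : Measure (Space N)) (T : ℝ)
    (u : ℝ → Space N → ℝ≥0∞) : Prop :=
  IsSolution α p μ T u ∧ ∀ v, IsSolution α p μ T v →
    ∀ᵐ t ∂(volume.restrict (Ioc 0 T)), ∀ᵐ x ∂(volume : Measure (Space N)), u t x ≤ v t x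

/-- The life span `T_α[μ] ∈ [0,∞]`: the supremum of the `T' > 0` such that the minimal solution
exists in `[0,T'] × ℝ^N`. -/
noncomputable def lifeSpan {N : ℕ} (α p : ℝ) (μ : Measure (Space N)) : ℝ≥0∞ :=
  sSup (ENNReal.ofReal '' {T' : ℝ | 0 < T' ∧ ∃ u, IsMinimalSolution α p μ T' u})

/-! ### The initial data -/

/-- `f_ε(x) = |x|^(-N) |log|x||^(-N/2-1+ε)` on the ball `B(0,1/e)`, and `0` elsewhere. -/
noncomputable def fData (N : ℕ) (ε : ℝ) (x : Space N) : ℝ :=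
  (Metric.ball (0 : Space N) (1 / exp 1)).indicator
    (fun x => ‖x‖ ^ (-(N : ℝ)) * |log ‖x‖| ^ (-(N : ℝ) / 2 - 1 + ε)) x

/-- A nonnegative function `φ` regarded as the measure `φ dx`. -/
noncomputable def toMeasure {N : ℕ} (φ : Space N → ℝ) : Measure (Space N) :=
  volume.withDensity fun x => ENNReal.ofReal (φ x)

/-! ### Verification that `subDensity` is the density `h_α` -/

theorem inv_Gamma_eq (x : ℝ) : (Gamma x)⁻¹ = x * (Gamma (x + 1))⁻¹ := by
  rcases eq_or_ne x 0 with rfl | h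
  · simp
  · rw [Real.Gamma_add_one h, mul_inv, ← mul_assoc, mul_inv_cancel₀ h, one_mul]

theorem exists_primitive (k : ℕ) : ∀ x : ℝ, ∃ Φ : ℂ → ℂ,
    (∀ w, HasDerivAt Φ ((1 + Complex.exp w) ^ k * Complex.exp (-(x * w))) w) ∧
    (∀ r : ℝ, (Φ r).im = 0) ∧
    (Φ (π * Complex.I)).im = π * (k.factorial * (Gamma (1 + x))⁻¹ * (Gamma (1 + k - x))⁻¹) := by
  induction k with
  | zero =>
    intro x
    rcases eq_or_ne x 0 with rfl | hx
    · refine ⟨fun w => w, fun w => ?_, by simp, by simp⟩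
      simpa using hasDerivAt_id' w
    · have hx' : (x : ℂ) ≠ 0 := by exact_mod_cast hx
      refine ⟨fun w => Complex.exp (-(x * w)) / (-x), fun w => ?_, fun r => ?_, ?_⟩
      · have h1 : HasDerivAt (fun w : ℂ => -((x : ℂ) * w)) (-x) w := by
          convert! ((hasDerivAt_id' w).const_mul (x : ℂ)).neg using 1
          rw [mul_one]
        have h2 := (h1.cexp).div_const (-(x : ℂ))
        convert! h2 using 1
        field_simp
        try ring
      · have : Complex.exp (-(x * (r : ℂ))) / (-x) = ((exp (-(x * r)) / (-x) : ℝ) : ℂ) := by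
          push_cast; rfl
        beta_reduce
        rw [this, Complex.ofReal_im]
      · have e : Complex.exp (-(x * (π * Complex.I))) = Complex.exp ((-(x * π) : ℝ) * Complex.I) := by
          congr 1; push_cast; ring
        have e2 : (-(x : ℂ)) = ((-x : ℝ) : ℂ) := by push_cast; rfl
        beta_reduce
        rw [e, e2, Complex.div_ofReal_im, Complex.exp_ofReal_mul_I_im]
        have g := Real.Gamma_mul_Gamma_one_sub x
        have g2 : (Gamma (1 + x))⁻¹ * (Gamma (1 - x))⁻¹ = (x * (π / sin (π * x)))⁻¹ := by
          rw [← g, add_comm, Real.Gamma_add_one hx, ← mul_inv, mul_assoc]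
        simp only [Nat.factorial_zero, Nat.cast_one, one_mul, Nat.cast_zero, add_zero]
        rw [g2, mul_inv, inv_div, Real.sin_neg, mul_comm x π]
        field_simp
  | succ k ih =>
    intro x
    obtain ⟨Φ, h1, h2, h3⟩ := ih x
    obtain ⟨Ψ, h1', h2', h3'⟩ := ih (x - 1)
    refine ⟨fun w => Φ w + Ψ w, fun w => ?_, fun r => by simp [h2, h2'], ?_⟩
    · convert! (h1 w).add (h1' w) using 1
      have : Complex.exp (-(((x - 1 : ℝ) : ℂ) * w)) = Complex.exp w * Complex.exp (-(x * w)) := by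
        rw [← Complex.exp_add]; congr 1; push_cast; ring
      rw [this]; ring
    · rw [Complex.add_im, h3, h3']
      have a1 := inv_Gamma_eq (1 + k - x)
      have a2 := inv_Gamma_eq x
      have e1 : 1 + (k : ℝ) - x + 1 = 1 + ((k + 1 : ℕ) : ℝ) - x := by push_cast; ring
      have e2 : 1 + (k : ℝ) - (x - 1) = 1 + ((k + 1 : ℕ) : ℝ) - x := by push_cast; ring
      have e3 : 1 + (x - 1) = x := by ring
      rw [e2, e3, a1, a2, e1, Nat.factorial_succ, add_comm x 1]
      push_cast; ring

section
variable {α u : ℝ}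

theorem sin_pos1 (h0 : 0 < α) (h1 : α < 1) (hu : u ∈ Ioo 0 π) : 0 < sin (α * u) :=
  sin_pos_of_pos_of_lt_pi (mul_pos h0 hu.1) (by nlinarith [hu.1, hu.2])

theorem sin_pos2 (h0 : 0 < α) (h1 : α < 1) (hu : u ∈ Ioo 0 π) : 0 < sin ((1 - α) * u) :=
  sin_pos1 (by linarith) (by linarith) hu

theorem sin_ge (h0 : 0 < α) (h1 : α < 1) (hu : u ∈ Ioo 0 π) : α * sin u ≤ sin (α * u) := by
  have := strictConcaveOn_sin_Icc.concaveOn.2 (x := u) (y := 0) ⟨hu.1.le, hu.2.le⟩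
    ⟨le_rfl, pi_pos.le⟩ h0.le (sub_nonneg.2 h1.le) (by ring)
  simpa using this

/-- the reciprocal kernel -/
noncomputable def W (α u : ℝ) : ℝ := sin u / (sin (α * u) ^ α * sin ((1 - α) * u) ^ (1 - α))

theorem W_pos (h0 : 0 < α) (h1 : α < 1) (hu : u ∈ Ioo 0 π) : 0 < W α u := by
  have := sin_pos1 h0 h1 hu
  have := sin_pos2 h0 h1 hu
  have := sin_pos_of_pos_of_lt_pi hu.1 hu.2
  unfold W; positivity

theorem stableKernel_eq (h0 : 0 < α) (h1 : α < 1) (hu : u ∈ Ioo 0 π) :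
    stableKernel α u = W α u ^ (-(1 / (1 - α))) := by
  rw [rpow_neg (W_pos h0 h1 hu).le, ← inv_rpow (W_pos h0 h1 hu).le, W, inv_div, stableKernel]

theorem stableKernel_pos (h0 : 0 < α) (h1 : α < 1) (hu : u ∈ Ioo 0 π) : 0 < stableKernel α u := by
  rw [stableKernel_eq h0 h1 hu]; exact rpow_pos_of_pos (W_pos h0 h1 hu) _

theorem W_le (h0 : 0 < α) (h1 : α < 1) (hu : u ∈ Ioo 0 π) :
    W α u ≤ (α ^ α * (1 - α) ^ (1 - α))⁻¹ := by
  have hs := sin_pos_of_pos_of_lt_pi hu.1 hu.2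
  have h1' : 0 < 1 - α := by linarith
  have a := rpow_le_rpow (by positivity) (sin_ge h0 h1 hu) h0.le
  have b := rpow_le_rpow (by positivity) (sin_ge h1' (by linarith) hu) h1'.le
  rw [mul_rpow h0.le hs.le] at a
  rw [mul_rpow h1'.le hs.le] at b
  have c : sin u ^ α * sin u ^ (1 - α) = sin u := by
    rw [← rpow_add hs]; simp
  have p1 := rpow_pos_of_pos h0 α
  have p2 := rpow_pos_of_pos h1' (1 - α)
  have q1 := rpow_pos_of_pos (sin_pos1 h0 h1 hu) α
  have q2 := rpow_pos_of_pos (sin_pos2 h0 h1 hu) (1 - α)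
  have d := mul_le_mul a b (by positivity) q1.le
  rw [W, div_le_iff₀ (by positivity), inv_mul_eq_div, le_div_iff₀ (by positivity)]
  calc _ = α ^ α * sin u ^ α * ((1 - α) ^ (1 - α) * sin u ^ (1 - α)) := by
        nth_rw 1 [← c]; ring
    _ ≤ _ := d

theorem measurable_W (α : ℝ) : Measurable (W α) := by unfold W; fun_prop

theorem measurable_stableKernel (α : ℝ) : Measurable (stableKernel α) := by unfold stableKernel; fun_prop

theorem integrableOn_W_pow (h0 : 0 < α) (h1 : α < 1) (k : ℕ) :
    IntegrableOn (fun u => W α u ^ k) (Ioo 0 π) := by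
  refine Measure.integrableOn_of_bounded (M := ((α ^ α * (1 - α) ^ (1 - α))⁻¹) ^ k)
    (by simp) ((measurable_W α).pow_const k).aestronglyMeasurable ?_
  refine (ae_restrict_iff' measurableSet_Ioo).2 (.of_forall fun u hu => ?_)
  rw [norm_pow, norm_of_nonneg (W_pos h0 h1 hu).le]
  exact pow_le_pow_left₀ (W_pos h0 h1 hu).le (W_le h0 h1 hu) k

theorem integral_W_pow (h0 : 0 < α) (h1 : α < 1) (k : ℕ) :
    ∫ u in Ioo 0 π, W α u ^ k =
      π * (k.factorial * (Gamma (1 + α * k))⁻¹ * (Gamma (1 + (1 - α) * k))⁻¹) := by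
  obtain ⟨Φ, hΦ, hr, hpi⟩ := exists_primitive k (α * k)
  have h1' : 0 < 1 - α := by linarith
  set ℓ : ℝ → ℝ := fun u => log (sin (α * u) / sin ((1 - α) * u)) with hℓ
  set γ : ℝ → ℂ := fun u => (ℓ u : ℂ) + u * Complex.I with hγ
  have key : ∀ u ∈ Ioo 0 π, (1 + Complex.exp (γ u)) ^ k * Complex.exp (-(((α * k : ℝ) : ℂ) * γ u))
      = ((W α u ^ k : ℝ) : ℂ) := by
    intro u hu
    have p1 := sin_pos1 h0 h1 hu
    have p2 := sin_pos2 h0 h1 hu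
    have p3 := sin_pos_of_pos_of_lt_pi hu.1 hu.2
    have e1 : Complex.exp (γ u) = ((sin (α * u) / sin ((1 - α) * u) : ℝ) : ℂ)
        * Complex.exp (u * Complex.I) := by
      rw [hγ]; beta_reduce
      rw [Complex.exp_add, ← Complex.ofReal_exp, hℓ]; beta_reduce
      rw [exp_log (by positivity)]
    have hu' : u = α * u + (1 - α) * u := by ring
    have e2 : 1 + Complex.exp (γ u) = ((sin u / sin ((1 - α) * u) : ℝ) : ℂ)
        * Complex.exp ((α * u : ℝ) * Complex.I) := by
      rw [e1]
      have s1 : sin u = sin (α * u) * cos ((1 - α) * u) + cos (α * u) * sin ((1 - α) * u) := by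
        rw [← sin_add]; congr 1
      have c1 : cos u = cos (α * u) * cos ((1 - α) * u) - sin (α * u) * sin ((1 - α) * u) := by
        rw [← cos_add]; congr 1
      have t1 := sin_sq_add_cos_sq (α * u)
      apply Complex.ext
      · simp only [Complex.add_re, Complex.one_re, Complex.re_ofReal_mul,
          Complex.exp_ofReal_mul_I_re]
        rw [div_mul_eq_mul_div, div_mul_eq_mul_div, eq_div_iff p2.ne', add_mul,
          div_mul_cancel₀ _ p2.ne', s1, c1]
        linear_combination (-sin ((1 - α) * u)) * t1
      · simp only [Complex.add_im, Complex.one_im, Complex.im_ofReal_mul,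
          Complex.exp_ofReal_mul_I_im]
        rw [div_mul_eq_mul_div, div_mul_eq_mul_div, zero_add]
        congr 1; ring
    have e3 : Complex.exp (-(((α * k : ℝ) : ℂ) * γ u)) =
        (((sin (α * u) / sin ((1 - α) * u)) ^ (-α) : ℝ) : ℂ) ^ k
        * Complex.exp (-((α * u : ℝ) * Complex.I)) ^ k := by
      have : -(((α * k : ℝ) : ℂ) * γ u) = k * (((ℓ u * (-α) : ℝ) : ℂ))
          + k * (-((α * u : ℝ) * Complex.I)) := by
        rw [hγ]; push_cast; ring
      rw [this, Complex.exp_add, Complex.exp_nat_mul, Complex.exp_nat_mul, ← Complex.ofReal_exp,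
        rpow_def_of_pos (by positivity)]
    have e4 : Complex.exp ((α * u : ℝ) * Complex.I) * Complex.exp (-((α * u : ℝ) * Complex.I)) = 1 := by
      rw [← Complex.exp_add]; simp
    have e5 : W α u = sin u / sin ((1 - α) * u) * (sin (α * u) / sin ((1 - α) * u)) ^ (-α) := by
      rw [W, rpow_neg (by positivity), div_rpow p1.le p2.le, rpow_sub p2, rpow_one]
      have := rpow_pos_of_pos p1 α
      have := rpow_pos_of_pos p2 α
      field_simp
    rw [e2, e3, e5]
    rw [← mul_pow, ← mul_pow, Complex.ofReal_pow,
      Complex.ofReal_mul (sin u / sin ((1 - α) * u))]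
    congr 1
    linear_combination (((sin u / sin ((1 - α) * u) : ℝ) : ℂ) *
      (((sin (α * u) / sin ((1 - α) * u)) ^ (-α) : ℝ) : ℂ)) * e4
  have hderiv : ∀ u ∈ Ioo 0 π, HasDerivAt (fun u => (Φ (γ u)).im) (W α u ^ k) u := by
    intro u hu
    have p1 := sin_pos1 h0 h1 hu
    have p2 := sin_pos2 h0 h1 hu
    have d1 : DifferentiableAt ℝ ℓ u := by
      have q1 : DifferentiableAt ℝ (fun u => sin (α * u)) u := by fun_prop
      have q2 : DifferentiableAt ℝ (fun u => sin ((1 - α) * u)) u := by fun_prop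
      exact (q1.div q2 p2.ne').log (div_pos p1 p2).ne'
    have d2 : HasDerivAt γ ((deriv ℓ u : ℝ) + Complex.I) u := by
      have a := d1.hasDerivAt.ofReal_comp
      have b := ((hasDerivAt_id' u).ofReal_comp).mul_const Complex.I
      convert! a.add b using 1
      simp
    have d3 := (hΦ (γ u)).comp u d2
    rw [key u hu] at d3
    have d4 := Complex.imCLM.hasFDerivAt.comp_hasDerivAt u d3
    convert! d4 using 1
    rw [Complex.imCLM_apply, Complex.im_ofReal_mul]
    simp
  have hcont : Continuous Φ := continuous_iff_continuousAt.2 fun w => (hΦ w).continuousAt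
  have lim : ∀ a : ℝ, Tendsto (fun u => sin (a * u) / u) (𝓝[>] 0) (𝓝 a) := by
    intro a
    have q : HasDerivAt (fun u => sin (a * u)) a 0 := by
      simpa using ((hasDerivAt_id' (0 : ℝ)).const_mul a).sin
    have := q.tendsto_slope_zero_right
    refine this.congr fun t => ?_
    simp [div_eq_inv_mul]
  have lim0 : Tendsto (fun u => (Φ (γ u)).im) (𝓝[>] 0) (𝓝 0) := by
    have l1 : Tendsto ℓ (𝓝[>] 0) (𝓝 (log (α / (1 - α)))) := by
      refine Tendsto.log ?_ (by positivity)
      refine ((lim α).div (lim (1 - α)) h1'.ne').congr' ?_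
      filter_upwards [self_mem_nhdsWithin] with u hu
      have : u ≠ 0 := (ne_of_gt hu)
      rw [Pi.div_apply, div_div_div_cancel_right₀ this]
    have l2 : Tendsto γ (𝓝[>] 0) (𝓝 ((log (α / (1 - α)) : ℝ) : ℂ)) := by
      have a := (Complex.continuous_ofReal.tendsto _).comp l1
      have b : Tendsto (fun u : ℝ => (u : ℂ) * Complex.I) (𝓝[>] 0) (𝓝 0) := by
        have : Continuous (fun u : ℝ => (u : ℂ) * Complex.I) := by fun_prop
        simpa using (this.tendsto 0).mono_left nhdsWithin_le_nhds
      simpa using! a.add b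
    have := ((Complex.continuous_im.comp hcont).tendsto _).comp l2
    simpa [Function.comp_def, hr] using this
  have limpi : Tendsto (fun u => (Φ (γ u)).im) (𝓝[<] π) (𝓝 (Φ (π * Complex.I)).im) := by
    have p1 : 0 < sin (α * π) := sin_pos_of_pos_of_lt_pi (by positivity) (by nlinarith [pi_pos])
    have p2 : sin ((1 - α) * π) = sin (α * π) := by
      rw [show (1 - α) * π = π - α * π by ring, sin_pi_sub]
    have c1 : ContinuousAt ℓ π := by
      refine ContinuousAt.log (ContinuousAt.div (by fun_prop) (by fun_prop) ?_) ?_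
      · rw [p2]; exact p1.ne'
      · rw [p2]; exact (div_pos p1 p1).ne'
    have c2 : ContinuousAt γ π :=
      (Complex.continuous_ofReal.continuousAt.comp c1).add (by fun_prop)
    have e : γ π = π * Complex.I := by
      simp only [hγ, hℓ]
      rw [p2, div_self p1.ne', log_one]; simp
    have c3 : ContinuousAt (fun u => (Φ (γ u)).im) π :=
      (Complex.continuous_im.comp hcont).continuousAt.comp c2
    have := c3.tendsto.mono_left (nhdsWithin_le_nhds (s := Iio π))
    rwa [e] at this
  have hint : IntervalIntegrable (fun u => W α u ^ k) volume 0 π := by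
    rw [intervalIntegrable_iff_integrableOn_Ioo_of_le pi_pos.le]
    exact integrableOn_W_pow h0 h1 k
  have := intervalIntegral.integral_eq_sub_of_hasDerivAt_of_tendsto pi_pos hderiv hint lim0 limpi
  rw [intervalIntegral.integral_of_le pi_pos.le, integral_Ioc_eq_integral_Ioo, sub_zero, hpi] at this
  rw [this]
  congr 4
  ring

theorem inner_integrable {θ : ℝ} (hθ : 0 < θ) (h0 : 0 < α) (h1 : α < 1) :
    IntegrableOn (fun u => stableKernel α u * exp (-stableKernel α u * θ ^ (1 / (1 - α)))) (Ioo 0 π) := by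
  have hp := rpow_pos_of_pos hθ (1 / (1 - α))
  have hm := measurable_stableKernel α
  refine Measure.integrableOn_of_bounded (M := (θ ^ (1 / (1 - α)))⁻¹)
    (by simp) (by fun_prop) ?_
  refine (ae_restrict_iff' measurableSet_Ioo).2 (.of_forall fun u hu => ?_)
  have hA := stableKernel_pos h0 h1 hu
  rw [norm_of_nonneg (by positivity), neg_mul, exp_neg, ← div_eq_mul_inv, inv_eq_one_div,
    div_le_div_iff₀ (exp_pos _) hp, one_mul]
  linarith [add_one_le_exp (stableKernel α u * θ ^ (1 / (1 - α)))]

theorem subDensity_pos {θ : ℝ} (h0 : 0 < α) (h1 : α < 1) (hθ : 0 < θ) : 0 < subDensity α θ := by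
  have h1' : 0 < 1 - α := by linarith
  have hp := rpow_pos_of_pos hθ (α / (1 - α))
  have : 0 < ∫ u in Ioo 0 π, stableKernel α u * exp (-stableKernel α u * θ ^ (1 / (1 - α))) := by
    rw [setIntegral_pos_iff_support_of_nonneg_ae _ (inner_integrable hθ h0 h1)]
    · have : Function.support (fun u => stableKernel α u * exp (-stableKernel α u * θ ^ (1 / (1 - α)))) ∩ Ioo 0 π
          = Ioo 0 π := by
        refine inter_eq_right.2 fun u hu => ?_
        have hA := stableKernel_pos h0 h1 hu
        exact (mul_pos hA (exp_pos _)).ne'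
      rw [this]; simp [pi_pos]
    · refine (ae_restrict_iff' measurableSet_Ioo).2 (.of_forall fun u hu => ?_)
      have hA := stableKernel_pos h0 h1 hu
      exact (mul_pos hA (exp_pos _)).le
  unfold subDensity; positivity

theorem measurable_subDensity (α : ℝ) : Measurable (subDensity α) := by
  have hm := measurable_stableKernel α
  have : StronglyMeasurable (fun θ : ℝ =>
      ∫ u in Ioo 0 π, stableKernel α u * exp (-stableKernel α u * θ ^ (1 / (1 - α)))) := by
    refine StronglyMeasurable.integral_prod_right' (f := fun q : ℝ × ℝ =>
      stableKernel α q.2 * exp (-stableKernel α q.2 * q.1 ^ (1 / (1 - α)))) ?_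
    exact Measurable.stronglyMeasurable (by fun_prop)
  unfold subDensity
  exact (by fun_prop : Measurable fun θ : ℝ => 1 / (π * (1 - α)) * θ ^ (α / (1 - α))).mul
    this.measurable

theorem lintegral_moment (h0 : 0 < α) (h1 : α < 1) (k : ℕ) :
    ∫⁻ θ in Ioi 0, ENNReal.ofReal (θ ^ k * subDensity α θ) =
      ENNReal.ofReal (k.factorial / Gamma (1 + α * k)) := by
  have h1' : 0 < 1 - α := by linarith
  have hm := measurable_stableKernel α
  set F : ℝ → ℝ → ℝ := fun θ u => 1 / (π * (1 - α)) * stableKernel α u *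
    (θ ^ (k + α / (1 - α)) * exp (-stableKernel α u * θ ^ (1 / (1 - α)))) with hF
  have s1 : ∀ θ ∈ Ioi (0 : ℝ), ENNReal.ofReal (θ ^ k * subDensity α θ) =
      ∫⁻ u in Ioo 0 π, ENNReal.ofReal (F θ u) := by
    intro θ hθ
    have hθ' : 0 < θ := hθ
    have e : θ ^ k * subDensity α θ = ∫ u in Ioo 0 π, F θ u := by
      rw [subDensity, ← mul_assoc, ← integral_const_mul]
      congr 1 with u
      simp only [hF]
      rw [rpow_add hθ', rpow_natCast]; ring
    have i : IntegrableOn (F θ) (Ioo 0 π) := by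
      refine ((inner_integrable hθ' h0 h1).const_mul
        (1 / (π * (1 - α)) * θ ^ (k + α / (1 - α)))).congr (.of_forall fun u => ?_)
      simp only [hF]; ring
    rw [e, ofReal_integral_eq_lintegral_ofReal i]
    refine (ae_restrict_iff' measurableSet_Ioo).2 (.of_forall fun u hu => ?_)
    have hA := stableKernel_pos h0 h1 hu
    simp only [hF, Pi.zero_apply]; positivity
  have s2 : ∀ u ∈ Ioo 0 π, ∫⁻ θ in Ioi 0, ENNReal.ofReal (F θ u) =
      ENNReal.ofReal (Gamma (1 + (1 - α) * k) / π * W α u ^ k) := by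
    intro u hu
    have hA := stableKernel_pos h0 h1 hu
    have hW := W_pos h0 h1 hu
    have hq : -1 < (k : ℝ) + α / (1 - α) := by
      have : 0 ≤ (k : ℝ) + α / (1 - α) := by positivity
      linarith
    have i := integrableOn_rpow_mul_exp_neg_mul_rpow hq (by positivity : 0 < 1 / (1 - α)) hA
    have v := integral_rpow_mul_exp_neg_mul_rpow (by positivity : 0 < 1 / (1 - α)) hq hA
    rw [← ofReal_integral_eq_lintegral_ofReal (i.const_mul _)]
    · rw [integral_const_mul, v]
      congr 1
      have e1 : ((k : ℝ) + α / (1 - α) + 1) / (1 / (1 - α)) = 1 + (1 - α) * k := by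
        field_simp; ring
      have e2 : -((k : ℝ) + α / (1 - α) + 1) / (1 / (1 - α)) = -(1 + (1 - α) * k) := by
        rw [neg_div, e1]
      have e3 : stableKernel α u ^ (-(1 + (1 - α) * k)) = (stableKernel α u)⁻¹ * W α u ^ k := by
        rw [neg_add, rpow_add hA, rpow_neg_one]
        congr 1
        rw [stableKernel_eq h0 h1 hu, ← rpow_mul hW.le, ← rpow_natCast]
        congr 1; field_simp
      rw [e1, e2, e3]
      field_simp
    · refine (ae_restrict_iff' measurableSet_Ioi).2 (.of_forall fun θ hθ => ?_)
      have hθ' : 0 < θ := hθ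
      simp only [Pi.zero_apply]; positivity
  rw [setLIntegral_congr_fun measurableSet_Ioi s1, lintegral_lintegral_swap
    (Measurable.aemeasurable (by simp only [hF, Function.uncurry_def]; fun_prop)),
    setLIntegral_congr_fun measurableSet_Ioo s2,
    ← ofReal_integral_eq_lintegral_ofReal ((integrableOn_W_pow h0 h1 k).const_mul _)]
  · rw [integral_const_mul, integral_W_pow h0 h1 k]
    congr 1
    have : 0 < Gamma (1 + (1 - α) * k) := Gamma_pos_of_pos (by positivity)
    field_simp
  · refine (ae_restrict_iff' measurableSet_Ioo).2 (.of_forall fun u hu => ?_)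
    have hW := W_pos h0 h1 hu
    have : 0 < Gamma (1 + (1 - α) * k) := Gamma_pos_of_pos (by positivity)
    simp only [Pi.zero_apply]; positivity

theorem integrable_moment (h0 : 0 < α) (h1 : α < 1) (k : ℕ) :
    IntegrableOn (fun θ => θ ^ k * subDensity α θ) (Ioi 0) := by
  have hd := measurable_subDensity α
  refine ⟨by fun_prop, ?_⟩
  rw [hasFiniteIntegral_iff_ofReal]
  · rw [lintegral_moment h0 h1]; exact ENNReal.ofReal_lt_top
  · refine (ae_restrict_iff' measurableSet_Ioi).2 (.of_forall fun θ hθ => ?_)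
    have hθ' : 0 < θ := hθ
    have := subDensity_pos h0 h1 hθ'
    simp only [Pi.zero_apply]; positivity

theorem integral_moment (h0 : 0 < α) (h1 : α < 1) (k : ℕ) :
    ∫ θ in Ioi 0, θ ^ k * subDensity α θ = k.factorial / Gamma (1 + α * k) := by
  have : 0 < Gamma (1 + α * k) := Gamma_pos_of_pos (by positivity)
  rw [integral_eq_lintegral_of_nonneg_ae _ (integrable_moment h0 h1 k).aestronglyMeasurable,
    lintegral_moment h0 h1, ENNReal.toReal_ofReal (by positivity)]
  refine (ae_restrict_iff' measurableSet_Ioi).2 (.of_forall fun θ hθ => ?_)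
  have hθ' : 0 < θ := hθ
  have := subDensity_pos h0 h1 hθ'
  simp only [Pi.zero_apply]; positivity

theorem summable_pow_div_Gamma (h0 : 0 < α) (h1 : α < 1) (r : ℝ) (hr : 0 < r) :
    Summable fun k : ℕ => r ^ k / Gamma (1 + α * k) := by
  have h1' : 0 < 1 - α := by linarith
  have G : ∀ k : ℕ, 0 < Gamma (1 + α * k) := fun k => Gamma_pos_of_pos (by positivity)
  refine summable_of_ratio_test_tendsto_lt_one zero_lt_one
    (.of_forall fun k => (div_pos (pow_pos hr k) (G k)).ne') ?_
  have bound : ∀ k : ℕ, ‖r ^ (k + 1) / Gamma (1 + α * (k + 1 : ℕ))‖ / ‖r ^ k / Gamma (1 + α * k)‖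
      ≤ r * (2 * (1 + α * k) ^ (-α)) := by
    intro k
    set x : ℝ := 1 + α * k with hx
    have hx1 : 1 ≤ x := by rw [hx]; linarith [show 0 ≤ α * (k : ℝ) by positivity]
    have hx0 : 0 < x := by linarith
    have e : 1 + α * ((k + 1 : ℕ) : ℝ) = x + α := by rw [hx]; push_cast; ring
    have gx : 0 < Gamma x := Gamma_pos_of_pos hx0
    have gy : 0 < Gamma (x + α) := Gamma_pos_of_pos (by linarith)
    have H := Gamma_mul_add_mul_le_rpow_Gamma_mul_rpow_Gamma (s := x + α) (t := x + α + 1)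
      (by linarith) (by linarith) h0 h1' (by ring)
    have e2 : α * (x + α) + (1 - α) * (x + α + 1) = x + 1 := by ring
    rw [e2, Gamma_add_one hx0.ne', Gamma_add_one (by linarith), mul_rpow (by linarith) gy.le,
      mul_left_comm, ← rpow_add gy, add_sub_cancel, rpow_one] at H
    have H2 : (x + α) ^ (1 - α) ≤ 2 * x ^ (1 - α) := by
      calc (x + α) ^ (1 - α) ≤ (2 * x) ^ (1 - α) :=
            rpow_le_rpow (by linarith) (by linarith) h1'.le
        _ = 2 ^ (1 - α) * x ^ (1 - α) := mul_rpow (by norm_num) hx0.le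
        _ ≤ _ := by
            gcongr
            calc (2 : ℝ) ^ (1 - α) ≤ 2 ^ (1 : ℝ) :=
                  rpow_le_rpow_of_exponent_le (by norm_num) (by linarith)
              _ = 2 := rpow_one _
    rw [e, norm_of_nonneg (by positivity), norm_of_nonneg (by positivity)]
    have H3 : Gamma x / Gamma (x + α) ≤ 2 * x ^ (-α) := by
      rw [div_le_iff₀ gy]
      have : x ^ (-α) = x ^ (1 - α) / x := by
        rw [show -α = (1 - α) - 1 by ring, rpow_sub_one hx0.ne']
      rw [this]
      have : x * Gamma x ≤ 2 * x ^ (1 - α) * Gamma (x + α) :=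
        H.trans (by gcongr)
      calc Gamma x = (x * Gamma x) / x := by field_simp
        _ ≤ (2 * x ^ (1 - α) * Gamma (x + α)) / x := by gcongr
        _ = _ := by ring
    calc r ^ (k + 1) / Gamma (x + α) / (r ^ k / Gamma x) = r * (Gamma x / Gamma (x + α)) := by
          field_simp
          ring
      _ ≤ _ := by gcongr
  refine squeeze_zero (fun k => by positivity) bound ?_
  have t : Tendsto (fun k : ℕ => 1 + α * (k : ℝ)) atTop atTop :=
    tendsto_atTop_add_const_left _ _ (tendsto_natCast_atTop_atTop.const_mul_atTop h0)
  simpa using (((tendsto_rpow_neg_atTop h0).comp t).const_mul 2).const_mul r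

theorem integral_subDensity_exp (h0 : 0 < α) (h1 : α < 1) (z : ℂ) :
    HasSum (fun k : ℕ => z ^ k / Complex.Gamma (α * k + 1))
      (∫ θ in Ioi (0 : ℝ), (subDensity α θ : ℂ) * Complex.exp (z * θ)) := by
  have hd := measurable_subDensity α
  set F : ℕ → ℝ → ℂ := fun k θ => (z ^ k / k.factorial) * ((θ ^ k * subDensity α θ : ℝ) : ℂ) with hF
  have G : ∀ k : ℕ, 0 < Gamma (1 + α * k) := fun k => Gamma_pos_of_pos (by positivity)
  have i : ∀ k, Integrable (F k) (volume.restrict (Ioi 0)) := fun k =>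
    ((integrable_moment h0 h1 k).ofReal).const_mul _
  have n : ∀ k, ∫ θ in Ioi 0, ‖F k θ‖ = ‖z‖ ^ k / Gamma (1 + α * k) := by
    intro k
    have : ∀ θ ∈ Ioi (0 : ℝ), ‖F k θ‖ = ‖z‖ ^ k / k.factorial * (θ ^ k * subDensity α θ) := by
      intro θ hθ
      have hθ' : 0 < θ := hθ
      have := subDensity_pos h0 h1 hθ'
      simp only [hF]
      rw [norm_mul, norm_div, norm_pow, Complex.norm_natCast, Complex.norm_real,
        norm_of_nonneg (by positivity)]
    rw [setIntegral_congr_fun measurableSet_Ioi this, integral_const_mul, integral_moment h0 h1]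
    have := G k
    field_simp
  have S : Summable fun k => ∫ θ in Ioi 0, ‖F k θ‖ := by
    simp_rw [n]
    refine (summable_pow_div_Gamma h0 h1 (‖z‖ + 1) (by positivity)).of_nonneg_of_le
      (fun k => div_nonneg (by positivity) (G k).le) fun k => ?_
    have := G k
    gcongr
    linarith
  have H := hasSum_integral_of_summable_integral_norm i S
  convert! H using 1
  · ext k
    simp only [hF]
    rw [integral_const_mul, integral_complex_ofReal, integral_moment h0 h1]
    have : Complex.Gamma (α * k + 1) = ((Gamma (1 + α * k) : ℝ) : ℂ) := by
      rw [← Complex.Gamma_ofReal]; congr 1; push_cast; ring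
    rw [this]
    have := (G k).ne'
    have f : (k.factorial : ℂ) ≠ 0 := by exact_mod_cast k.factorial_ne_zero
    push_cast
    field_simp
  · refine setIntegral_congr_fun measurableSet_Ioi fun θ _ => ?_
    have := (NormedSpace.expSeries_div_hasSum_exp (z * θ)).mul_left (subDensity α θ : ℂ)
    rw [← Complex.exp_eq_exp_ℂ] at this
    rw [← this.tsum_eq]
    congr 1 with k
    simp only [hF]
    push_cast
    ring

/-- `∫_0^∞ h_α(θ) exp(zθ) dθ = E_{α,1}(z)`. -/
theorem integral_subDensity_mul_exp (h0 : 0 < α) (h1 : α < 1) (z : ℂ) :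
    ∫ θ in Ioi (0 : ℝ), (subDensity α θ : ℂ) * Complex.exp (z * θ) = mittagLeffler α 1 z :=
  (integral_subDensity_exp h0 h1 z).tsum_eq.symm

end

end TimeFracHeat

namespace TimeFracHeat

/-! ### The Gauss kernel -/

section HeatKernel
variable {N : ℕ}

/-! The life span is governed by the mass of the datum at the parabolic scale, compared with the
threshold `(1-α)^(N/2)`. Up to constants, a solution on `[0,T]` forces `μ(B(0,σ)) ≲ (1-α)^(N/2)` for
a radius `σ` slightly below `T^(α/2)`, while the analogous smallness of `e^{T^α Δ} μ` at time `T^α`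
suffices for existence. For `κ f_ε` the mass in `B(0,σ)` is of order `κ (-log σ)^(-(N/2-ε))`.
Equating this with the threshold gives `-log σ` of order `κ^(2/(N-2ε)) (1-α)^(-N/(N-2ε))`, and `log
T` is `2/α` times `log σ` up to lower order terms.

Necessity (`exists_ball_le_of_isSolution`). Integrating the equation over `B(0, t^(α/2))` gives a
Volterra inequality between `U(t) = ∫ u` and `V(t) = ∫ u^p` over that ball, and Young's inequality
bounds `U` by `V` plus the volume of the ball. Testing against `t^(-α) log(S/t)^(N/2)` on the window
`(S e^(-1/(1-α)), S)`, where `t^(1-α)` is constant up to a factor `e`, lets the `V` terms cancel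
(`le_of_integral_inequality`). The window has logarithmic length `1/(1-α)`, whose power `-N/2` is
the threshold. The factor `e^(-1/(1-α))` by which the scale shrinks is harmless: since `ε > 0`, the
rate dominates `1/(1-α)` as `α → 1`.

Sufficiency (`exists_forall_isMinimalSolution`). With `l = T^α`, the Picard iterates satisfy `sup_z
∫ u(t)^p G(l, z-x) dx ≤ K^p l t^(-α)`. Such a bound is at the same time a bound on `e^{lΔ}(u(t)^p)`,
so one smoothing estimate serves both the linear and the Duhamel term. At the Fujita exponent the
singularity `s^(-α)` in the Duhamel integral is integrable only because `α < 1`, at the price of the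
factor `1/(1-α)`; this is why the smallness condition contains `1-α`. The remaining constants must
not depend on `α`, which rests on moments of `h_α` uniform for `α ≥ 1/2`, including the negative
moment of order `-1/p`. -/

theorem heatKernel_nonneg {t : ℝ} (ht : 0 ≤ t) (x : Space N) : 0 ≤ heatKernel t x := by
  unfold heatKernel; positivity

theorem measurable_heatKernel :
    Measurable fun q : ℝ × Space N => heatKernel q.1 q.2 := by
  unfold heatKernel; fun_prop

theorem heatKernel_sub_comm (t : ℝ) (x y : Space N) : heatKernel t (x - y) = heatKernel t (y - x) := by
  rw [heatKernel, heatKernel, norm_sub_rev]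

theorem lintegral_exp_neg_mul_sq_norm_sub {b : ℝ} (hb : 0 < b) (w : Space N) :
    ∫⁻ x : Space N, ENNReal.ofReal (exp (-b * ‖x - w‖ ^ 2)) =
      ENNReal.ofReal ((π / b) ^ ((N : ℝ) / 2)) := by
  have h := GaussianFourier.integral_rexp_neg_mul_sq_norm (V := Space N) hb
  rw [finrank_euclideanSpace_fin] at h
  rw [lintegral_sub_right_eq_self (fun x : Space N => ENNReal.ofReal (exp (-b * ‖x‖ ^ 2))) w, ← h,
    ofReal_integral_eq_lintegral_ofReal]
  · by_contra hc
    rw [integral_undef hc] at h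
    have : 0 < (π / b) ^ ((N : ℝ) / 2) := by positivity
    linarith
  · exact .of_forall fun x => (exp_pos _).le

theorem lintegral_heatKernel {t : ℝ} (ht : 0 < t) (y : Space N) :
    ∫⁻ x : Space N, ENNReal.ofReal (heatKernel t (x - y)) = 1 := by
  have : ∀ x : Space N, ENNReal.ofReal (heatKernel t (x - y)) =
      ENNReal.ofReal (1 / (4 * π * t) ^ ((N : ℝ) / 2)) *
        ENNReal.ofReal (exp (-(1 / (4 * t)) * ‖x - y‖ ^ 2)) := by
    intro x
    rw [← ENNReal.ofReal_mul (by positivity), heatKernel]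
    congr 3; ring
  simp_rw [this]
  rw [lintegral_const_mul _ (by fun_prop), lintegral_exp_neg_mul_sq_norm_sub (by positivity),
    ← ENNReal.ofReal_mul (by positivity), ← ENNReal.ofReal_one]
  congr 1
  have e : π / (1 / (4 * t)) = 4 * π * t := by field_simp
  rw [e, one_div, inv_mul_cancel₀ (by positivity)]

/-- The convolution identity `G(s) * G(t) = G(s+t)`. -/
theorem lintegral_heatKernel_mul {s t : ℝ} (hs : 0 < s) (ht : 0 < t) (z y : Space N) :
    ∫⁻ x : Space N, ENNReal.ofReal (heatKernel s (z - x)) * ENNReal.ofReal (heatKernel t (x - y)) =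
      ENNReal.ofReal (heatKernel (s + t) (z - y)) := by
  have hst : 0 < s + t := by positivity
  -- Completing the square: as a function of `x`, the product of the two Gaussians is a Gaussian
  -- centred at this weighted mean of `z` and `y`.
  set w : Space N := (t / (s + t)) • z + (s / (s + t)) • y with hw
  have key : ∀ x : Space N, -‖z - x‖ ^ 2 / (4 * s) + -‖x - y‖ ^ 2 / (4 * t) =
      -((s + t) / (4 * s * t)) * ‖x - w‖ ^ 2 + -‖z - y‖ ^ 2 / (4 * (s + t)) := by
    intro x
    obtain ⟨a, ha⟩ : ∃ a, a = z - x := ⟨_, rfl⟩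
    obtain ⟨b, hb⟩ : ∃ b, b = x - y := ⟨_, rfl⟩
    have e1 : z - y = a + b := by rw [ha, hb]; abel
    have e2 : x - w = (s / (s + t)) • b - (t / (s + t)) • a := by
      have : (1 : ℝ) = t / (s + t) + s / (s + t) := by field_simp; ring
      have hx : x = (t / (s + t)) • x + (s / (s + t)) • x := by
        rw [← add_smul, ← this, one_smul]
      rw [hw, ha, hb, smul_sub, smul_sub]
      nth_rw 1 [hx]
      abel
    rw [← ha, ← hb, e1, e2, norm_add_sq_real, norm_sub_sq_real, norm_smul, norm_smul, inner_smul_left,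
      inner_smul_right, real_inner_comm a b, norm_of_nonneg (by positivity : 0 ≤ s / (s + t)),
      norm_of_nonneg (by positivity : 0 ≤ t / (s + t))]
    simp only [conj_trivial]
    field_simp
    ring
  have : ∀ x : Space N,
      ENNReal.ofReal (heatKernel s (z - x)) * ENNReal.ofReal (heatKernel t (x - y)) =
      ENNReal.ofReal (1 / (4 * π * s) ^ ((N : ℝ) / 2) * (1 / (4 * π * t) ^ ((N : ℝ) / 2)) *
        exp (-‖z - y‖ ^ 2 / (4 * (s + t)))) *
        ENNReal.ofReal (exp (-((s + t) / (4 * s * t)) * ‖x - w‖ ^ 2)) := by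
    intro x
    rw [← ENNReal.ofReal_mul (heatKernel_nonneg hs.le _), ← ENNReal.ofReal_mul (by positivity),
      heatKernel, heatKernel]
    congr 1
    have := congrArg exp (key x)
    rw [exp_add, exp_add] at this
    linear_combination (1 / (4 * π * s) ^ ((N : ℝ) / 2) * (1 / (4 * π * t) ^ ((N : ℝ) / 2))) * this
  simp_rw [this]
  rw [lintegral_const_mul _ (by fun_prop), lintegral_exp_neg_mul_sq_norm_sub (by positivity),
    ← ENNReal.ofReal_mul (by positivity), heatKernel]
  congr 1
  have e : (4 * π * s) ^ ((N : ℝ) / 2) * (4 * π * t) ^ ((N : ℝ) / 2) =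
      (π / ((s + t) / (4 * s * t))) ^ ((N : ℝ) / 2) * (4 * π * (s + t)) ^ ((N : ℝ) / 2) := by
    rw [← mul_rpow (by positivity) (by positivity), ← mul_rpow (by positivity) (by positivity)]
    congr 1
    field_simp
  have p1 : 0 < (4 * π * s) ^ ((N : ℝ) / 2) := by positivity
  have p2 : 0 < (4 * π * t) ^ ((N : ℝ) / 2) := by positivity
  have p3 : 0 < (4 * π * (s + t)) ^ ((N : ℝ) / 2) := by positivity
  generalize (π / ((s + t) / (4 * s * t))) ^ ((N : ℝ) / 2) = q at e ⊢
  field_simp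
  linear_combination -e

/-- The exponential factor increases with time, so only the ratio of the normalizing factors is
lost. -/
theorem heatKernel_le_mul {s t : ℝ} (hs : 0 < s) (hst : s ≤ t) (x : Space N) :
    heatKernel s x ≤ (t / s) ^ ((N : ℝ) / 2) * heatKernel t x := by
  have ht : 0 < t := hs.trans_le hst
  have e : (t / s) ^ ((N : ℝ) / 2) * (1 / (4 * π * t) ^ ((N : ℝ) / 2)) =
      1 / (4 * π * s) ^ ((N : ℝ) / 2) := by
    rw [one_div, one_div, ← inv_rpow (by positivity), ← inv_rpow (by positivity),
      ← mul_rpow (by positivity) (by positivity)]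
    congr 1
    field_simp
  rw [heatKernel, heatKernel, ← mul_assoc, e]
  gcongr 1 / (4 * π * s) ^ ((N : ℝ) / 2) * ?_
  rw [exp_le_exp, neg_div, neg_div, neg_le_neg_iff]
  gcongr

end HeatKernel

/-! ### Elementary measure theory -/

theorem lintegral_inv_Ioo {a b : ℝ} (ha : 0 < a) (hab : a ≤ b) :
    ∫⁻ t in Ioo a b, ENNReal.ofReal t⁻¹ = ENNReal.ofReal (log (b / a)) := by
  have hb : 0 < b := ha.trans_le hab
  have hi : IntervalIntegrable (fun t : ℝ => t⁻¹) volume a b :=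
    intervalIntegral.intervalIntegrable_inv (fun x hx => by
      rw [uIcc_of_le hab] at hx; exact (ha.trans_le hx.1).ne') continuousOn_id
  rw [← integral_inv_of_pos ha hb, intervalIntegral.integral_of_le hab, integral_Ioc_eq_integral_Ioo,
    ofReal_integral_eq_lintegral_ofReal]
  · exact (intervalIntegrable_iff_integrableOn_Ioo_of_le hab).1 hi
  · exact (ae_restrict_iff' measurableSet_Ioo).2
      (.of_forall fun t ht => (inv_pos.2 (ha.trans ht.1)).le)

/-- Integration of radial functions in polar coordinates. -/
theorem lintegral_radial {N : ℕ} (hN : 1 ≤ N) {f : ℝ → ℝ≥0∞} (hf : Measurable f) :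
    ∫⁻ x : Space N, f ‖x‖ = N * volume (Metric.ball (0 : Space N) 1) *
      ∫⁻ r in Ioi (0 : ℝ), ENNReal.ofReal (r ^ (N - 1)) * f r := by
  have : Nontrivial (Space N) := by
    have : Nonempty (Fin N) := ⟨⟨0, hN⟩⟩
    infer_instance
  have hd : Module.finrank ℝ (Space N) = N := finrank_euclideanSpace_fin
  set μ : Measure (Space N) := volume
  calc
    ∫⁻ x, f ‖x‖ ∂μ = ∫⁻ x : ({(0)}ᶜ : Set (Space N)), f ‖x.1‖ ∂(μ.comap (↑)) := by
      rw [lintegral_subtype_comap (measurableSet_singleton _).compl fun x => f ‖x‖,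
        restrict_compl_singleton]
    _ = ∫⁻ x, f x.2 ∂μ.toSphere.prod (.volumeIoiPow (Module.finrank ℝ (Space N) - 1)) := by
      simpa using μ.measurePreserving_homeomorphUnitSphereProd.lintegral_comp_emb
        (Homeomorph.measurableEmbedding _) (f ∘ Subtype.val ∘ Prod.snd)
    _ = μ.toSphere univ * ∫⁻ x : Ioi (0 : ℝ), f x
          ∂.volumeIoiPow (Module.finrank ℝ (Space N) - 1) := by
      rw [lintegral_prod _ (by fun_prop)]
      simp only [lintegral_const]
      rw [mul_comm]
    _ = _ := by
      rw [μ.toSphere_apply_univ, hd, Measure.volumeIoiPow,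
        lintegral_withDensity_eq_lintegral_mul _ (by fun_prop) (by fun_prop)]
      congr 1
      simp only [Pi.mul_apply]
      rw [lintegral_subtype_comap measurableSet_Ioi fun r : ℝ => ENNReal.ofReal (r ^ (N - 1)) * f r]

/-- An integral form of Minkowski's inequality. -/
theorem lintegral_lintegral_rpow_le {Ω X : Type*} [MeasurableSpace Ω] [MeasurableSpace X]
    {ν : Measure Ω} {γ : Measure X} [SFinite ν] [SFinite γ] {p : ℝ} (hp : 1 < p)
    {E : Ω → X → ℝ≥0∞} (hE : Measurable (Function.uncurry E)) {b : Ω → ℝ≥0∞} (hb : Measurable b)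
    (hb0 : ∀ᵐ ω ∂ν, b ω ≠ 0) (hbt : ∀ᵐ ω ∂ν, b ω ≠ ∞)
    (h : ∀ᵐ ω ∂ν, ∫⁻ x, E ω x ^ p ∂γ ≤ b ω ^ p) :
    ∫⁻ x, (∫⁻ ω, E ω x ∂ν) ^ p ∂γ ≤ (∫⁻ ω, b ω ∂ν) ^ p := by
  have hpq : p.HolderConjugate (p / (p - 1)) := Real.HolderConjugate.conjExponent hp
  set q := p / (p - 1) with hq
  have hq0 : 0 < q := hpq.symm.pos
  have hp0 : 0 < p := hpq.pos
  have hpq1 : p / q = p - 1 := by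
    rw [hq]; field_simp [(sub_pos.2 hp).ne']
  -- Hölder applied to `E = (b^(-1/q) E) · b^(1/q)`. After integration in `x` the hypothesis turns
  -- `b^(-(p-1)) b^p` into `b`, which supplies the missing factor `∫ b`.
  have point : ∀ x, (∫⁻ ω, E ω x ∂ν) ^ p ≤
      (∫⁻ ω, b ω ∂ν) ^ (p - 1) * ∫⁻ ω, b ω ^ (-(p / q)) * E ω x ^ p ∂ν := by
    intro x
    have hEx : Measurable fun ω => E ω x := hE.comp (measurable_id.prodMk measurable_const)
    have e : ∫⁻ ω, E ω x ∂ν = ∫⁻ ω, (b ω ^ (-(1 / q)) * E ω x) * b ω ^ (1 / q) ∂ν := by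
      refine lintegral_congr_ae ?_
      filter_upwards [hb0, hbt] with ω h0 ht
      rw [mul_right_comm, ← ENNReal.rpow_add _ _ h0 ht, neg_add_cancel, ENNReal.rpow_zero, one_mul]
    have H := ENNReal.lintegral_mul_le_Lp_mul_Lq ν hpq
      (f := fun ω => b ω ^ (-(1 / q)) * E ω x) (g := fun ω => b ω ^ (1 / q))
      (by fun_prop) (by fun_prop)
    simp only [Pi.mul_apply] at H
    rw [← e] at H
    refine (ENNReal.rpow_le_rpow H hp0.le).trans ?_
    rw [ENNReal.mul_rpow_of_nonneg _ _ hp0.le, ← ENNReal.rpow_mul, ← ENNReal.rpow_mul,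
      one_div_mul_cancel hp0.ne', ENNReal.rpow_one, mul_comm]
    have e1 : 1 / q * p = p - 1 := by rw [← hpq1]; ring
    rw [e1]
    refine mul_le_mul' (le_of_eq ?_) (le_of_eq ?_)
    · congr 1
      refine lintegral_congr fun ω => ?_
      rw [← ENNReal.rpow_mul, one_div_mul_cancel hq0.ne', ENNReal.rpow_one]
    · refine lintegral_congr fun ω => ?_
      rw [ENNReal.mul_rpow_of_nonneg _ _ hp0.le, ← ENNReal.rpow_mul]
      congr 2; ring
  have hE2 : Measurable (Function.uncurry fun (x : X) (ω : Ω) => b ω ^ (-(p / q)) * E ω x ^ p) := by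
    have : Measurable fun z : X × Ω => E z.2 z.1 := hE.comp measurable_swap
    simp only [Function.uncurry_def]
    fun_prop
  calc ∫⁻ x, (∫⁻ ω, E ω x ∂ν) ^ p ∂γ
      ≤ ∫⁻ x, (∫⁻ ω, b ω ∂ν) ^ (p - 1) * ∫⁻ ω, b ω ^ (-(p / q)) * E ω x ^ p ∂ν ∂γ :=
        lintegral_mono point
    _ = (∫⁻ ω, b ω ∂ν) ^ (p - 1) * ∫⁻ x, ∫⁻ ω, b ω ^ (-(p / q)) * E ω x ^ p ∂ν ∂γ :=
        lintegral_const_mul _ hE2.lintegral_prod_right'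
    _ = (∫⁻ ω, b ω ∂ν) ^ (p - 1) * ∫⁻ ω, ∫⁻ x, b ω ^ (-(p / q)) * E ω x ^ p ∂γ ∂ν := by
        rw [lintegral_lintegral_swap hE2.aemeasurable]
    _ ≤ (∫⁻ ω, b ω ∂ν) ^ (p - 1) * ∫⁻ ω, b ω ∂ν := by
        gcongr 1
        refine lintegral_mono_ae ?_
        filter_upwards [hb0, hbt, h] with ω h0 ht hω
        have hEx : Measurable fun x => E ω x := hE.comp (measurable_const.prodMk measurable_id)
        rw [lintegral_const_mul _ (by fun_prop)]
        calc _ ≤ b ω ^ (-(p / q)) * b ω ^ p := by gcongr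
          _ = b ω := by
            rw [← ENNReal.rpow_add _ _ h0 ht, hpq1]
            ring_nf
            rw [ENNReal.rpow_one]
    _ = (∫⁻ ω, b ω ∂ν) ^ p := by
        nth_rw 2 [← ENNReal.rpow_one (∫⁻ ω, b ω ∂ν)]
        rw [← ENNReal.rpow_add_of_nonneg _ _ (sub_pos.2 hp).le zero_le_one, sub_add_cancel]

/-! ### Moments of the density `h_α`, uniformly in `α ∈ [1/2, 1)` -/

/-- On `[2,∞)` this is monotonicity. On `[3/2,2]`, convexity between `x` and `3` with `Γ(2) = 1`,
`Γ(3) = 2` gives `Γ(x) ≥ x - 1`. For `α ≥ 1/2` it controls the moments `k!/Γ(1+αk)`, `k = 1, 2`,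
uniformly. -/
theorem half_le_Gamma {x : ℝ} (hx : 3 / 2 ≤ x) : 1 / 2 ≤ Gamma x := by
  rcases le_or_gt 2 x with h | h
  · have := Gamma_strictMonoOn_Ici.monotoneOn (by simp) h h
    rw [Gamma_two] at this
    linarith
  · have h3 : Gamma 3 = 2 := by
      rw [show (3 : ℝ) = 2 + 1 by norm_num, Gamma_add_one two_ne_zero, Gamma_two, mul_one]
    have hx3 : 0 < 3 - x := by linarith
    obtain ⟨-, H⟩ := convexOn_Gamma
    have := H (show x ∈ Ioi 0 by simp; linarith) (show (3 : ℝ) ∈ Ioi 0 by simp)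
      (show 0 ≤ 1 / (3 - x) by positivity) (show 0 ≤ (2 - x) / (3 - x) from
      div_nonneg (by linarith) hx3.le) (by field_simp; ring)
    simp only [smul_eq_mul] at this
    rw [show 1 / (3 - x) * x + (2 - x) / (3 - x) * 3 = 2 by field_simp; ring, Gamma_two, h3,
      div_mul_eq_mul_div, div_mul_eq_mul_div, ← add_div, le_div_iff₀ hx3] at this
    linarith

theorem Gamma_le_one {x : ℝ} (h1 : 1 ≤ x) (h2 : x ≤ 2) : Gamma x ≤ 1 := by
  obtain ⟨-, H⟩ := convexOn_Gamma
  have := H (show (1 : ℝ) ∈ Ioi 0 by simp) (show (2 : ℝ) ∈ Ioi 0 by simp)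
      (show 0 ≤ 2 - x by linarith) (show 0 ≤ x - 1 by linarith) (by ring)
  simp only [smul_eq_mul] at this
  rw [Gamma_one, Gamma_two] at this
  rw [show (2 - x) * 1 + (x - 1) * 2 = x by ring] at this
  linarith

section Density
variable {α : ℝ}

theorem subDensity_nonneg (h0 : 0 < α) (h1 : α < 1) {θ : ℝ} (hθ : θ ∈ Ioi (0 : ℝ)) :
    0 ≤ subDensity α θ := (subDensity_pos h0 h1 hθ).le

theorem lintegral_subDensity (h0 : 0 < α) (h1 : α < 1) :
    ∫⁻ θ in Ioi 0, ENNReal.ofReal (subDensity α θ) = 1 := by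
  have := lintegral_moment h0 h1 0
  simpa using this

theorem lintegral_mul_subDensity_le (h0 : 1 / 2 ≤ α) (h1 : α < 1) :
    ∫⁻ θ in Ioi 0, ENNReal.ofReal (θ * subDensity α θ) ≤ 2 := by
  have := lintegral_moment (by linarith) h1 1
  simp only [pow_one] at this
  rw [this, show (2 : ℝ≥0∞) = ENNReal.ofReal 2 by simp]
  have g : 1 / 2 ≤ Gamma (1 + α * (1 : ℕ)) := half_le_Gamma (by push_cast; linarith)
  refine ENNReal.ofReal_le_ofReal ?_
  rw [div_le_iff₀ (lt_of_lt_of_le (by norm_num) g)]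
  simp at g ⊢
  linarith

theorem one_le_lintegral_mul_subDensity (h0 : 0 < α) (h1 : α < 1) :
    1 ≤ ∫⁻ θ in Ioi 0, ENNReal.ofReal (θ * subDensity α θ) := by
  have := lintegral_moment h0 h1 1
  simp only [pow_one] at this
  rw [this, ← ENNReal.ofReal_one]
  have g : Gamma (1 + α * (1 : ℕ)) ≤ 1 := Gamma_le_one (by simp; linarith) (by simp; linarith)
  have g0 : 0 < Gamma (1 + α * (1 : ℕ)) := Gamma_pos_of_pos (by positivity)
  refine ENNReal.ofReal_le_ofReal ?_
  rw [le_div_iff₀ g0]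
  simp at g ⊢
  linarith

theorem lintegral_sq_mul_subDensity_le (h0 : 1 / 2 ≤ α) (h1 : α < 1) :
    ∫⁻ θ in Ioi 0, ENNReal.ofReal (θ * (θ * subDensity α θ)) ≤ 4 := by
  have := lintegral_moment (by linarith) h1 2
  simp only [pow_two, mul_assoc] at this
  rw [this, show (4 : ℝ≥0∞) = ENNReal.ofReal 4 by simp]
  have g : 1 / 2 ≤ Gamma (1 + α * (2 : ℕ)) := half_le_Gamma (by push_cast; linarith)
  refine ENNReal.ofReal_le_ofReal ?_
  rw [div_le_iff₀ (lt_of_lt_of_le (by norm_num) g)]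
  simp [Nat.factorial] at g ⊢
  linarith

/-- Markov's inequality: a weight of mass at least `1` and first moment at most `4` has mass at
least `1/2` on `(0,9)`. -/
theorem half_le_lintegral_Ioo {w : ℝ → ℝ} (hw : Measurable w) (hw0 : ∀ θ ∈ Ioi (0 : ℝ), 0 ≤ w θ)
    (h1 : 1 ≤ ∫⁻ θ in Ioi 0, ENNReal.ofReal (w θ))
    (h4 : ∫⁻ θ in Ioi 0, ENNReal.ofReal (θ * w θ) ≤ 4) :
    1 / 2 ≤ ∫⁻ θ in Ioo 0 9, ENNReal.ofReal (w θ) := by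
  have e : Ioi (0 : ℝ) = Ioo 0 9 ∪ Ici 9 := (Ioo_union_Ici_eq_Ioi (by norm_num)).symm
  have d : Disjoint (Ioo (0 : ℝ) 9) (Ici 9) := by
    rw [Set.disjoint_left]; intro x hx hx'; exact absurd hx.2 (not_lt.2 hx')
  -- The mass beyond `9` is at most `4/9`, which leaves at least `5/9` on `(0,9)`.
  have t : 9 * ∫⁻ θ in Ici 9, ENNReal.ofReal (w θ) ≤ 4 := by
    refine le_trans ?_ h4
    rw [← lintegral_const_mul _ (by fun_prop)]
    refine le_trans ?_ (lintegral_mono_set (Ici_subset_Ioi.2 (by norm_num) :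
      Ici (9 : ℝ) ⊆ Ioi 0))
    refine setLIntegral_mono' measurableSet_Ici fun θ hθ => ?_
    have hθ' : 9 ≤ θ := hθ
    rw [show (9 : ℝ≥0∞) = ENNReal.ofReal 9 by simp, ← ENNReal.ofReal_mul (by norm_num)]
    refine ENNReal.ofReal_le_ofReal ?_
    have := hw0 θ (show 0 < θ by linarith)
    gcongr
  rw [e, lintegral_union measurableSet_Ici d] at h1
  generalize ∫⁻ θ in Ioo 0 9, ENNReal.ofReal (w θ) = a at h1 ⊢
  generalize ∫⁻ θ in Ici 9, ENNReal.ofReal (w θ) = b at h1 t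
  have hb : b ≠ ∞ := by
    rintro h; rw [h] at t; simp at t
  rcases eq_or_ne a ∞ with ha | ha
  · rw [ha]; exact le_top
  lift a to NNReal using ha
  lift b to NNReal using hb
  have t' : 9 * (b : ℝ) ≤ 4 := by exact_mod_cast t
  have h1' : 1 ≤ (a : ℝ) + b := by exact_mod_cast h1
  have : (1 / 2 : NNReal) ≤ a := by
    rw [← NNReal.coe_le_coe]; push_cast; linarith
  calc (1 / 2 : ℝ≥0∞) = ((1 / 2 : NNReal) : ℝ≥0∞) := by
        rw [ENNReal.coe_div two_ne_zero]; simp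
    _ ≤ a := by exact_mod_cast this

theorem half_le_lintegral_subDensity (h0 : 1 / 2 ≤ α) (h1 : α < 1) :
    1 / 2 ≤ ∫⁻ θ in Ioo 0 9, ENNReal.ofReal (subDensity α θ) := by
  refine half_le_lintegral_Ioo (measurable_subDensity α)
    (fun θ hθ => subDensity_nonneg (by linarith) h1 hθ) (lintegral_subDensity (by linarith) h1).ge
    ((lintegral_mul_subDensity_le h0 h1).trans (by norm_num))

theorem half_le_lintegral_mul_subDensity (h0 : 1 / 2 ≤ α) (h1 : α < 1) :
    1 / 2 ≤ ∫⁻ θ in Ioo 0 9, ENNReal.ofReal (θ * subDensity α θ) := by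
  have := measurable_subDensity α
  refine half_le_lintegral_Ioo (by fun_prop)
    (fun θ hθ => mul_nonneg (le_of_lt hθ) (subDensity_nonneg (by linarith) h1 hθ))
    (one_le_lintegral_mul_subDensity (by linarith) h1) (lintegral_sq_mul_subDensity_le h0 h1)

/-- The denominator of `W` is a product of powers of numbers in `(0,1]`. The point is a minorant
independent of `α`, since `W` will be raised to a negative power. -/
theorem sin_le_W {u : ℝ} (h0 : 0 < α) (h1 : α < 1) (hu : u ∈ Ioo 0 π) : sin u ≤ W α u := by
  have p1 := sin_pos1 h0 h1 hu
  have p2 := sin_pos2 h0 h1 hu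
  have p3 := sin_pos_of_pos_of_lt_pi hu.1 hu.2
  have a1 := rpow_le_one p1.le (sin_le_one _) h0.le
  have a2 := rpow_le_one p2.le (sin_le_one ((1 - α) * u)) (sub_pos.2 h1).le
  have b1 := rpow_pos_of_pos p1 α
  have b2 := rpow_pos_of_pos p2 (1 - α)
  rw [W, le_div_iff₀ (by positivity)]
  exact mul_le_of_le_one_right p3.le (mul_le_one₀ a1 b2.le a2)

/-- Jordan's inequality `sin u ≥ 2u/π` on the first half of the interval, and its reflection on the
second, reduce this to integrable powers at the two endpoints. -/
theorem lintegral_sin_rpow_lt_top {s : ℝ} (hs : -1 < s) (hs0 : s ≤ 0) :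
    ∫⁻ u in Ioo 0 π, ENNReal.ofReal (sin u ^ s) < ∞ := by
  have hI : IntegrableOn (fun u : ℝ => u ^ s) (Ioo 0 π) :=
    (intervalIntegrable_iff_integrableOn_Ioo_of_le pi_pos.le).1
      (intervalIntegral.intervalIntegrable_rpow' hs)
  have hJ : IntegrableOn (fun u : ℝ => (π - u) ^ s) (Ioo 0 π) := by
    have := (intervalIntegral.intervalIntegrable_rpow' (a := 0) (b := π) hs).comp_sub_left π
    simp only [sub_zero, sub_self] at this
    exact (intervalIntegrable_iff_integrableOn_Ioo_of_le pi_pos.le).1 this.symm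
  have hK : IntegrableOn (fun u : ℝ => (2 / π) ^ s * u ^ s + (2 / π) ^ s * (π - u) ^ s) (Ioo 0 π) :=
    (hI.const_mul _).add (hJ.const_mul _)
  refine lt_of_le_of_lt (setLIntegral_mono' measurableSet_Ioo fun u hu => ?_)
    (hasFiniteIntegral_iff_ofReal ?_ |>.1 hK.2)
  · refine ENNReal.ofReal_le_ofReal ?_
    have hu0 : 0 < u := hu.1
    have hu1 : 0 < π - u := sub_pos.2 hu.2
    rcases le_total u (π / 2) with h | h
    · have := mul_le_sin hu.1.le h
      have q := rpow_le_rpow_of_nonpos (by positivity) this hs0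
      rw [mul_rpow (by positivity) hu0.le] at q
      have : 0 ≤ (2 / π) ^ s * (π - u) ^ s := by positivity
      linarith
    · have := mul_le_sin hu1.le (by linarith)
      rw [sin_pi_sub] at this
      have q := rpow_le_rpow_of_nonpos (by positivity) this hs0
      rw [mul_rpow (by positivity) hu1.le] at q
      have : 0 ≤ (2 / π) ^ s * u ^ s := by positivity
      linarith
  · refine (ae_restrict_iff' measurableSet_Ioo).2 (.of_forall fun u hu => ?_)
    have hu0 : 0 < u := hu.1
    have hu1 : 0 < π - u := sub_pos.2 hu.2
    simp only [Pi.zero_apply]; positivity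

/-- A bound, uniform in `α`, for the negative moments of `h_α`. -/
theorem lintegral_rpow_mul_subDensity_le (h0 : 0 < α) (h1 : α < 1) {s : ℝ} (hs : -1 < s)
    (hs0 : s ≤ 0) :
    ∫⁻ θ in Ioi 0, ENNReal.ofReal (θ ^ s * subDensity α θ) ≤
      ENNReal.ofReal (Gamma (1 + s) / π) * ∫⁻ u in Ioo 0 π, ENNReal.ofReal (sin u ^ s) := by
  have h1' : 0 < 1 - α := by linarith
  have hm := measurable_stableKernel α
  set F : ℝ → ℝ → ℝ := fun θ u => 1 / (π * (1 - α)) * stableKernel α u *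
    (θ ^ (s + α / (1 - α)) * exp (-stableKernel α u * θ ^ (1 / (1 - α)))) with hF
  have s1 : ∀ θ ∈ Ioi (0 : ℝ), ENNReal.ofReal (θ ^ s * subDensity α θ) =
      ∫⁻ u in Ioo 0 π, ENNReal.ofReal (F θ u) := by
    intro θ hθ
    have hθ' : 0 < θ := hθ
    have e : θ ^ s * subDensity α θ = ∫ u in Ioo 0 π, F θ u := by
      rw [subDensity, ← mul_assoc, ← integral_const_mul]
      congr 1 with u
      simp only [hF]
      rw [rpow_add hθ']; ring
    have i : IntegrableOn (F θ) (Ioo 0 π) := by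
      refine ((inner_integrable hθ' h0 h1).const_mul
        (1 / (π * (1 - α)) * θ ^ (s + α / (1 - α)))).congr (.of_forall fun u => ?_)
      simp only [hF]; ring
    rw [e, ofReal_integral_eq_lintegral_ofReal i]
    refine (ae_restrict_iff' measurableSet_Ioo).2 (.of_forall fun u hu => ?_)
    have hA := stableKernel_pos h0 h1 hu
    simp only [hF, Pi.zero_apply]; positivity
  have hss : -1 < (1 - α) * s := by nlinarith
  -- `Γ` decreases on `(0,1]` and `1 + s ≤ 1 + (1-α)s ≤ 1`; this removes `α` from the Gamma factor.
  have hgle : Gamma (1 + (1 - α) * s) ≤ Gamma (1 + s) :=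
    Gamma_strictAntiOn_Ioc.antitoneOn ⟨by linarith, by linarith⟩
      ⟨by linarith, by nlinarith⟩ (by nlinarith)
  have hg0 : 0 < Gamma (1 + (1 - α) * s) := Gamma_pos_of_pos (by linarith)
  -- For fixed `u` the integral in `θ` is a Gamma integral, equal to `Γ(1+(1-α)s) W^s / π`; both
  -- factors are then replaced by bounds free of `α`.
  have s2 : ∀ u ∈ Ioo 0 π, ∫⁻ θ in Ioi 0, ENNReal.ofReal (F θ u) ≤
      ENNReal.ofReal (Gamma (1 + s) / π) * ENNReal.ofReal (sin u ^ s) := by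
    intro u hu
    have hA := stableKernel_pos h0 h1 hu
    have hW := W_pos h0 h1 hu
    have hq : -1 < s + α / (1 - α) := by
      have : 0 ≤ α / (1 - α) := by positivity
      linarith
    have i := integrableOn_rpow_mul_exp_neg_mul_rpow hq (by positivity : 0 < 1 / (1 - α)) hA
    have v := integral_rpow_mul_exp_neg_mul_rpow (by positivity : 0 < 1 / (1 - α)) hq hA
    rw [← ofReal_integral_eq_lintegral_ofReal (i.const_mul _)]
    · rw [integral_const_mul, v]
      have e1 : (s + α / (1 - α) + 1) / (1 / (1 - α)) = 1 + (1 - α) * s := by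
        field_simp; ring
      have e2 : -(s + α / (1 - α) + 1) / (1 / (1 - α)) = -(1 + (1 - α) * s) := by
        rw [neg_div, e1]
      have e3 : stableKernel α u ^ (-(1 + (1 - α) * s)) = (stableKernel α u)⁻¹ * W α u ^ s := by
        rw [neg_add, rpow_add hA, rpow_neg_one]
        congr 1
        rw [stableKernel_eq h0 h1 hu, ← rpow_mul hW.le]
        congr 1; field_simp
      rw [e1, e2, e3, ← ENNReal.ofReal_mul (div_nonneg (hg0.le.trans hgle) pi_pos.le)]
      refine ENNReal.ofReal_le_ofReal ?_
      have q := rpow_le_rpow_of_nonpos (sin_pos_of_pos_of_lt_pi hu.1 hu.2) (sin_le_W h0 h1 hu) hs0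
      have hWs := rpow_pos_of_pos hW s
      calc _ = Gamma (1 + (1 - α) * s) / π * W α u ^ s := by field_simp
        _ ≤ _ := mul_le_mul (div_le_div_of_nonneg_right hgle pi_pos.le) q hWs.le
            (div_nonneg (hg0.le.trans hgle) pi_pos.le)
    · refine (ae_restrict_iff' measurableSet_Ioi).2 (.of_forall fun θ hθ => ?_)
      have hθ' : 0 < θ := hθ
      simp only [Pi.zero_apply]; positivity
  rw [setLIntegral_congr_fun measurableSet_Ioi s1, lintegral_lintegral_swap
    (Measurable.aemeasurable (by simp only [hF, Function.uncurry_def]; fun_prop)),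
    ← lintegral_const_mul _ (by fun_prop)]
  exact setLIntegral_mono' measurableSet_Ioo s2

end Density

/-! ### Lower bounds for the mass in a ball -/

section Ball
variable {N : ℕ}

/-- A lower bound for the mass which the Gauss kernel centred in a ball leaves in that ball. -/
noncomputable def ballMass (N : ℕ) : ℝ≥0∞ :=
  ENNReal.ofReal (1 / (36 * π) ^ ((N : ℝ) / 2) * exp (-1 / 9)) *
    volume (Metric.ball (0 : Space N) 1)

theorem ballMass_pos (N : ℕ) : 0 < ballMass N := by
  refine ENNReal.mul_pos (ENNReal.ofReal_pos.2 (by positivity)).ne'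
    (Metric.measure_ball_pos _ _ one_pos).ne'

theorem ballMass_ne_top (N : ℕ) : ballMass N ≠ ∞ :=
  ENNReal.mul_ne_top ENNReal.ofReal_ne_top measure_ball_lt_top.ne

theorem volume_ball_eq (x : Space N) {r : ℝ} (hr : 0 < r) :
    volume (Metric.ball x r) = ENNReal.ofReal (r ^ (N : ℝ)) * volume (Metric.ball (0 : Space N) 1) := by
  rw [Measure.addHaar_ball_of_pos _ _ hr, finrank_euclideanSpace_fin, rpow_natCast]

/-- A ball of radius `ρ = √τ/3` fits inside `B(0,r)` within distance `2ρ` of `y`. There `|x-y|²/(4τ)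
≤ 1/9`, so the kernel is at least `(4πτ)^(-N/2) e^(-1/9)`. The `9` in the hypothesis matches the
cutoff `θ < 9` for the densities. -/
theorem ballMass_le {r τ : ℝ} (hτ : 0 < τ) (hr : 0 < r) (h : τ ≤ 9 * r ^ 2) {y : Space N}
    (hy : y ∈ Metric.ball 0 r) :
    ballMass N ≤ ∫⁻ x in Metric.ball 0 r, ENNReal.ofReal (heatKernel τ (x - y)) := by
  set ρ := √τ / 3 with hρ
  have hρ0 : 0 < ρ := by positivity
  have hρ2 : 9 * ρ ^ 2 = τ := by rw [hρ, div_pow, sq_sqrt hτ.le]; ring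
  have hρr : ρ ≤ r := by
    refine le_of_sq_le_sq ?_ hr.le
    linarith
  -- The centre is `y` shrunk towards the origin, so that the ball of radius `ρ` about it stays
  -- inside `B(0,r)` even when `y` is close to the boundary.
  set z : Space N := (1 - ρ / r) • y with hz
  have hq : ρ / r ≤ 1 := (div_le_one hr).2 hρr
  have hyr : ‖y‖ < r := by simpa using hy
  have hsub : Metric.ball z ρ ⊆ Metric.ball 0 r := by
    refine Metric.ball_subset_ball' ?_
    rw [dist_zero_right, hz, norm_smul, norm_of_nonneg (by linarith)]
    have : (1 - ρ / r) * ‖y‖ ≤ (1 - ρ / r) * r := by gcongr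
    have e : (1 - ρ / r) * r = r - ρ := by field_simp
    linarith
  have hzy : ‖z - y‖ ≤ ρ := by
    have : z - y = -((ρ / r) • y) := by rw [hz, sub_smul, one_smul]; abel
    rw [this, norm_neg, norm_smul, norm_of_nonneg (by positivity)]
    calc ρ / r * ‖y‖ ≤ ρ / r * r := by gcongr
      _ = ρ := by field_simp
  calc ballMass N = ENNReal.ofReal (1 / (4 * π * τ) ^ ((N : ℝ) / 2) * exp (-1 / 9)) *
        volume (Metric.ball z ρ) := by
        rw [volume_ball_eq z hρ0, ← mul_assoc, ← ENNReal.ofReal_mul (by positivity), ballMass]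
        congr 2
        have : (4 * π * τ) ^ ((N : ℝ) / 2) = (36 * π) ^ ((N : ℝ) / 2) * ρ ^ (N : ℝ) := by
          rw [← hρ2, show 4 * π * (9 * ρ ^ 2) = 36 * π * ρ ^ 2 by ring,
            mul_rpow (by positivity) (by positivity), ← rpow_natCast ρ 2, ← rpow_mul hρ0.le]
          congr 2; push_cast; ring
        rw [this]
        field_simp
    _ = ∫⁻ x in Metric.ball z ρ, ENNReal.ofReal (1 / (4 * π * τ) ^ ((N : ℝ) / 2) * exp (-1 / 9)) := by
        rw [setLIntegral_const]
    _ ≤ ∫⁻ x in Metric.ball z ρ, ENNReal.ofReal (heatKernel τ (x - y)) := by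
        refine setLIntegral_mono' Metric.isOpen_ball.measurableSet fun x hx => ?_
        refine ENNReal.ofReal_le_ofReal ?_
        rw [heatKernel]
        gcongr 1 / (4 * π * τ) ^ ((N : ℝ) / 2) * ?_
        rw [exp_le_exp, div_le_div_iff₀ (by norm_num) (by positivity)]
        have : ‖x - y‖ ≤ 2 * ρ := by
          have h1 : ‖x - z‖ < ρ := by simpa [dist_eq_norm] using hx
          have h2 := norm_sub_le_norm_sub_add_norm_sub x z y
          linarith
        have h4 : ‖x - y‖ ^ 2 ≤ (2 * ρ) ^ 2 := by gcongr
        nlinarith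
    _ ≤ _ := lintegral_mono_set hsub

theorem measurable_heatSemigroup_uncurry (μ : Measure (Space N)) [SFinite μ] :
    Measurable fun q : ℝ × Space N => heatSemigroup q.1 μ q.2 := by
  unfold heatSemigroup
  refine Measurable.lintegral_prod_right' (f := fun q : (ℝ × Space N) × Space N =>
    ENNReal.ofReal (heatKernel q.1.1 (q.1.2 - q.2))) ?_
  exact (measurable_heatKernel.comp (f := fun q : (ℝ × Space N) × Space N =>
    (q.1.1, q.1.2 - q.2)) (by fun_prop)).ennreal_ofReal

theorem ballMass_mul_le_heatSemigroup {r τ : ℝ} (hτ : 0 < τ) (hr : 0 < r) (h : τ ≤ 9 * r ^ 2)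
    (μ : Measure (Space N)) [SFinite μ] :
    ballMass N * μ (Metric.ball 0 r) ≤ ∫⁻ x in Metric.ball 0 r, heatSemigroup τ μ x := by
  unfold heatSemigroup
  have hm : Measurable fun q : Space N × Space N => ENNReal.ofReal (heatKernel τ (q.1 - q.2)) :=
    (measurable_heatKernel.comp (f := fun q : Space N × Space N => (τ, q.1 - q.2))
      (by fun_prop)).ennreal_ofReal
  rw [lintegral_lintegral_swap hm.aemeasurable, ← setLIntegral_const]
  refine (setLIntegral_mono' Metric.isOpen_ball.measurableSet fun y hy => ?_).trans
    (setLIntegral_le_lintegral (Metric.ball 0 r) _)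
  exact ballMass_le hτ hr h hy

/-- The operators `∫ w(θ) e^{t^α θ Δ} μ dθ`, of which `opP` and `opS` are special cases. -/
theorem ballMass_mul_le_lintegral_weight {α t r : ℝ} (ht : 0 < t) (hr : 0 < r)
    (h : t ^ α ≤ r ^ 2) (μ : Measure (Space N)) [SFinite μ] {w : ℝ → ℝ≥0∞} (hw : Measurable w)
    (hw2 : 1 / 2 ≤ ∫⁻ θ in Ioo 0 9, w θ) :
    1 / 2 * ballMass N * μ (Metric.ball 0 r) ≤
      ∫⁻ x in Metric.ball 0 r, ∫⁻ θ in Ioi (0 : ℝ), w θ * heatSemigroup (t ^ α * θ) μ x := by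
  have hm : Measurable fun q : Space N × ℝ => w q.2 * heatSemigroup (t ^ α * q.2) μ q.1 :=
    (hw.comp measurable_snd).mul ((measurable_heatSemigroup_uncurry μ).comp
      (f := fun q : Space N × ℝ => (t ^ α * q.2, q.1)) (by fun_prop))
  rw [lintegral_lintegral_swap (f := fun x θ => w θ * heatSemigroup (t ^ α * θ) μ x)
    hm.aemeasurable]
  refine le_trans ?_ (lintegral_mono_set (Ioo_subset_Ioi_self : Ioo (0 : ℝ) 9 ⊆ Ioi 0))
  calc _ ≤ (∫⁻ θ in Ioo 0 9, w θ) * (ballMass N * μ (Metric.ball 0 r)) := by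
        rw [mul_assoc]; gcongr
    _ = ∫⁻ θ in Ioo 0 9, w θ * (ballMass N * μ (Metric.ball 0 r)) := by
        rw [lintegral_mul_const _ hw]
    _ ≤ _ := by
        refine setLIntegral_mono' measurableSet_Ioo fun θ hθ => ?_
        have ht' := rpow_pos_of_pos ht α
        have hmx : Measurable (heatSemigroup (t ^ α * θ) μ) :=
          (measurable_heatSemigroup_uncurry μ).comp
            (f := fun x : Space N => (t ^ α * θ, x)) (by fun_prop)
        rw [lintegral_const_mul _ hmx]
        gcongr
        refine ballMass_mul_le_heatSemigroup (mul_pos ht' hθ.1) hr ?_ μ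
        nlinarith [hθ.1, hθ.2]

theorem ballMass_mul_le_opP {α t r : ℝ} (h0 : 1 / 2 ≤ α) (h1 : α < 1) (ht : 0 < t) (hr : 0 < r)
    (h : t ^ α ≤ r ^ 2) (μ : Measure (Space N)) [SFinite μ] :
    1 / 2 * ballMass N * μ (Metric.ball 0 r) ≤ ∫⁻ x in Metric.ball 0 r, opP α t μ x :=
  ballMass_mul_le_lintegral_weight ht hr h μ (measurable_subDensity α).ennreal_ofReal
    (half_le_lintegral_subDensity h0 h1)

theorem ballMass_mul_le_opS {α t r : ℝ} (h0 : 1 / 2 ≤ α) (h1 : α < 1) (ht : 0 < t) (hr : 0 < r)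
    (h : t ^ α ≤ r ^ 2) (μ : Measure (Space N)) [SFinite μ] :
    1 / 2 * ballMass N * μ (Metric.ball 0 r) ≤ ∫⁻ x in Metric.ball 0 r, opS α t μ x :=
  ballMass_mul_le_lintegral_weight ht hr h μ
    (measurable_id.mul (measurable_subDensity α)).ennreal_ofReal
    (half_le_lintegral_mul_subDensity h0 h1)

end Ball

/-! ### The mass of the initial data near the origin -/

section Data
variable {N : ℕ} {ε κ : ℝ}

theorem measurable_fData (N : ℕ) (ε : ℝ) : Measurable (fData N ε) := by
  unfold fData
  exact Measurable.indicator (by fun_prop) Metric.isOpen_ball.measurableSet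

theorem one_le_neg_log {σ : ℝ} (h0 : 0 < σ) (h1 : σ ≤ 1 / exp 1) : 1 ≤ -log σ := by
  have := log_le_log h0 h1
  rw [one_div, log_inv, log_exp] at this
  linarith

/-- In polar coordinates `r^(N-1) r^(-N) = 1/r`: the singularity is critical and the mass is an
integral in the variable `log r`. -/
theorem toMeasure_ball (hN : 1 ≤ N) (hκ : 0 < κ) {σ : ℝ} (h1 : σ ≤ 1 / exp 1) :
    toMeasure (fun x => κ * fData N ε x) (Metric.ball 0 σ) =
      N * volume (Metric.ball (0 : Space N) 1) * (ENNReal.ofReal κ *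
        ∫⁻ r in Ioo 0 σ, ENNReal.ofReal (r⁻¹ * (-log r) ^ (-((N : ℝ) / 2 - ε) - 1))) := by
  set F : ℝ → ℝ≥0∞ := (Iio σ).indicator fun r =>
    ENNReal.ofReal (κ * (r ^ (-(N : ℝ)) * |log r| ^ (-(N : ℝ) / 2 - 1 + ε))) with hF
  have hFm : Measurable F := Measurable.indicator (by fun_prop) measurableSet_Iio
  have e1 : toMeasure (fun x => κ * fData N ε x) (Metric.ball 0 σ) = ∫⁻ x : Space N, F ‖x‖ := by
    rw [toMeasure, withDensity_apply _ Metric.isOpen_ball.measurableSet,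
      ← lintegral_indicator Metric.isOpen_ball.measurableSet]
    refine lintegral_congr fun x => ?_
    by_cases hx : ‖x‖ < σ
    · rw [indicator_of_mem (by simpa using hx), hF, indicator_of_mem (by simpa using hx), fData,
        indicator_of_mem (by simpa using hx.trans_le (by simpa using h1))]
    · rw [indicator_of_notMem (by simpa using hx), hF, indicator_of_notMem (by simpa using hx)]
  rw [e1, lintegral_radial hN hFm]
  congr 1
  rw [← lintegral_const_mul _ (by fun_prop)]
  have e2 : ∀ r, ENNReal.ofReal (r ^ (N - 1)) * F r = (Iio σ).indicator (fun r =>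
      ENNReal.ofReal (r ^ (N - 1)) *
        ENNReal.ofReal (κ * (r ^ (-(N : ℝ)) * |log r| ^ (-(N : ℝ) / 2 - 1 + ε)))) r := by
    intro r
    rw [hF, indicator_mul_right]
  simp_rw [e2]
  rw [setLIntegral_indicator measurableSet_Iio, Set.inter_comm, Ioi_inter_Iio]
  refine setLIntegral_congr_fun measurableSet_Ioo fun r hr => ?_
  have hr0 : 0 < r := hr.1
  have hl : 1 ≤ -log r := one_le_neg_log hr0 (hr.2.le.trans h1)
  rw [← ENNReal.ofReal_mul (by positivity), ← ENNReal.ofReal_mul hκ.le]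
  congr 1
  rw [abs_of_neg (by linarith)]
  have e3 : r ^ (N - 1) * r ^ (-(N : ℝ)) = r⁻¹ := by
    rw [← rpow_natCast, ← rpow_add hr0, Nat.cast_sub hN, ← rpow_neg_one]
    congr 1; push_cast; ring
  have e4 : -(N : ℝ) / 2 - 1 + ε = -((N : ℝ) / 2 - ε) - 1 := by ring
  rw [e4]
  linear_combination κ * (-log r) ^ (-((N : ℝ) / 2 - ε) - 1) * e3

/-- On `(σ²,σ)` the quantity `-log r` stays below `2(-log σ)`, and this interval has logarithmic
length `-log σ`. -/
theorem le_lintegral_log_rpow {σ b : ℝ} (hb : 0 < b) (h0 : 0 < σ) (h1 : σ ≤ 1 / exp 1) :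
    ENNReal.ofReal (2 ^ (-b - 1) * (-log σ) ^ (-b)) ≤
      ∫⁻ r in Ioo 0 σ, ENNReal.ofReal (r⁻¹ * (-log r) ^ (-b - 1)) := by
  have hl : 1 ≤ -log σ := one_le_neg_log h0 h1
  have hl0 : 0 < -log σ := by linarith
  have hσ1 : σ ≤ 1 := h1.trans (by rw [div_le_one (exp_pos _)]; exact one_le_exp zero_le_one)
  have h2 : σ ^ 2 ≤ σ := by nlinarith
  have hsub : Ioo (σ ^ 2) σ ⊆ Ioo 0 σ := Ioo_subset_Ioo_left (by positivity)
  refine le_trans ?_ (lintegral_mono_set hsub)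
  calc ENNReal.ofReal (2 ^ (-b - 1) * (-log σ) ^ (-b))
      = ENNReal.ofReal ((2 * -log σ) ^ (-b - 1)) * ENNReal.ofReal (log (σ / σ ^ 2)) := by
        rw [← ENNReal.ofReal_mul (by positivity)]
        congr 1
        have e : log (σ / σ ^ 2) = -log σ := by
          rw [log_div h0.ne' (by positivity), log_pow]; push_cast; ring
        rw [e, mul_rpow (by norm_num) hl0.le, mul_assoc]
        congr 1
        nth_rw 3 [← rpow_one (-log σ)]
        rw [← rpow_add hl0]; congr 1; ring
    _ = ∫⁻ r in Ioo (σ ^ 2) σ, ENNReal.ofReal ((2 * -log σ) ^ (-b - 1)) * ENNReal.ofReal r⁻¹ := by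
        rw [lintegral_const_mul _ (by fun_prop), lintegral_inv_Ioo (by positivity) h2]
    _ ≤ _ := by
        refine setLIntegral_mono' measurableSet_Ioo fun r hr => ?_
        have hr0 : 0 < r := lt_trans (by positivity) hr.1
        rw [← ENNReal.ofReal_mul (by positivity), mul_comm]
        refine ENNReal.ofReal_le_ofReal ?_
        have h3 := one_le_neg_log hr0 (hr.2.le.trans h1)
        have h4 := log_le_log (by positivity) hr.1.le
        rw [log_pow] at h4
        push_cast at h4
        gcongr ?_ * ?_
        exact rpow_le_rpow_of_nonpos (by linarith) (by linarith) (by linarith)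

/-- The substitution `r = e^(-y)` turns the integral into that of `y^(-b-1)` over `(-log σ, ∞)`. -/
theorem lintegral_log_rpow_le {σ b : ℝ} (hb : 0 < b) (h0 : 0 < σ) (h1 : σ ≤ 1 / exp 1) :
    ∫⁻ r in Ioo 0 σ, ENNReal.ofReal (r⁻¹ * (-log r) ^ (-b - 1)) ≤
      ENNReal.ofReal ((-log σ) ^ (-b) / b) := by
  have hl : 1 ≤ -log σ := one_le_neg_log h0 h1
  have hl0 : 0 < -log σ := by linarith
  have him : (fun y : ℝ => exp (-y)) '' Ioi (-log σ) = Ioo 0 σ := by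
    ext r
    simp only [mem_image, mem_Ioi, mem_Ioo]
    constructor
    · rintro ⟨y, hy, rfl⟩
      refine ⟨exp_pos _, ?_⟩
      rw [← lt_log_iff_exp_lt h0]; linarith
    · rintro ⟨h3, h4⟩
      refine ⟨-log r, ?_, by simp [exp_log h3]⟩
      have := log_lt_log h3 h4
      linarith
  rw [← him, lintegral_image_eq_lintegral_abs_deriv_mul (f' := fun y => -exp (-y)) measurableSet_Ioi
    (fun y _ => by simpa using ((hasDerivAt_id y).neg.exp).hasDerivWithinAt)
    (fun x _ y _ h => by simpa using h)]
  have hi := integrableOn_Ioi_rpow_of_lt (a := -b - 1) (by linarith) hl0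
  have hv := integral_Ioi_rpow_of_lt (a := -b - 1) (by linarith) hl0
  have e : ∀ y ∈ Ioi (-log σ), ENNReal.ofReal |-exp (-y)| *
      ENNReal.ofReal ((exp (-y))⁻¹ * (-log (exp (-y))) ^ (-b - 1)) =
      ENNReal.ofReal (y ^ (-b - 1)) := by
    intro y hy
    rw [abs_neg, abs_of_pos (exp_pos _), ← ENNReal.ofReal_mul (exp_pos _).le, log_exp, neg_neg,
      ← mul_assoc, mul_inv_cancel₀ (exp_pos _).ne', one_mul]
  rw [setLIntegral_congr_fun measurableSet_Ioi e, ← ofReal_integral_eq_lintegral_ofReal hi]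
  · rw [hv]
    refine ENNReal.ofReal_le_ofReal (le_of_eq ?_)
    rw [show -b - 1 + 1 = -b by ring, neg_div_neg_eq]
  · refine (ae_restrict_iff' measurableSet_Ioi).2 (.of_forall fun y hy => ?_)
    exact rpow_nonneg (hl0.le.trans (le_of_lt hy)) _

theorem exists_le_toMeasure_ball (hN : 1 ≤ N) (hε : ε < (N : ℝ) / 2) :
    ∃ c : ℝ, 0 < c ∧ ∀ κ : ℝ, 0 < κ → ∀ σ : ℝ, 0 < σ → σ ≤ 1 / exp 1 →
      ENNReal.ofReal (c * κ * (-log σ) ^ (-((N : ℝ) / 2 - ε))) ≤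
        toMeasure (fun x => κ * fData N ε x) (Metric.ball 0 σ) := by
  have hb : 0 < (N : ℝ) / 2 - ε := by linarith
  have hω : (N * volume (Metric.ball (0 : Space N) 1)).toReal ≠ 0 := by
    rw [ENNReal.toReal_ne_zero]
    refine ⟨mul_ne_zero (by positivity) (Metric.measure_ball_pos _ _ one_pos).ne',
      ENNReal.mul_ne_top (by simp) measure_ball_lt_top.ne⟩
  set ω := (N * volume (Metric.ball (0 : Space N) 1)).toReal with hωd
  have hω0 : 0 < ω := lt_of_le_of_ne ENNReal.toReal_nonneg hω.symm
  refine ⟨ω * 2 ^ (-((N : ℝ) / 2 - ε) - 1), by positivity, fun κ hκ σ h0 h1 => ?_⟩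
  have hl : 0 < -log σ := by linarith [one_le_neg_log h0 h1]
  rw [toMeasure_ball hN hκ h1, ← ENNReal.ofReal_toReal (a := N * volume (Metric.ball (0 : Space N) 1))
    (ENNReal.mul_ne_top (by simp) measure_ball_lt_top.ne), ← hωd]
  refine le_trans (le_of_eq ?_)
    (mul_le_mul_right (mul_le_mul_right (le_lintegral_log_rpow hb h0 h1) _) _)
  rw [← ENNReal.ofReal_mul hκ.le, ← ENNReal.ofReal_mul hω0.le]
  congr 1; ring

theorem exists_toMeasure_ball_le (hN : 1 ≤ N) (hε : ε < (N : ℝ) / 2) :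
    ∃ C : ℝ, 0 < C ∧ ∀ κ : ℝ, 0 < κ → ∀ σ : ℝ, 0 < σ → σ ≤ 1 / exp 1 →
      toMeasure (fun x => κ * fData N ε x) (Metric.ball 0 σ) ≤
        ENNReal.ofReal (C * κ * (-log σ) ^ (-((N : ℝ) / 2 - ε))) := by
  have hb : 0 < (N : ℝ) / 2 - ε := by linarith
  have hω : (N * volume (Metric.ball (0 : Space N) 1)).toReal ≠ 0 := by
    rw [ENNReal.toReal_ne_zero]
    refine ⟨mul_ne_zero (by positivity) (Metric.measure_ball_pos _ _ one_pos).ne',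
      ENNReal.mul_ne_top (by simp) measure_ball_lt_top.ne⟩
  set ω := (N * volume (Metric.ball (0 : Space N) 1)).toReal with hωd
  have hω0 : 0 < ω := lt_of_le_of_ne ENNReal.toReal_nonneg hω.symm
  refine ⟨ω / ((N : ℝ) / 2 - ε), by positivity, fun κ hκ σ h0 h1 => ?_⟩
  have hl : 0 < -log σ := by linarith [one_le_neg_log h0 h1]
  rw [toMeasure_ball hN hκ h1, ← ENNReal.ofReal_toReal (a := N * volume (Metric.ball (0 : Space N) 1))
    (ENNReal.mul_ne_top (by simp) measure_ball_lt_top.ne), ← hωd]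
  refine le_trans
    (mul_le_mul_right (mul_le_mul_right (lintegral_log_rpow_le hb h0 h1) _) _) (le_of_eq ?_)
  rw [← ENNReal.ofReal_mul hκ.le, ← ENNReal.ofReal_mul hω0.le]
  congr 1; field_simp

/-- Away from the origin the data are bounded by a multiple of their value at distance `σ`. -/
theorem exists_fData_le (hN : 1 ≤ N) (hε : ε < (N : ℝ) / 2) :
    ∃ C : ℝ, 0 < C ∧ ∀ σ : ℝ, 0 < σ → σ ≤ 1 / exp 1 → ∀ x : Space N, σ ≤ ‖x‖ →
      fData N ε x ≤ C * (σ ^ (-(N : ℝ)) * (-log σ) ^ (-((N : ℝ) / 2 - ε))) := by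
  have hb : 0 < (N : ℝ) / 2 - ε := by linarith
  have hN0 : 0 < (N : ℝ) := by positivity
  set a := (N : ℝ) / 2 - ε + 1 with ha
  have ha0 : 0 < a := by linarith
  refine ⟨(1 + a / N) ^ a, by positivity, fun σ h0 h1 x hx => ?_⟩
  have hl : 1 ≤ -log σ := one_le_neg_log h0 h1
  have hl0 : 0 < -log σ := by linarith
  rw [fData]
  by_cases hxe : x ∈ Metric.ball (0 : Space N) (1 / exp 1)
  · rw [indicator_of_mem hxe]
    set r := ‖x‖ with hr
    have hr0 : 0 < r := h0.trans_le hx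
    have hxe' : r < 1 / exp 1 := by simpa using hxe
    have hlr : 1 ≤ -log r := one_le_neg_log hr0 hxe'.le
    have hlr0 : 0 < -log r := by linarith
    set y := r / σ with hy
    have hy1 : 1 ≤ y := (one_le_div h0).2 hx
    have hy0 : 0 < y := by positivity
    have hlog : log y = -log σ - -log r := by rw [hy, log_div hr0.ne' h0.ne']; ring
    -- The logarithms at `σ` and `r` differ by `log y ≤ (a/N) y^(N/a)`. Raised to the power `a` this
    -- costs a constant times `y^N = (r/σ)^N`, which is what the factor `r^(-N)` gains over
    -- `σ^(-N)`.
    have k1 : -log σ ≤ -log r * ((1 + a / N) * y ^ ((N : ℝ) / a)) := by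
      have k2 : log y ≤ y ^ ((N : ℝ) / a) / (N / a) := log_le_rpow_div hy0.le (by positivity)
      have k3 : 1 ≤ y ^ ((N : ℝ) / a) := one_le_rpow hy1 (by positivity)
      have k4 : y ^ ((N : ℝ) / a) / (N / a) = a / N * y ^ ((N : ℝ) / a) := by field_simp
      have k5 : 0 ≤ log y := log_nonneg hy1
      calc -log σ = -log r * 1 + 1 * log y := by rw [hlog]; ring
        _ ≤ -log r * y ^ ((N : ℝ) / a) + -log r * (a / N * y ^ ((N : ℝ) / a)) := by
          rw [← k4]; gcongr
        _ = _ := by ring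
    have k6 := rpow_le_rpow hl0.le k1 ha0.le
    rw [mul_rpow hlr0.le (by positivity), mul_rpow (by positivity) (by positivity),
      ← rpow_mul hy0.le, div_mul_cancel₀ _ ha0.ne', hy, div_rpow hr0.le h0.le] at k6
    have k7 : |log r| ^ (-(N : ℝ) / 2 - 1 + ε) = ((-log r) ^ a)⁻¹ := by
      rw [abs_of_neg (by linarith), ← rpow_neg hlr0.le]; congr 1; rw [ha]; ring
    -- One power of the logarithm is given away here, to match the decay of the mass of the ball.
    have k8 : ((-log σ) ^ a)⁻¹ ≤ (-log σ) ^ (-((N : ℝ) / 2 - ε)) := by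
      rw [← rpow_neg hl0.le]
      exact rpow_le_rpow_of_exponent_le hl (by linarith)
    have p1 := rpow_pos_of_pos hlr0 a
    have p2 := rpow_pos_of_pos hl0 a
    have p3 := rpow_pos_of_pos hr0 (N : ℝ)
    have p4 := rpow_pos_of_pos h0 (N : ℝ)
    calc r ^ (-(N : ℝ)) * |log r| ^ (-(N : ℝ) / 2 - 1 + ε)
        = (r ^ (N : ℝ))⁻¹ * ((-log r) ^ a)⁻¹ := by rw [k7, rpow_neg hr0.le]
      _ ≤ (1 + a / N) ^ a * ((σ ^ (N : ℝ))⁻¹ * ((-log σ) ^ a)⁻¹) := by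
        rw [← mul_inv, ← mul_inv, ← div_eq_mul_inv, le_div_iff₀ (by positivity),
          inv_mul_le_iff₀ (by positivity)]
        calc σ ^ (N : ℝ) * (-log σ) ^ a ≤ σ ^ (N : ℝ) *
              ((-log r) ^ a * ((1 + a / N) ^ a * (r ^ (N : ℝ) / σ ^ (N : ℝ)))) := by gcongr
          _ = _ := by field_simp
      _ ≤ _ := by rw [← rpow_neg h0.le]; gcongr
  · rw [indicator_of_notMem hxe]
    positivity

end Data

/-! ### Measurability and monotonicity of the integral equation -/

section Equation
variable {N : ℕ} {α : ℝ}

theorem heatSemigroup_withDensity (t : ℝ) {g : Space N → ℝ≥0∞} (hg : Measurable g) (x : Space N) :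
    heatSemigroup t (volume.withDensity g) x =
      ∫⁻ y, g y * ENNReal.ofReal (heatKernel t (x - y)) := by
  have : Measurable fun y : Space N => ENNReal.ofReal (heatKernel t (x - y)) :=
    (measurable_heatKernel.comp (f := fun y : Space N => (t, x - y)) (by fun_prop)).ennreal_ofReal
  rw [heatSemigroup, lintegral_withDensity_eq_lintegral_mul _ hg this]
  rfl

theorem measurable_heatSemigroup_withDensity {X : Type*} [MeasurableSpace X]
    {g : X → Space N → ℝ≥0∞} (hg : Measurable (Function.uncurry g)) :
    Measurable fun q : X × ℝ × Space N =>
      heatSemigroup q.2.1 (volume.withDensity (g q.1)) q.2.2 := by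
  have hg1 : ∀ a, Measurable (g a) := fun a => hg.comp measurable_prodMk_left
  simp_rw [fun q : X × ℝ × Space N => heatSemigroup_withDensity q.2.1 (hg1 q.1) q.2.2]
  refine Measurable.lintegral_prod_right' (f := fun q : (X × ℝ × Space N) × Space N =>
    g q.1.1 q.2 * ENNReal.ofReal (heatKernel q.1.2.1 (q.1.2.2 - q.2))) ?_
  refine Measurable.mul ?_ ?_
  · exact hg.comp (f := fun q : (X × ℝ × Space N) × Space N => (q.1.1, q.2)) (by fun_prop)
  · exact (measurable_heatKernel.comp (f := fun q : (X × ℝ × Space N) × Space N =>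
      (q.1.2.1, q.1.2.2 - q.2)) (by fun_prop)).ennreal_ofReal

theorem measurable_opS_withDensity {X : Type*} [MeasurableSpace X]
    {g : X → Space N → ℝ≥0∞} (hg : Measurable (Function.uncurry g)) :
    Measurable fun q : X × ℝ × Space N => opS α q.2.1 (volume.withDensity (g q.1)) q.2.2 := by
  unfold opS
  refine Measurable.lintegral_prod_right' (f := fun q : (X × ℝ × Space N) × ℝ =>
    ENNReal.ofReal (q.2 * subDensity α q.2) *
      heatSemigroup (q.1.2.1 ^ α * q.2) (volume.withDensity (g q.1.1)) q.1.2.2) ?_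
  refine Measurable.mul ?_ ?_
  · have := measurable_subDensity α
    fun_prop
  · exact (measurable_heatSemigroup_withDensity hg).comp (f := fun q : (X × ℝ × Space N) × ℝ =>
      (q.1.1, q.1.2.1 ^ α * q.2, q.1.2.2)) (by fun_prop)

theorem measurable_opP (μ : Measure (Space N)) [SFinite μ] :
    Measurable fun q : ℝ × Space N => opP α q.1 μ q.2 := by
  unfold opP
  refine Measurable.lintegral_prod_right' (f := fun q : (ℝ × Space N) × ℝ =>
    ENNReal.ofReal (subDensity α q.2) * heatSemigroup (q.1.1 ^ α * q.2) μ q.1.2) ?_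
  refine Measurable.mul ?_ ?_
  · have := measurable_subDensity α
    fun_prop
  · exact (measurable_heatSemigroup_uncurry μ).comp (f := fun q : (ℝ × Space N) × ℝ =>
      (q.1.1 ^ α * q.2, q.1.2)) (by fun_prop)

theorem measurable_uncurry_rpow {p : ℝ} {u : ℝ → Space N → ℝ≥0∞}
    (hu : Measurable (Function.uncurry u)) :
    Measurable (Function.uncurry fun s y => u s y ^ p) :=
  hu.pow_const p

theorem measurable_mildRHS {p : ℝ} (μ : Measure (Space N)) [SFinite μ] {u : ℝ → Space N → ℝ≥0∞}
    (hu : Measurable (Function.uncurry u)) :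
    Measurable (Function.uncurry (mildRHS α p μ u)) := by
  unfold mildRHS
  refine (measurable_opP μ).add (Measurable.const_mul ?_ _)
  have e : ∀ q : ℝ × Space N, ∫⁻ s in Ioo 0 q.1, ENNReal.ofReal ((q.1 - s) ^ (α - 1)) *
      opS α (q.1 - s) (volume.withDensity fun y => u s y ^ p) q.2 =
      ∫⁻ s, {w : (ℝ × Space N) × ℝ | w.2 ∈ Ioo 0 w.1.1}.indicator (fun w =>
        ENNReal.ofReal ((w.1.1 - w.2) ^ (α - 1)) *
          opS α (w.1.1 - w.2) (volume.withDensity fun y => u w.2 y ^ p) w.1.2) (q, s) := by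
    intro q
    rw [← lintegral_indicator measurableSet_Ioo]
    rfl
  simp_rw [e]
  refine Measurable.lintegral_prod_right' (Measurable.indicator (Measurable.mul ?_ ?_) ?_)
  · fun_prop
  · exact (measurable_opS_withDensity (measurable_uncurry_rpow hu)).comp
      (f := fun w : (ℝ × Space N) × ℝ => (w.2, w.1.1 - w.2, w.1.2)) (by fun_prop)
  · exact (measurableSet_lt measurable_const measurable_snd).inter
      (measurableSet_lt measurable_snd measurable_fst.fst)

theorem heatSemigroup_mono {μ ν : Measure (Space N)} (h : μ ≤ ν) (t : ℝ) (x : Space N) :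
    heatSemigroup t μ x ≤ heatSemigroup t ν x := lintegral_mono' h le_rfl

theorem opS_mono {μ ν : Measure (Space N)} (h : μ ≤ ν) (t : ℝ) (x : Space N) :
    opS α t μ x ≤ opS α t ν x :=
  lintegral_mono fun _ => mul_le_mul_right (heatSemigroup_mono h _ _) _

/-- An inequality almost everywhere suffices, because `u` enters only under integrals. Hence the
right-hand side ignores null sets, and Picard iterates can be compared with an arbitrary solution.
-/
theorem mildRHS_mono {p : ℝ} (hp : 0 ≤ p) (μ : Measure (Space N)) {T : ℝ}
    {u v : ℝ → Space N → ℝ≥0∞}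
    (h : ∀ᵐ t ∂(volume.restrict (Ioc 0 T)), ∀ᵐ x ∂(volume : Measure (Space N)), u t x ≤ v t x)
    {t : ℝ} (ht : t ≤ T) (x : Space N) : mildRHS α p μ u t x ≤ mildRHS α p μ v t x := by
  unfold mildRHS
  gcongr 1
  gcongr 1
  refine lintegral_mono_ae ?_
  have hsub : Ioo 0 t ⊆ Ioc 0 T := fun s hs => ⟨hs.1, hs.2.le.trans ht⟩
  filter_upwards [ae_restrict_of_ae_restrict_of_subset hsub h] with s hs
  gcongr 1
  refine opS_mono (withDensity_mono ?_) _ _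
  filter_upwards [hs] with y hy
  exact ENNReal.rpow_le_rpow hy hp

/-- Every solution has a jointly measurable version. -/
theorem IsSolution.exists_measurable {p : ℝ} (hp : 0 ≤ p) {μ : Measure (Space N)} {T : ℝ}
    {u : ℝ → Space N → ℝ≥0∞} (hu : IsSolution α p μ T u) :
    ∃ v : ℝ → Space N → ℝ≥0∞, Measurable (Function.uncurry v) ∧ IsSolution α p μ T v := by
  obtain ⟨hm, hs⟩ := hu
  refine ⟨fun t x => hm.mk _ (t, x), hm.measurable_mk, hm.measurable_mk.aemeasurable, ?_⟩
  have e := Measure.ae_ae_of_ae_prod hm.ae_eq_mk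
  have e1 : ∀ᵐ t ∂(volume.restrict (Ioc 0 T)), ∀ᵐ x ∂(volume : Measure (Space N)),
      u t x ≤ hm.mk _ (t, x) := by
    filter_upwards [e] with t ht
    filter_upwards [ht] with x hx using hx.le
  have e2 : ∀ᵐ t ∂(volume.restrict (Ioc 0 T)), ∀ᵐ x ∂(volume : Measure (Space N)),
      hm.mk _ (t, x) ≤ u t x := by
    filter_upwards [e] with t ht
    filter_upwards [ht] with x hx using hx.ge
  filter_upwards [hs, e, ae_restrict_mem measurableSet_Ioc] with t ht1 ht2 htT
  filter_upwards [ht1, ht2] with x hx1 hx2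
  have hx3 : u t x = hm.mk _ (t, x) := hx2
  rw [← hx3]
  exact ⟨hx1.1, hx1.2.trans (le_antisymm (mildRHS_mono hp μ e1 htT.2 x)
    (mildRHS_mono hp μ e2 htT.2 x))⟩

theorem IsSolution.mono {p : ℝ} {μ : Measure (Space N)} {T T' : ℝ} (h : T' ≤ T)
    {u : ℝ → Space N → ℝ≥0∞} (hu : IsSolution α p μ T u) : IsSolution α p μ T' u := by
  have hsub : Ioc 0 T' ⊆ Ioc 0 T := Ioc_subset_Ioc_right h
  exact ⟨hu.1.mono_measure (Measure.prod_mono (Measure.restrict_mono hsub le_rfl) le_rfl),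
    ae_restrict_of_ae_restrict_of_subset hsub hu.2⟩

end Equation

/-! ### A necessary condition for the existence of a solution -/

/-- Either `y ≤ d^(-q)`, or `y^(p-1) ≥ 1/d` and the first term dominates. The parameter `d` is left
free because it will be chosen depending on time. -/
theorem le_ofReal_mul_rpow_add {p q d : ℝ} (hp : 1 < p) (hpq : (p - 1) * q = 1) (hd : 0 < d)
    (y : ℝ≥0∞) : y ≤ ENNReal.ofReal d * y ^ p + ENNReal.ofReal (d ^ (-q)) := by
  rcases eq_or_ne y ∞ with rfl | hy
  · rw [ENNReal.top_rpow_of_pos (by linarith), ENNReal.mul_top (by simpa using hd)]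
    simp
  · rw [← ENNReal.ofReal_toReal hy]
    set z := y.toReal
    have hz : 0 ≤ z := ENNReal.toReal_nonneg
    rw [ENNReal.ofReal_rpow_of_nonneg hz (by linarith), ← ENNReal.ofReal_mul hd.le,
      ← ENNReal.ofReal_add (by positivity) (by positivity)]
    refine ENNReal.ofReal_le_ofReal ?_
    rcases le_or_gt z (d ^ (-q)) with h | h
    · have : 0 ≤ d * z ^ p := by positivity
      linarith
    · have hz0 : 0 < z := lt_trans (by positivity) h
      have h1 := rpow_le_rpow (by positivity) h.le (sub_pos.2 hp).le
      rw [← rpow_mul hd.le, neg_mul, mul_comm q, hpq, rpow_neg_one] at h1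
      have h2 : z ^ p = z * z ^ (p - 1) := by
        rw [← rpow_one_add' hz0.le (by linarith)]; congr 1; ring
      have h3 : z ≤ d * z ^ p := by
        rw [h2]
        calc z = d * (z * d⁻¹) := by field_simp
          _ ≤ _ := by gcongr
      have : 0 ≤ d ^ (-q) := by positivity
      linarith

theorem lintegral_triangle {F : ℝ → ℝ → ℝ≥0∞} (hF : Measurable (Function.uncurry F)) (a b : ℝ) :
    ∫⁻ t in Ioo a b, ∫⁻ s in Ioo a t, F t s = ∫⁻ s in Ioo a b, ∫⁻ t in Ioo s b, F t s := by
  have e1 : ∀ t ∈ Ioo a b, ∫⁻ s in Ioo a t, F t s =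
      ∫⁻ s in Ioo a b, {w : ℝ × ℝ | w.2 < w.1}.indicator (Function.uncurry F) (t, s) := by
    intro t ht
    have : ∀ s, {w : ℝ × ℝ | w.2 < w.1}.indicator (Function.uncurry F) (t, s) =
        (Iio t).indicator (F t) s := fun s => rfl
    simp_rw [this]
    rw [setLIntegral_indicator measurableSet_Iio, Set.inter_comm, Ioo_inter_Iio,
      min_eq_right ht.2.le]
  have e2 : ∀ s ∈ Ioo a b, ∫⁻ t in Ioo s b, F t s =
      ∫⁻ t in Ioo a b, {w : ℝ × ℝ | w.2 < w.1}.indicator (Function.uncurry F) (t, s) := by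
    intro s hs
    have : ∀ t, {w : ℝ × ℝ | w.2 < w.1}.indicator (Function.uncurry F) (t, s) =
        (Ioi s).indicator (fun t => F t s) t := fun t => rfl
    simp_rw [this]
    rw [setLIntegral_indicator measurableSet_Ioi, Ioi_inter_Ioo, max_eq_left hs.1.le]
  rw [setLIntegral_congr_fun measurableSet_Ioo e1, setLIntegral_congr_fun measurableSet_Ioo e2,
    lintegral_lintegral_swap]
  exact (hF.indicator (measurableSet_lt measurable_snd measurable_fst)).aemeasurable

/-- The first half `(s, √(sS))` of `(s, S)` in logarithmic scale. -/
theorem half_log_of_mem {s S t : ℝ} (hs : 0 < s) (hsS : s < S) (ht : t ∈ Ioo s √(s * S)) :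
    0 < t ∧ t < S ∧ log (S / s) / 2 ≤ log (S / t) := by
  have hS : 0 < S := hs.trans hsS
  have ht0 : 0 < t := hs.trans ht.1
  have h1 : t ^ 2 < s * S := (lt_sqrt ht0.le).1 ht.2
  have h2 : t < S := by
    by_contra h
    push Not at h
    nlinarith
  refine ⟨ht0, h2, ?_⟩
  have h3 := log_le_log (by positivity) h1.le
  rw [log_pow, log_mul hs.ne' hS.ne'] at h3
  rw [log_div hS.ne' hs.ne', log_div hS.ne' ht0.ne']
  push_cast at h3
  linarith

theorem lintegral_inv_half {s S : ℝ} (hs : 0 < s) (hsS : s < S) :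
    ∫⁻ t in Ioo s √(s * S), ENNReal.ofReal t⁻¹ = ENNReal.ofReal (log (S / s) / 2) := by
  have hS : 0 < S := hs.trans hsS
  rw [lintegral_inv_Ioo hs (le_sqrt_of_sq_le (by nlinarith))]
  congr 1
  rw [log_div (by positivity) hs.ne', log_sqrt (by positivity), log_mul hs.ne' hS.ne',
    log_div hS.ne' hs.ne']
  ring

/-- On the first logarithmic half of `(s,S)` the logarithm is at least half of `log(S/s)`, and
`(t-s)^(α-1) ≥ t^(α-1)` leaves the measure `dt/t`, of total mass `log(S/s)/2`. -/
theorem le_lintegral_kernel {α q s S : ℝ} (h1 : α < 1) (hq : 0 < q) (hs : 0 < s) (hsS : s < S) :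
    ENNReal.ofReal ((log (S / s) / 2) ^ (q + 1)) ≤
      ∫⁻ t in Ioo s S, ENNReal.ofReal (t ^ (-α) * log (S / t) ^ q) *
        ENNReal.ofReal ((t - s) ^ (α - 1)) := by
  have hS : 0 < S := hs.trans hsS
  have hL : 0 < log (S / s) := log_pos ((one_lt_div hs).2 hsS)
  have hsub : Ioo s √(s * S) ⊆ Ioo s S := fun t ht => ⟨ht.1, (half_log_of_mem hs hsS ht).2.1⟩
  refine le_trans ?_ (lintegral_mono_set hsub)
  rw [rpow_add_one (by positivity), ENNReal.ofReal_mul (by positivity), ← lintegral_inv_half hs hsS,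
    ← lintegral_const_mul _ (by fun_prop)]
  refine setLIntegral_mono' measurableSet_Ioo fun t ht => ?_
  obtain ⟨ht0, htS, hl⟩ := half_log_of_mem hs hsS ht
  have hl0 : 0 < log (S / t) := lt_of_lt_of_le (by positivity) hl
  rw [← ENNReal.ofReal_mul (by positivity), ← ENNReal.ofReal_mul (by positivity)]
  refine ENNReal.ofReal_le_ofReal ?_
  have h2 : t ^ (α - 1) ≤ (t - s) ^ (α - 1) :=
    rpow_le_rpow_of_nonpos (by linarith [ht.1]) (by linarith) (by linarith)
  have h3 : t ^ (-α) * t ^ (α - 1) = t⁻¹ := by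
    rw [← rpow_add ht0, ← rpow_neg_one]; congr 1; ring
  calc (log (S / s) / 2) ^ q * t⁻¹ ≤ log (S / t) ^ q * t⁻¹ := by gcongr
    _ = t ^ (-α) * log (S / t) ^ q * t ^ (α - 1) := by rw [← h3]; ring
    _ ≤ _ := by gcongr

/-- The one-dimensional inequality behind the necessary condition. -/
theorem le_of_integral_inequality {α q c ω S t₀ : ℝ} (h0 : 1 / 2 ≤ α) (h1 : α < 1) (hq : 0 < q)
    (hc : 0 < c) (hω : 0 < ω) (hS : 0 < S) (ht₀ : t₀ = S * exp (-(1 / (1 - α))))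
    {U V : ℝ → ℝ≥0∞} (hV : Measurable V) {m : ℝ≥0∞}
    (hfin : ∫⁻ t in Ioo t₀ S, V t < ∞)
    (hlow : ∀ᵐ t ∂(volume.restrict (Ioo t₀ S)), ENNReal.ofReal c * m + ENNReal.ofReal α *
      ∫⁻ s in Ioo t₀ t, ENNReal.ofReal ((t - s) ^ (α - 1)) * (ENNReal.ofReal c * V s) ≤ U t)
    (hup : ∀ t ∈ Ioo t₀ S, ∀ d : ℝ, 0 < d →
      U t ≤ ENNReal.ofReal d * V t + ENNReal.ofReal (d ^ (-q) * (ω * t ^ (α * q)))) :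
    m ≤ ENNReal.ofReal ((c * 2 ^ (-q - 3)) ^ (-q) * ω * exp 1 * 2 ^ (q + 1) / c * (1 - α) ^ q) := by
  have h1' : 0 < 1 - α := by linarith
  set Λ := 1 / (1 - α) with hΛ
  have hΛ0 : 0 < Λ := by positivity
  have ht₀0 : 0 < t₀ := by rw [ht₀]; positivity
  have ht₀S : t₀ < S := by
    rw [ht₀]; exact mul_lt_of_lt_one_right hS (exp_lt_one_iff.2 (by linarith))
  have hlogt₀ : log (S / t₀) = Λ := by
    rw [ht₀, div_mul_cancel_left₀ hS.ne', log_inv, log_exp, neg_neg]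
  have hL : ∀ t ∈ Ioo t₀ S, 0 < t ∧ 0 < log (S / t) ∧ log (S / t) ≤ Λ := by
    intro t ht
    have ht0 := ht₀0.trans ht.1
    refine ⟨ht0, log_pos ((one_lt_div ht0).2 ht.2), ?_⟩
    rw [← hlogt₀]
    have := ht.1
    gcongr
  -- Chosen so that `α c 2^(-q-1) = 4αa ≥ 2a` for `α ≥ 1/2`: the Volterra term then yields at least
  -- two copies of `J`, against the single copy coming from Young's inequality.
  set a := c * 2 ^ (-q - 3) with ha
  have ha0 : 0 < a := by positivity
  -- The test weight. With `d = a t^α log(S/t)` in Young's inequality, `K d` becomes `a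
  -- log(S/t)^(q+1)`, the weight in `J`, and in `K d^(-q) t^(αq)` all logarithms cancel.
  set K : ℝ → ℝ≥0∞ := fun t => ENNReal.ofReal (t ^ (-α) * log (S / t) ^ q) with hK
  have hKm : Measurable K := by rw [hK]; fun_prop
  set J := ∫⁻ s in Ioo t₀ S, ENNReal.ofReal (a * log (S / s) ^ (q + 1)) * V s with hJ
  have hJm : Measurable fun s => ENNReal.ofReal (a * log (S / s) ^ (q + 1)) * V s := by fun_prop
  -- Needed to cancel `J` from both sides in `[0,∞]`.
  have hJfin : J ≠ ∞ := by
    refine ne_of_lt (lt_of_le_of_lt (b := ENNReal.ofReal (a * Λ ^ (q + 1)) * ∫⁻ t in Ioo t₀ S, V t)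
      ?_ (ENNReal.mul_lt_top ENNReal.ofReal_lt_top hfin))
    rw [← lintegral_const_mul _ hV]
    refine setLIntegral_mono' measurableSet_Ioo fun s hs => ?_
    obtain ⟨_, hl0, hl⟩ := hL s hs
    gcongr
  have upper : ∫⁻ t in Ioo t₀ S, K t * U t ≤
      J + ENNReal.ofReal (a ^ (-q) * ω) * ∫⁻ t in Ioo t₀ S, ENNReal.ofReal (t ^ (-α)) := by
    rw [hJ, ← lintegral_const_mul _ (by fun_prop), ← lintegral_add_left hJm]
    refine setLIntegral_mono' measurableSet_Ioo fun t ht => ?_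
    obtain ⟨ht0, hl0, -⟩ := hL t ht
    have hd : 0 < a * t ^ α * log (S / t) := by positivity
    refine (mul_le_mul_right (hup t ht _ hd) _).trans (le_of_eq ?_)
    rw [mul_add, ← mul_assoc, hK]
    simp only
    rw [← ENNReal.ofReal_mul (by positivity), ← ENNReal.ofReal_mul (by positivity),
      ← ENNReal.ofReal_mul (by positivity)]
    have e0 : t ^ (-α) * t ^ α = 1 := by rw [← rpow_add ht0]; simp
    congr 2
    · congr 1
      rw [rpow_add_one hl0.ne']
      linear_combination a * (log (S / t) ^ q * log (S / t)) * e0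
    · rw [mul_rpow (by positivity) hl0.le, mul_rpow ha0.le (by positivity), ← rpow_mul ht0.le]
      have e1 : log (S / t) ^ q * log (S / t) ^ (-q) = 1 := by rw [← rpow_add hl0]; simp
      have e2 : t ^ (α * -q) * t ^ (α * q) = 1 := by rw [← rpow_add ht0]; simp
      calc _ = t ^ (-α) * (a ^ (-q) * ω) * (log (S / t) ^ q * log (S / t) ^ (-q)) *
            (t ^ (α * -q) * t ^ (α * q)) := by ring
        _ = _ := by rw [e1, e2]; ring
  have lower : (∫⁻ t in Ioo t₀ S, K t) * (ENNReal.ofReal c * m) + (J + J) ≤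
      ∫⁻ t in Ioo t₀ S, K t * U t := by
    set F : ℝ → ℝ → ℝ≥0∞ := fun t s => K t * (ENNReal.ofReal α *
      (ENNReal.ofReal ((t - s) ^ (α - 1)) * (ENNReal.ofReal c * V s))) with hF
    have hFm : Measurable (Function.uncurry F) := by
      simp only [hF, Function.uncurry_def]; fun_prop
    -- Exchanging the order of integration puts `V(s)` outside and leaves the kernel integral
    -- bounded below by `le_lintegral_kernel`.
    have step : J + J ≤ ∫⁻ t in Ioo t₀ S, ∫⁻ s in Ioo t₀ t, F t s := by
      rw [lintegral_triangle hFm, hJ, ← lintegral_add_left hJm]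
      refine setLIntegral_mono' measurableSet_Ioo fun s hs => ?_
      obtain ⟨hs0, hl0, -⟩ := hL s hs
      have e : ∀ t, F t s = ENNReal.ofReal α * (ENNReal.ofReal c * V s) *
          (K t * ENNReal.ofReal ((t - s) ^ (α - 1))) := fun t => by simp only [hF]; ring
      simp_rw [e]
      rw [lintegral_const_mul _ (by fun_prop)]
      refine le_trans ?_ (mul_le_mul_right (le_lintegral_kernel h1 hq hs0 hs.2) _)
      have e2 : ∀ w : ℝ≥0∞, ENNReal.ofReal α * (ENNReal.ofReal c * w) *
          ENNReal.ofReal ((log (S / s) / 2) ^ (q + 1)) =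
          ENNReal.ofReal (α * c * (log (S / s) / 2) ^ (q + 1)) * w := by
        intro w
        rw [ENNReal.ofReal_mul (by positivity), ENNReal.ofReal_mul (by positivity)]; ring
      rw [e2, ← add_mul, ← ENNReal.ofReal_add (by positivity) (by positivity)]
      gcongr
      have e3 : (log (S / s) / 2) ^ (q + 1) = 4 * 2 ^ (-q - 3) * log (S / s) ^ (q + 1) := by
        rw [div_rpow hl0.le (by norm_num), div_eq_mul_inv, ← rpow_neg (by norm_num), mul_comm]
        congr 1
        rw [show (4 : ℝ) = 2 ^ (2 : ℝ) by norm_num, ← rpow_add (by norm_num)]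
        congr 1; ring
      rw [e3, ha]
      have : 0 < c * 2 ^ (-q - 3) * log (S / s) ^ (q + 1) := by positivity
      nlinarith
    have hKc : Measurable fun t => K t * (ENNReal.ofReal c * m) := by fun_prop
    rw [← lintegral_mul_const _ hKm]
    refine (add_le_add_right step _).trans ?_
    rw [← lintegral_add_left hKc]
    refine lintegral_mono_ae ?_
    filter_upwards [hlow] with t ht
    refine le_trans (le_of_eq ?_) (mul_le_mul_right ht _)
    have m1 : Measurable fun s => ENNReal.ofReal ((t - s) ^ (α - 1)) * (ENNReal.ofReal c * V s) := by
      fun_prop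
    simp only [hF]
    rw [mul_add, lintegral_const_mul _ (by fun_prop), lintegral_const_mul _ m1]
  have main : (∫⁻ t in Ioo t₀ S, K t) * (ENNReal.ofReal c * m) ≤
      ENNReal.ofReal (a ^ (-q) * ω) * ∫⁻ t in Ioo t₀ S, ENNReal.ofReal (t ^ (-α)) := by
    have := lower.trans upper
    rw [← add_assoc, add_comm J] at this
    have h2 := (ENNReal.add_le_add_iff_right hJfin).1 this
    exact le_self_add.trans h2
  -- The choice of `t₀` makes `t^(1-α)` vary only by a factor `e` on the window, so `t^(-α) dt` is
  -- comparable with `S^(1-α) dt/t`. The factors `S^(1-α)` cancel in the end, which makes the bound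
  -- independent of `S`.
  have hexp : t₀ ^ (1 - α) = S ^ (1 - α) * exp (-1) := by
    rw [ht₀, mul_rpow hS.le (exp_pos _).le, ← exp_mul, hΛ]
    congr 2
    field_simp
  have Klow : ENNReal.ofReal (S ^ (1 - α) * exp (-1) * (Λ / 2) ^ (q + 1)) ≤
      ∫⁻ t in Ioo t₀ S, K t := by
    have hsub : Ioo t₀ √(t₀ * S) ⊆ Ioo t₀ S :=
      fun t ht => ⟨ht.1, (half_log_of_mem ht₀0 ht₀S ht).2.1⟩
    refine le_trans ?_ (lintegral_mono_set hsub)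
    rw [rpow_add_one (by positivity), ← mul_assoc, ENNReal.ofReal_mul (by positivity), ← hlogt₀,
      ← lintegral_inv_half ht₀0 ht₀S, ← lintegral_const_mul _ (by fun_prop), hlogt₀]
    refine setLIntegral_mono' measurableSet_Ioo fun t ht => ?_
    obtain ⟨ht0, htS, hl⟩ := half_log_of_mem ht₀0 ht₀S ht
    rw [hlogt₀] at hl
    rw [← ENNReal.ofReal_mul (by positivity)]
    refine ENNReal.ofReal_le_ofReal ?_
    have e1 : t ^ (-α) = t ^ (1 - α) * t⁻¹ := by
      rw [← rpow_neg_one t, ← rpow_add ht0]; congr 1; ring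
    have e2 : t₀ ^ (1 - α) ≤ t ^ (1 - α) := rpow_le_rpow ht₀0.le ht.1.le h1'.le
    rw [← hexp, e1]
    calc t₀ ^ (1 - α) * (Λ / 2) ^ q * t⁻¹ ≤ t ^ (1 - α) * log (S / t) ^ q * t⁻¹ := by gcongr
      _ = _ := by ring
  have Tup : ∫⁻ t in Ioo t₀ S, ENNReal.ofReal (t ^ (-α)) ≤ ENNReal.ofReal (S ^ (1 - α) * Λ) := by
    rw [ENNReal.ofReal_mul (by positivity), ← hlogt₀, ← lintegral_inv_Ioo ht₀0 ht₀S.le,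
      ← lintegral_const_mul _ (by fun_prop)]
    refine setLIntegral_mono' measurableSet_Ioo fun t ht => ?_
    obtain ⟨ht0, -, -⟩ := hL t ht
    rw [← ENNReal.ofReal_mul (by positivity)]
    refine ENNReal.ofReal_le_ofReal ?_
    have e1 : t ^ (-α) = t ^ (1 - α) * t⁻¹ := by
      rw [← rpow_neg_one t, ← rpow_add ht0]; congr 1; ring
    rw [e1]
    have := ht.2.le
    gcongr
  set A := S ^ (1 - α) * exp (-1) * (Λ / 2) ^ (q + 1) * c with hA
  have hA0 : 0 < A := by positivity
  have fin : ENNReal.ofReal A * m ≤ ENNReal.ofReal (a ^ (-q) * ω * (S ^ (1 - α) * Λ)) := by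
    rw [hA, ENNReal.ofReal_mul (by positivity), ENNReal.ofReal_mul (p := a ^ (-q) * ω)
      (by positivity), mul_assoc]
    exact (mul_le_mul_left Klow _).trans (main.trans (mul_le_mul_right Tup _))
  have fin2 : m ≤ ENNReal.ofReal (a ^ (-q) * ω * (S ^ (1 - α) * Λ)) / ENNReal.ofReal A := by
    rw [ENNReal.le_div_iff_mul_le (Or.inl (by simpa using hA0)) (Or.inl ENNReal.ofReal_ne_top),
      mul_comm]
    exact fin
  refine fin2.trans (le_of_eq ?_)
  rw [← ENNReal.ofReal_div_of_pos hA0]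
  congr 1
  have e1 : (1 - α) ^ q = (Λ ^ q)⁻¹ := by
    rw [hΛ, one_div, inv_rpow h1'.le, inv_inv]
  have e2 : exp 1 * exp (-1) = 1 := by rw [← exp_add]; simp
  rw [e1, hA, div_rpow hΛ0.le (by norm_num), rpow_add_one hΛ0.ne', exp_neg]
  have := rpow_pos_of_pos hΛ0 q
  field_simp

section Necessary
variable {N : ℕ} {α p : ℝ}

/-- The integral of `g(s)` over the ball of radius `s^(α/2)`. -/
noncomputable def parabolicMass (α : ℝ) (g : ℝ → Space N → ℝ≥0∞) (s : ℝ) : ℝ≥0∞ :=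
  ∫⁻ y in Metric.ball 0 (s ^ (α / 2)), g s y

theorem measurable_parabolicMass {g : ℝ → Space N → ℝ≥0∞} (hg : Measurable (Function.uncurry g)) :
    Measurable (parabolicMass α g) := by
  have e : ∀ s, parabolicMass α g s = ∫⁻ y, {w : ℝ × Space N | ‖w.2‖ < w.1 ^ (α / 2)}.indicator
      (Function.uncurry g) (s, y) := by
    intro s
    rw [parabolicMass, ← lintegral_indicator Metric.isOpen_ball.measurableSet]
    refine lintegral_congr fun y => ?_
    simp only [indicator, mem_ofPred_eq, Metric.mem_ball, dist_zero_right, Function.uncurry]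
  rw [funext e]
  refine Measurable.lintegral_prod_right' (hg.indicator ?_)
  exact measurableSet_lt (by fun_prop) (by fun_prop)

/-- Finiteness at one later point `(t,x)` is enough: for `s < S < t` and `y` in a fixed ball, the
kernel of the Duhamel term at `(t,x)` has a positive lower bound. This supplies the finiteness
required for cancellation in `le_of_integral_inequality`. -/
theorem lintegral_ball_rpow_lt_top (h0 : 0 < α) (h1 : α < 1) {μ : Measure (Space N)}
    {v : ℝ → Space N → ℝ≥0∞} (hv : Measurable (Function.uncurry v)) {S t : ℝ} (hS : 0 < S)
    (hSt : S < t) {x : Space N} (h : mildRHS α p μ v t x < ∞) (R : ℝ) :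
    ∫⁻ s in Ioo 0 S, ∫⁻ y in Metric.ball 0 R, v s y ^ p < ∞ := by
  have ht : 0 < t := hS.trans hSt
  have hS' : 0 < t - S := sub_pos.2 hSt
  have hd := measurable_subDensity α
  have hvp : Measurable (Function.uncurry fun s y => v s y ^ p) := measurable_uncurry_rpow hv
  have hvs : ∀ s, Measurable fun y => v s y ^ p := fun s => hvp.comp measurable_prodMk_left
  -- A lower bound for `G((t-s)^α θ, x-y)` uniform in `s` and `y`: the normalizing factor is taken
  -- at the largest time, the exponential at the smallest time and the largest distance.
  set e : ℝ → ℝ := fun θ => 1 / (4 * π * (t ^ α * θ)) ^ ((N : ℝ) / 2) *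
    exp (-(‖x‖ + R) ^ 2 / (4 * ((t - S) ^ α * θ))) with he
  set k := ∫⁻ θ in Ioi (0 : ℝ), ENNReal.ofReal (θ * subDensity α θ) * ENNReal.ofReal (e θ) with hk
  have hk0 : k ≠ 0 := by
    refine ne_of_gt ((lintegral_pos_iff_support (by fun_prop)).2 ?_)
    have : Ioi (0 : ℝ) ⊆ Function.support fun θ =>
        ENNReal.ofReal (θ * subDensity α θ) * ENNReal.ofReal (e θ) := by
      intro θ hθ
      have hθ' : 0 < θ := hθ
      have := subDensity_pos h0 h1 hθ'
      simp only [Function.mem_support]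
      refine mul_ne_zero ?_ ?_
      · simp only [ne_eq, ENNReal.ofReal_eq_zero, not_le]; positivity
      · simp only [ne_eq, ENNReal.ofReal_eq_zero, not_le, he]; positivity
    refine lt_of_lt_of_le ?_ (measure_mono this)
    simp
  set c := ENNReal.ofReal α * (ENNReal.ofReal (t ^ (α - 1)) * k) with hc
  have hc0 : c ≠ 0 := by
    refine mul_ne_zero ?_ (mul_ne_zero ?_ hk0)
    · simpa using h0
    · simp only [ne_eq, ENNReal.ofReal_eq_zero, not_le]; positivity
  have key : c * ∫⁻ s in Ioo 0 S, ∫⁻ y in Metric.ball 0 R, v s y ^ p ≤ mildRHS α p μ v t x := by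
    refine le_trans ?_ le_add_self
    rw [hc, mul_assoc]
    gcongr 1
    refine le_trans ?_ (lintegral_mono_set (Ioo_subset_Ioo_right hSt.le))
    have hVm : Measurable fun s => ∫⁻ y in Metric.ball 0 R, v s y ^ p := hvp.lintegral_prod_right'
    rw [← lintegral_const_mul _ hVm]
    refine setLIntegral_mono' measurableSet_Ioo fun s hs => ?_
    have hts : 0 < t - s := by linarith [hs.2]
    rw [mul_assoc]
    refine mul_le_mul' (ENNReal.ofReal_le_ofReal ?_) ?_
    · exact rpow_le_rpow_of_nonpos hts (by linarith [hs.1]) (by linarith)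
    · rw [hk, opS, ← lintegral_mul_const _ (by fun_prop)]
      refine setLIntegral_mono' measurableSet_Ioi fun θ hθ => ?_
      have hθ' : 0 < θ := hθ
      rw [mul_assoc]
      gcongr 1
      rw [heatSemigroup_withDensity _ (hvs s), ← lintegral_const_mul _ (hvs s)]
      refine le_trans ?_ (setLIntegral_le_lintegral (Metric.ball 0 R) _)
      refine setLIntegral_mono' Metric.isOpen_ball.measurableSet fun y hy => ?_
      rw [mul_comm]
      gcongr 2
      have hy' : ‖y‖ < R := by simpa using hy
      have b1 : (t - s) ^ α ≤ t ^ α := rpow_le_rpow hts.le (by linarith [hs.1]) h0.le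
      have b2 : (t - S) ^ α ≤ (t - s) ^ α := rpow_le_rpow hS'.le (by linarith [hs.2]) h0.le
      have b3 : 0 < (t - S) ^ α := rpow_pos_of_pos hS' _
      have b4 : 0 < (t - s) ^ α := rpow_pos_of_pos hts _
      have b5 : ‖x - y‖ ≤ ‖x‖ + R := (norm_sub_le x y).trans (by linarith)
      rw [heatKernel]
      simp only [he]
      refine mul_le_mul ?_ (exp_le_exp.2 ?_) (exp_pos _).le (by positivity)
      · gcongr
      · rw [neg_div, neg_div, neg_le_neg_iff]
        gcongr
  have := key.trans_lt h
  exact ENNReal.lt_top_of_mul_ne_top_right this.ne hc0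

theorem fujitaExponent_gt_one (hN : 1 ≤ N) : 1 < fujitaExponent N := by
  have : 0 < (N : ℝ) := by positivity
  rw [fujitaExponent]
  have : 0 < 2 / (N : ℝ) := by positivity
  linarith

theorem measurable_opS_lag {g : ℝ → Space N → ℝ≥0∞} (hg : Measurable (Function.uncurry g)) (t : ℝ) :
    Measurable fun w : ℝ × Space N => ENNReal.ofReal ((t - w.1) ^ (α - 1)) *
      opS α (t - w.1) (volume.withDensity (g w.1)) w.2 := by
  refine Measurable.mul (by fun_prop) ?_
  exact (measurable_opS_withDensity hg).comp
    (f := fun w : ℝ × Space N => (w.1, t - w.1, w.2)) (by fun_prop)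

/-- Integrating the equation over the ball of radius `r = t^(α/2)`: since `(t-s)^α ≤ t^α = r²`, both
`opP` and `opS` keep a fixed fraction of the mass lying in that ball, and the parabolic balls of
earlier times are contained in it. -/
theorem le_parabolicMass (h0 : 1 / 2 ≤ α) (h1 : α < 1) (μ : Measure (Space N)) [SFinite μ]
    {v : ℝ → Space N → ℝ≥0∞} (hvp : Measurable (Function.uncurry fun s y => v s y ^ p)) {t₀ t : ℝ}
    (ht₀0 : 0 < t₀) (htS : t₀ < t)
    (hx : ∀ᵐ x ∂(volume : Measure (Space N)), v t x = mildRHS α p μ v t x) :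
    1 / 2 * ballMass N * μ (Metric.ball 0 (t₀ ^ (α / 2))) + ENNReal.ofReal α *
      ∫⁻ s in Ioo t₀ t, ENNReal.ofReal ((t - s) ^ (α - 1)) *
        (1 / 2 * ballMass N * parabolicMass α (fun s y => v s y ^ p) s) ≤ parabolicMass α v t := by
  have hα0 : 0 < α := by linarith
  have ht0 : 0 < t := ht₀0.trans htS
  have hradius : t ^ α = (t ^ (α / 2)) ^ 2 := by
    rw [← rpow_natCast, ← rpow_mul ht0.le]; congr 1; push_cast; ring
  set r := t ^ (α / 2) with hr
  have hr0 : 0 < r := by positivity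
  have hP : Measurable (opP α t μ) :=
    (measurable_opP (α := α) μ).comp (f := fun x : Space N => (t, x)) (by fun_prop)
  obtain ⟨B, hB⟩ : ∃ B : ℝ → Space N → ℝ≥0∞, ∀ s x, B s x = ENNReal.ofReal ((t - s) ^ (α - 1)) *
    opS α (t - s) (volume.withDensity fun y => v s y ^ p) x := ⟨_, fun _ _ => rfl⟩
  have hBm : Measurable fun w : ℝ × Space N => B w.1 w.2 := by
    simp only [hB]; exact measurable_opS_lag hvp t
  have hsw : Measurable (Function.uncurry fun (x : Space N) (s : ℝ) => B s x) :=
    hBm.comp measurable_swap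
  have e1 : parabolicMass α v t = (∫⁻ x in Metric.ball 0 r, opP α t μ x) +
      ENNReal.ofReal α * ∫⁻ s in Ioo 0 t, ∫⁻ x in Metric.ball 0 r, B s x := by
    have hin : Measurable fun x => ∫⁻ s in Ioo 0 t, B s x := hsw.lintegral_prod_right'
    rw [parabolicMass, ← lintegral_lintegral_swap hsw.aemeasurable,
      ← lintegral_const_mul _ hin, ← lintegral_add_left hP]
    refine lintegral_congr_ae (ae_restrict_of_ae ?_)
    filter_upwards [hx] with x hx
    simp only [hx, mildRHS, hB]
  rw [e1]
  refine add_le_add ?_ ?_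
  · refine le_trans ?_ (ballMass_mul_le_opP h0 h1 ht0 hr0 hradius.le μ)
    gcongr 1
    refine measure_mono (Metric.ball_subset_ball ?_)
    exact rpow_le_rpow ht₀0.le htS.le (by positivity)
  · gcongr 1
    refine le_trans (setLIntegral_mono' measurableSet_Ioo fun s hs => ?_)
      (lintegral_mono_set (Ioo_subset_Ioo_left ht₀0.le))
    have hs0 : 0 < s := ht₀0.trans hs.1
    have hvps : Measurable fun y => v s y ^ p := hvp.comp measurable_prodMk_left
    have hms : Measurable (opS α (t - s) (volume.withDensity fun y => v s y ^ p)) :=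
      (measurable_opS_withDensity (α := α) hvp).comp (f := fun x : Space N => (s, t - s, x))
        (by fun_prop)
    simp only [hB]
    rw [lintegral_const_mul _ hms]
    gcongr 1
    refine le_trans ?_ (ballMass_mul_le_opS h0 h1 (sub_pos.2 hs.2) hr0 ?_ _)
    · gcongr 1
      rw [withDensity_apply _ Metric.isOpen_ball.measurableSet]
      refine lintegral_mono_set (Metric.ball_subset_ball ?_)
      exact rpow_le_rpow hs0.le hs.2.le (by positivity)
    · rw [← hradius]
      exact rpow_le_rpow (sub_pos.2 hs.2).le (by linarith) hα0.le

/-- If a solution exists in `[0,T]`, the mass of the initial datum at the scale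
`T exp(-1/(1-α))` is at most of order `(1-α)^(N/2)`. -/
theorem exists_ball_le_of_isSolution (hN : 1 ≤ N) :
    ∃ C : ℝ, 0 < C ∧ ∀ (α : ℝ), 1 / 2 ≤ α → α < 1 → ∀ (μ : Measure (Space N)) [SFinite μ] (T : ℝ),
      0 < T → ∀ u, IsSolution α (fujitaExponent N) μ T u →
      μ (Metric.ball 0 ((T / 2 * exp (-(1 / (1 - α)))) ^ (α / 2))) ≤
        ENNReal.ofReal (C * (1 - α) ^ ((N : ℝ) / 2)) := by
  set p := fujitaExponent N with hp
  have hp1 : 1 < p := fujitaExponent_gt_one hN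
  have hN0 : 0 < (N : ℝ) := by positivity
  set q := (N : ℝ) / 2 with hq
  have hq0 : 0 < q := by positivity
  have hpq : (p - 1) * q = 1 := by rw [hp, fujitaExponent, hq]; field_simp; ring
  set c := (1 / 2 * ballMass N).toReal with hc
  have hcE : ENNReal.ofReal c = 1 / 2 * ballMass N :=
    ENNReal.ofReal_toReal (ENNReal.mul_ne_top (by simp) (ballMass_ne_top N))
  have hc0 : 0 < c := ENNReal.toReal_pos (mul_ne_zero (by simp) (ballMass_pos N).ne')
    (ENNReal.mul_ne_top (by simp) (ballMass_ne_top N))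
  set ω := (volume (Metric.ball (0 : Space N) 1)).toReal with hω
  have hωE : ENNReal.ofReal ω = volume (Metric.ball (0 : Space N) 1) :=
    ENNReal.ofReal_toReal measure_ball_lt_top.ne
  have hω0 : 0 < ω := ENNReal.toReal_pos (Metric.measure_ball_pos _ _ one_pos).ne'
    measure_ball_lt_top.ne
  refine ⟨(c * 2 ^ (-q - 3)) ^ (-q) * ω * exp 1 * 2 ^ (q + 1) / c, by positivity, ?_⟩
  intro α h0 h1 μ _ T hT u hu
  have hα0 : 0 < α := by linarith
  obtain ⟨v, hv, hvs⟩ := hu.exists_measurable (by linarith)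
  have hvp : Measurable (Function.uncurry fun s y => v s y ^ p) := measurable_uncurry_rpow hv
  have hvps : ∀ s, Measurable fun y => v s y ^ p := fun s => hvp.comp measurable_prodMk_left
  have hvt : ∀ s, Measurable fun y => v s y := fun s => hv.comp measurable_prodMk_left
  have h1' : 0 < 1 - α := by linarith
  -- Stopping at `T/2` leaves times in `(S,T)` at which the solution is finite, so that `V` is
  -- integrable on `(t₀,S)`.
  set S := T / 2 with hSd
  have hS : 0 < S := by positivity
  set t₀ := S * exp (-(1 / (1 - α))) with ht₀
  have ht₀0 : 0 < t₀ := by positivity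
  refine le_of_integral_inequality (V := parabolicMass α fun s y => v s y ^ p)
    (U := parabolicMass α v) (t₀ := t₀) h0 h1 hq0 hc0 hω0 hS ht₀
    (measurable_parabolicMass hvp) ?_ ?_ ?_
  · have hex : ∃ t ∈ Ioo S T, ∀ᵐ x ∂(volume : Measure (Space N)), v t x < ∞ ∧
        v t x = mildRHS α p μ v t x := by
      have hsub : Ioo S T ⊆ Ioc 0 T := fun s hs => ⟨hS.trans hs.1, hs.2.le⟩
      have h2 := ae_restrict_of_ae_restrict_of_subset hsub hvs.2
      have h3 : volume.restrict (Ioo S T) ≠ 0 := by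
        rw [ne_eq, Measure.restrict_eq_zero, Real.volume_Ioo, ENNReal.ofReal_eq_zero, not_le]
        linarith
      have : NeBot (ae (volume.restrict (Ioo S T))) := ae_neBot.2 h3
      obtain ⟨t, ht1, ht2⟩ := (h2.and (ae_restrict_mem measurableSet_Ioo)).exists
      exact ⟨t, ht2, ht1⟩
    obtain ⟨t, ht, hx⟩ := hex
    obtain ⟨x, hx1, hx2⟩ := hx.exists
    rw [hx2] at hx1
    have := lintegral_ball_rpow_lt_top hα0 h1 hv hS ht.1 hx1 (S ^ (α / 2))
    refine lt_of_le_of_lt ?_ this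
    refine le_trans (setLIntegral_mono' measurableSet_Ioo fun s hs => ?_)
      (lintegral_mono_set (Ioo_subset_Ioo_left ht₀0.le))
    refine lintegral_mono_set (Metric.ball_subset_ball ?_)
    exact rpow_le_rpow (ht₀0.trans hs.1).le hs.2.le (by positivity)
  · have hsub : Ioo t₀ S ⊆ Ioc 0 T := fun s hs => ⟨ht₀0.trans hs.1, by linarith [hs.2]⟩
    filter_upwards [ae_restrict_of_ae_restrict_of_subset hsub hvs.2,
      ae_restrict_mem measurableSet_Ioo] with t ht htS
    have ht0 : 0 < t := ht₀0.trans htS.1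
    rw [hcE]
    exact le_parabolicMass h0 h1 μ hvp ht₀0 htS.1 (ht.mono fun x hx => hx.2)
  · intro t ht d hd
    have ht0 : 0 < t := ht₀0.trans ht.1
    have e2 : ENNReal.ofReal (d ^ (-q) * (ω * t ^ (α * q))) =
        ENNReal.ofReal (d ^ (-q)) * volume (Metric.ball (0 : Space N) (t ^ (α / 2))) := by
      rw [volume_ball_eq _ (by positivity), ← hωE, ← ENNReal.ofReal_mul (by positivity),
        ← ENNReal.ofReal_mul (by positivity), ← rpow_mul ht0.le]
      congr 2
      rw [mul_comm]; congr 2; rw [hq]; ring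
    rw [e2, ← setLIntegral_const, parabolicMass, parabolicMass,
      ← lintegral_const_mul _ (hvps t), ← lintegral_add_left ((hvps t).const_mul _)]
    exact lintegral_mono fun x => le_ofReal_mul_rpow_add hp1 hpq hd _

end Necessary

/-! ### Smoothing estimates in the spaces with Gaussian weight -/

section Smoothing
variable {N : ℕ} {α p : ℝ}

theorem measurable_heatKernel_sub (t : ℝ) (z : Space N) :
    Measurable fun x : Space N => ENNReal.ofReal (heatKernel t (z - x)) :=
  (measurable_heatKernel.comp (f := fun x : Space N => (t, z - x)) (by fun_prop)).ennreal_ofReal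

/-- The measure `G(l, z - x) dx`. -/
noncomputable def gaussWeight (l : ℝ) (z : Space N) : Measure (Space N) :=
  volume.withDensity fun x => ENNReal.ofReal (heatKernel l (z - x))

instance (l : ℝ) (z : Space N) : SFinite (gaussWeight l z) := by
  unfold gaussWeight; infer_instance

/-- Applied to `g = u(s)^p`, this identifies weighted `L^p` bounds for all centres `z` with
pointwise bounds on `e^{lΔ}(u(s)^p)`. The output of the smoothing estimate thus has the form of its
hypothesis. -/
theorem lintegral_gaussWeight (l : ℝ) (z : Space N) {g : Space N → ℝ≥0∞} (hg : Measurable g) :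
    ∫⁻ x, g x ∂(gaussWeight l z) = heatSemigroup l (volume.withDensity g) z := by
  rw [heatSemigroup_withDensity _ hg, gaussWeight,
    lintegral_withDensity_eq_lintegral_mul _ (measurable_heatKernel_sub l z) hg]
  simp only [Pi.mul_apply, mul_comm]

theorem measurable_heatSemigroup (t : ℝ) (μ : Measure (Space N)) [SFinite μ] :
    Measurable (heatSemigroup t μ) :=
  (measurable_heatSemigroup_uncurry μ).comp (f := fun x : Space N => (t, x)) (by fun_prop)

/-- The semigroup property. -/
theorem lintegral_gaussWeight_heatSemigroup {l t : ℝ} (hl : 0 < l) (ht : 0 < t) (z : Space N)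
    (μ : Measure (Space N)) [SFinite μ] :
    ∫⁻ x, heatSemigroup t μ x ∂(gaussWeight l z) = heatSemigroup (l + t) μ z := by
  rw [gaussWeight, lintegral_withDensity_eq_lintegral_mul _ (measurable_heatKernel_sub l z)
    (measurable_heatSemigroup t μ)]
  have hm : Measurable fun w : Space N × Space N =>
      ENNReal.ofReal (heatKernel l (z - w.1)) * ENNReal.ofReal (heatKernel t (w.1 - w.2)) :=
    ((measurable_heatKernel_sub l z).comp measurable_fst).mul
      (measurable_heatKernel.comp (f := fun w : Space N × Space N => (t, w.1 - w.2))
        (by fun_prop)).ennreal_ofReal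
  have e : ∀ x, ((fun x => ENNReal.ofReal (heatKernel l (z - x)) : Space N → ℝ≥0∞) *
      heatSemigroup t μ) x = ∫⁻ y, ENNReal.ofReal (heatKernel l (z - x)) * ENNReal.ofReal (heatKernel t (x - y)) ∂μ := by
    intro x
    rw [lintegral_const_mul _ (measurable_heatKernel_sub t x)]
    rfl
  simp_rw [e]
  rw [lintegral_lintegral_swap hm.aemeasurable, heatSemigroup]
  exact lintegral_congr fun y => lintegral_heatKernel_mul hl ht z y

/-- After time `l` the semigroup property and unit mass preserve the bound. Before time `l`,
comparing the kernels at times `t` and `l` costs `(l/t)^(N/2)`. -/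
theorem heatSemigroup_le_of_le {l t : ℝ} (hl : 0 < l) (ht : 0 < t) (μ : Measure (Space N))
    [SFinite μ] {A : ℝ≥0∞} (hA : ∀ z, heatSemigroup l μ z ≤ A) (x : Space N) :
    heatSemigroup t μ x ≤ A * ENNReal.ofReal (max 1 (l / t) ^ ((N : ℝ) / 2)) := by
  rcases lt_or_ge l t with h | h
  · have e : max 1 (l / t) = 1 := max_eq_left ((div_le_one ht).2 h.le)
    rw [e, one_rpow, ENNReal.ofReal_one, mul_one]
    have e2 : t = (t - l) + l := by ring
    rw [e2, ← lintegral_gaussWeight_heatSemigroup (sub_pos.2 h) hl]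
    calc _ ≤ ∫⁻ _, A ∂(gaussWeight (t - l) x) := lintegral_mono hA
      _ = A := by
        rw [lintegral_const, gaussWeight, withDensity_apply _ MeasurableSet.univ,
          Measure.restrict_univ]
        simp_rw [heatKernel_sub_comm (t - l) x]
        rw [lintegral_heatKernel (sub_pos.2 h), mul_one]
  · have e : max 1 (l / t) = l / t := max_eq_right ((one_le_div ht).2 h)
    rw [e, mul_comm]
    refine le_trans ?_ (mul_le_mul_right (hA x) _)
    rw [heatSemigroup, heatSemigroup, ← lintegral_const_mul _ (measurable_heatKernel_sub l x)]
    refine lintegral_mono fun y => ?_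
    rw [← ENNReal.ofReal_mul (by positivity)]
    exact ENNReal.ofReal_le_ofReal (heatKernel_le_mul ht h _)

/-- Write the power as `(p-1) + 1`. The pointwise bound is used for the exponent `p-1`, where
`(N/2)(p-1) = 1` leaves the first power of `l/t`; the remaining linear factor is integrated exactly
by the semigroup property. -/
theorem lintegral_heatSemigroup_rpow_le (hp : 1 < p) (hpN : (N : ℝ) / 2 * (p - 1) = 1) {l t : ℝ}
    (hl : 0 < l) (ht : 0 < t) (μ : Measure (Space N)) [SFinite μ] {A : ℝ≥0∞}
    (hA : ∀ z, heatSemigroup l μ z ≤ A) (z : Space N) :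
    ∫⁻ x, heatSemigroup t μ x ^ p ∂(gaussWeight l z) ≤ A ^ p * ENNReal.ofReal (max 1 (l / t)) := by
  have hp1 : 0 < p - 1 := sub_pos.2 hp
  have hM : 0 < max 1 (l / t) := lt_max_of_lt_left one_pos
  have point : ∀ x, heatSemigroup t μ x ^ p ≤
      A ^ (p - 1) * ENNReal.ofReal (max 1 (l / t)) * heatSemigroup t μ x := by
    intro x
    have e : heatSemigroup t μ x ^ p = heatSemigroup t μ x ^ (p - 1) * heatSemigroup t μ x := by
      nth_rw 3 [← ENNReal.rpow_one (heatSemigroup t μ x)]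
      rw [← ENNReal.rpow_add_of_nonneg _ _ hp1.le zero_le_one, sub_add_cancel]
    rw [e]
    gcongr 1
    refine (ENNReal.rpow_le_rpow (heatSemigroup_le_of_le hl ht μ hA x) hp1.le).trans (le_of_eq ?_)
    rw [ENNReal.mul_rpow_of_nonneg _ _ hp1.le, ENNReal.ofReal_rpow_of_pos (by positivity),
      ← rpow_mul hM.le, hpN, rpow_one]
  calc _ ≤ ∫⁻ x, A ^ (p - 1) * ENNReal.ofReal (max 1 (l / t)) * heatSemigroup t μ x
          ∂(gaussWeight l z) := lintegral_mono point
    _ = A ^ (p - 1) * ENNReal.ofReal (max 1 (l / t)) * heatSemigroup (l + t) μ z := by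
        rw [lintegral_const_mul _ (measurable_heatSemigroup t μ),
          lintegral_gaussWeight_heatSemigroup hl ht]
    _ ≤ A ^ (p - 1) * ENNReal.ofReal (max 1 (l / t)) * A := by
        gcongr 1
        have := heatSemigroup_le_of_le hl (add_pos hl ht) μ hA z
        have e : max 1 (l / (l + t)) = 1 :=
          max_eq_left ((div_le_one (add_pos hl ht)).2 (by linarith))
        rwa [e, one_rpow, ENNReal.ofReal_one, mul_one] at this
    _ = A ^ p * ENNReal.ofReal (max 1 (l / t)) := by
        have : A ^ p = A ^ (p - 1) * A := by
          nth_rw 3 [← ENNReal.rpow_one A]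
          rw [← ENNReal.rpow_add_of_nonneg _ _ hp1.le zero_le_one, sub_add_cancel]
        rw [this]; ring

/-- The smoothing estimate for the operators `∫ w(θ) e^{t^α θ Δ} μ dθ`. -/
theorem lintegral_weight_rpow_le (hp : 1 < p) (hpN : (N : ℝ) / 2 * (p - 1) = 1) {l t : ℝ}
    (ht : 0 < t) (htl : t ^ α ≤ l) (μ : Measure (Space N)) [SFinite μ] {A : ℝ} (hA0 : 0 < A)
    (hA : ∀ z, heatSemigroup l μ z ≤ ENNReal.ofReal A) {w : ℝ → ℝ≥0∞} (hw : Measurable w)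
    (z : Space N) :
    ∫⁻ x, (∫⁻ θ in Ioi (0 : ℝ), w θ * heatSemigroup (t ^ α * θ) μ x) ^ p ∂(gaussWeight l z) ≤
      (ENNReal.ofReal (A * (l / t ^ α) ^ (1 / p)) *
        ∫⁻ θ in Ioi (0 : ℝ), w θ * ENNReal.ofReal (1 + θ ^ (-(1 / p)))) ^ p := by
  have hp0 : 0 < p := by linarith
  have hta : 0 < t ^ α := rpow_pos_of_pos ht α
  have hl : 0 < l := hta.trans_le htl
  have hlt : 1 ≤ l / t ^ α := (one_le_div hta).2 htl
  set ν := (volume.restrict (Ioi (0 : ℝ))).withDensity w with hν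
  have hpos : ∀ᵐ θ ∂ν, θ ∈ Ioi (0 : ℝ) :=
    (withDensity_absolutelyContinuous _ w).ae_le (ae_restrict_mem measurableSet_Ioi)
  -- The majorant for Minkowski's inequality over `θ`. It separates the variables through `max(1,
  -- l/(t^α θ)) ≤ (l/t^α)(1 + θ^(-1/p))^p`, valid because `t^α ≤ l`.
  set b : ℝ → ℝ≥0∞ := fun θ =>
    ENNReal.ofReal (A * (l / t ^ α) ^ (1 / p)) * ENNReal.ofReal (1 + θ ^ (-(1 / p))) with hb
  have hbm : Measurable fun θ : ℝ => ENNReal.ofReal (1 + θ ^ (-(1 / p))) := by fun_prop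
  have hEm : Measurable (Function.uncurry fun (θ : ℝ) (x : Space N) =>
      heatSemigroup (t ^ α * θ) μ x) :=
    (measurable_heatSemigroup_uncurry μ).comp (f := fun q : ℝ × Space N => (t ^ α * q.1, q.2))
      (by fun_prop)
  have e1 : ∀ x, ∫⁻ θ in Ioi (0 : ℝ), w θ * heatSemigroup (t ^ α * θ) μ x =
      ∫⁻ θ, heatSemigroup (t ^ α * θ) μ x ∂ν := by
    intro x
    have hx : Measurable fun θ => heatSemigroup (t ^ α * θ) μ x :=
      hEm.comp (f := fun θ : ℝ => (θ, x)) (by fun_prop)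
    rw [hν, lintegral_withDensity_eq_lintegral_mul _ hw hx]
    rfl
  have e2 : ENNReal.ofReal (A * (l / t ^ α) ^ (1 / p)) *
        ∫⁻ θ in Ioi (0 : ℝ), w θ * ENNReal.ofReal (1 + θ ^ (-(1 / p))) = ∫⁻ θ, b θ ∂ν := by
    rw [hν, lintegral_withDensity_eq_lintegral_mul _ hw (by fun_prop),
      ← lintegral_const_mul _ (by fun_prop)]
    refine lintegral_congr fun θ => ?_
    simp only [Pi.mul_apply, hb]; ring
  simp_rw [e1]
  rw [e2]
  refine lintegral_lintegral_rpow_le hp hEm (by fun_prop) ?_ ?_ ?_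
  · filter_upwards [hpos] with θ hθ
    have hθ' : 0 < θ := hθ
    refine mul_ne_zero ?_ ?_ <;>
    · simp only [ne_eq, ENNReal.ofReal_eq_zero, not_le]; positivity
  · exact .of_forall fun θ => ENNReal.mul_ne_top ENNReal.ofReal_ne_top ENNReal.ofReal_ne_top
  · filter_upwards [hpos] with θ hθ
    have hθ' : 0 < θ := hθ
    refine (lintegral_heatSemigroup_rpow_le hp hpN hl (mul_pos hta hθ') μ hA z).trans ?_
    simp only [hb]
    rw [← ENNReal.ofReal_mul (by positivity), ENNReal.ofReal_rpow_of_pos hA0,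
      ENNReal.ofReal_rpow_of_pos (by positivity), ← ENNReal.ofReal_mul (by positivity)]
    refine ENNReal.ofReal_le_ofReal ?_
    rw [mul_rpow (by positivity) (by positivity), mul_rpow hA0.le (by positivity),
      ← rpow_mul (by positivity), one_div_mul_cancel hp0.ne', rpow_one, mul_assoc]
    gcongr ?_ * ?_
    have hθp : 0 < θ ^ (-(1 / p)) := rpow_pos_of_pos hθ' _
    have k1 : 1 ≤ (1 + θ ^ (-(1 / p))) ^ p := one_le_rpow (by linarith) hp0.le
    have k2 : θ⁻¹ ≤ (1 + θ ^ (-(1 / p))) ^ p := by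
      have : θ⁻¹ = (θ ^ (-(1 / p))) ^ p := by
        rw [← rpow_mul hθ'.le, neg_mul, one_div_mul_cancel hp0.ne', rpow_neg_one]
      rw [this]
      exact rpow_le_rpow hθp.le (by linarith) hp0.le
    refine max_le ?_ ?_
    · nlinarith
    · rw [← div_div, div_eq_mul_inv _ θ]
      gcongr

theorem lintegral_subDensity_mul_le (h0 : 0 < α) (h1 : α < 1) {s : ℝ} (hs : -1 < s) (hs0 : s ≤ 0) :
    ∫⁻ θ in Ioi (0 : ℝ), ENNReal.ofReal (subDensity α θ) * ENNReal.ofReal (1 + θ ^ s) ≤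
      1 + ENNReal.ofReal (Gamma (1 + s) / π) * ∫⁻ u in Ioo 0 π, ENNReal.ofReal (sin u ^ s) := by
  have hd := measurable_subDensity α
  calc _ = ∫⁻ θ in Ioi (0 : ℝ), ENNReal.ofReal (subDensity α θ) +
        ENNReal.ofReal (θ ^ s * subDensity α θ) := by
        refine setLIntegral_congr_fun measurableSet_Ioi fun θ hθ => ?_
        have hθ' : 0 < θ := hθ
        have := subDensity_pos h0 h1 hθ'
        rw [← ENNReal.ofReal_mul this.le, ← ENNReal.ofReal_add this.le (by positivity)]
        congr 1; ring
    _ ≤ _ := by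
        rw [lintegral_add_left (by fun_prop), lintegral_subDensity h0 h1]
        gcongr 1
        exact lintegral_rpow_mul_subDensity_le h0 h1 hs hs0

/-- The extra factor `θ` absorbs the negative power: `θ^(1+s) ≤ 1 + θ`. Hence only the mass and the
first moment enter, and `5 = 1 + 2·2`. -/
theorem lintegral_mul_subDensity_mul_le (h0 : 1 / 2 ≤ α) (h1 : α < 1) {s : ℝ} (hs : -1 < s)
    (hs0 : s ≤ 0) :
    ∫⁻ θ in Ioi (0 : ℝ), ENNReal.ofReal (θ * subDensity α θ) * ENNReal.ofReal (1 + θ ^ s) ≤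
      ENNReal.ofReal 5 := by
  have hd := measurable_subDensity α
  calc _ ≤ ∫⁻ θ in Ioi (0 : ℝ), ENNReal.ofReal (subDensity α θ) +
        2 * ENNReal.ofReal (θ * subDensity α θ) := by
        refine setLIntegral_mono' measurableSet_Ioi fun θ hθ => ?_
        have hθ' : 0 < θ := hθ
        have := subDensity_pos (by linarith) h1 hθ'
        have hq : 0 ≤ θ * subDensity α θ := by positivity
        rw [show (2 : ℝ≥0∞) = ENNReal.ofReal 2 by simp, ← ENNReal.ofReal_mul hq,
          ← ENNReal.ofReal_mul (p := 2) (by norm_num), ← ENNReal.ofReal_add this.le (by positivity)]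
        refine ENNReal.ofReal_le_ofReal ?_
        have k : θ * θ ^ s ≤ 1 + θ := by
          rw [← rpow_one_add' hθ'.le (by linarith)]
          rcases le_total θ 1 with h | h
          · have := rpow_le_one hθ'.le h (by linarith : 0 ≤ 1 + s)
            linarith
          · have := rpow_le_rpow_of_exponent_le h (by linarith : 1 + s ≤ 1)
            rw [rpow_one] at this
            linarith
        nlinarith
    _ ≤ _ := by
        rw [lintegral_add_left (by fun_prop), lintegral_const_mul _ (by fun_prop),
          lintegral_subDensity (by linarith) h1]
        calc _ ≤ 1 + 2 * (2 : ℝ≥0∞) := by gcongr; exact lintegral_mul_subDensity_le h0 h1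
          _ = _ := by norm_num

/-- Splitting at `t/2` separates the two endpoint singularities. The one of `s^(-α)` produces the
factor `1/(1-α)`; the other costs only a constant depending on `η`, as `α ≥ 1/2`. -/
theorem lintegral_time_le {η t : ℝ} (h0 : 1 / 2 ≤ α) (h1 : α < 1) (hη : 0 < η) (hη1 : η < 1)
    (ht : 0 < t) :
    ∫⁻ s in Ioo 0 t, ENNReal.ofReal ((t - s) ^ (α * η - 1) * s ^ (-α)) ≤
      ENNReal.ofReal ((2 + 4 / η) / (1 - α) * t ^ (-(α * (1 - η)))) := by
  have h1' : 0 < 1 - α := by linarith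
  have hα0 : 0 < α := by linarith
  set β := α * η with hβ
  have hβ0 : 0 < β := by positivity
  have hβ1 : β < 1 := by nlinarith
  have ht2 : 0 < t / 2 := by positivity
  have i1 : IntegrableOn (fun s : ℝ => s ^ (-α)) (Ioo 0 t) :=
    (intervalIntegrable_iff_integrableOn_Ioo_of_le ht.le).1
      (intervalIntegral.intervalIntegrable_rpow' (by linarith))
  have v1 : ∫ s in Ioo 0 t, s ^ (-α) = t ^ (1 - α) / (1 - α) := by
    rw [← integral_Ioc_eq_integral_Ioo, ← intervalIntegral.integral_of_le ht.le,
      integral_rpow (Or.inl (by linarith)), neg_add_eq_sub, zero_rpow h1'.ne', sub_zero]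
  have i2' : IntervalIntegrable (fun s : ℝ => (t - s) ^ (β - 1)) volume 0 t := by
    have := (intervalIntegral.intervalIntegrable_rpow' (a := 0) (b := t) (r := β - 1)
      (by linarith)).comp_sub_left t
    simpa using this.symm
  have i2 : IntegrableOn (fun s : ℝ => (t - s) ^ (β - 1)) (Ioo 0 t) :=
    (intervalIntegrable_iff_integrableOn_Ioo_of_le ht.le).1 i2'
  have v2 : ∫ s in Ioo 0 t, (t - s) ^ (β - 1) = t ^ β / β := by
    rw [← integral_Ioc_eq_integral_Ioo, ← intervalIntegral.integral_of_le ht.le,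
      intervalIntegral.integral_comp_sub_left (fun s => s ^ (β - 1)) t, sub_self, sub_zero,
      integral_rpow (Or.inl (by linarith)), sub_add_cancel, zero_rpow hβ0.ne', sub_zero]
  have point : ∀ s ∈ Ioo 0 t, (t - s) ^ (β - 1) * s ^ (-α) ≤
      (t / 2) ^ (β - 1) * s ^ (-α) + (t / 2) ^ (-α) * (t - s) ^ (β - 1) := by
    intro s hs
    have hs0 : 0 < s := hs.1
    have hts : 0 < t - s := sub_pos.2 hs.2
    rcases le_total s (t / 2) with h | h
    · have := rpow_le_rpow_of_nonpos ht2 (by linarith : t / 2 ≤ t - s) (by linarith : β - 1 ≤ 0)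
      have h3 : 0 ≤ (t / 2) ^ (-α) * (t - s) ^ (β - 1) := by positivity
      have h4 : (t - s) ^ (β - 1) * s ^ (-α) ≤ (t / 2) ^ (β - 1) * s ^ (-α) := by gcongr
      linarith
    · have := rpow_le_rpow_of_nonpos ht2 h (by linarith : -α ≤ 0)
      have h3 : 0 ≤ (t / 2) ^ (β - 1) * s ^ (-α) := by positivity
      have h4 : (t - s) ^ (β - 1) * s ^ (-α) ≤ (t - s) ^ (β - 1) * (t / 2) ^ (-α) := by gcongr
      linarith
  refine (setLIntegral_mono' measurableSet_Ioo fun s hs =>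
    ENNReal.ofReal_le_ofReal (point s hs)).trans ?_
  have i3 : IntegrableOn (fun s : ℝ => (t / 2) ^ (β - 1) * s ^ (-α) +
      (t / 2) ^ (-α) * (t - s) ^ (β - 1)) (Ioo 0 t) := (i1.const_mul _).add (i2.const_mul _)
  rw [← ofReal_integral_eq_lintegral_ofReal i3]
  · refine ENNReal.ofReal_le_ofReal ?_
    rw [integral_add (i1.const_mul _) (i2.const_mul _), integral_const_mul, integral_const_mul,
      v1, v2]
    have ea : (t / 2) ^ (β - 1) * t ^ (1 - α) = t ^ (-(α * (1 - η))) * 2 ^ (1 - β) := by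
      rw [div_rpow ht.le (by norm_num), div_eq_mul_inv, ← rpow_neg (by norm_num : (0 : ℝ) ≤ 2),
        neg_sub, mul_right_comm, ← rpow_add ht]
      congr 2; rw [hβ]; ring
    have eb : (t / 2) ^ (-α) * t ^ β = t ^ (-(α * (1 - η))) * 2 ^ α := by
      rw [div_rpow ht.le (by norm_num), div_eq_mul_inv, ← rpow_neg (by norm_num : (0 : ℝ) ≤ 2),
        neg_neg, mul_right_comm, ← rpow_add ht]
      congr 2; rw [hβ]; ring
    have ec : (2 : ℝ) ^ (1 - β) ≤ 2 := by
      simpa using rpow_le_rpow_of_exponent_le one_le_two (by linarith : 1 - β ≤ 1)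
    have ed : (2 : ℝ) ^ α ≤ 2 := by
      simpa using rpow_le_rpow_of_exponent_le one_le_two h1.le
    rw [← mul_div_assoc, ea, ← mul_div_assoc, eb]
    have hx : 0 < t ^ (-(α * (1 - η))) := rpow_pos_of_pos ht _
    have f1 : t ^ (-(α * (1 - η))) * 2 ^ (1 - β) / (1 - α) ≤ t ^ (-(α * (1 - η))) * 2 / (1 - α) := by
      gcongr
    -- From `β = αη ≥ η/2` and `2^α ≤ 2` the coefficient is at most `4/η`; enlarging it by `1/(1-α)
    -- ≥ 1` allows the two terms to be added.
    have f2 : t ^ (-(α * (1 - η))) * 2 ^ α / β ≤ t ^ (-(α * (1 - η))) * (4 / η / (1 - α)) := by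
      rw [mul_div_assoc]
      gcongr ?_ * ?_
      rw [div_div, div_le_div_iff₀ hβ0 (by positivity)]
      have : (2 : ℝ) ^ α * (η * (1 - α)) ≤ 2 * (η * (1 - α)) := by gcongr
      rw [hβ]
      nlinarith
    calc _ ≤ t ^ (-(α * (1 - η))) * 2 / (1 - α) + t ^ (-(α * (1 - η))) * (4 / η / (1 - α)) :=
          add_le_add f1 f2
      _ = _ := by ring
  · refine (ae_restrict_iff' measurableSet_Ioo).2 (.of_forall fun s hs => ?_)
    have hs0 : 0 < s := hs.1
    have hts : 0 < t - s := sub_pos.2 hs.2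
    simp only [Pi.zero_apply]; positivity

end Smoothing

/-! ### Existence of the minimal solution -/

section Existence
variable {N : ℕ} {α p : ℝ}

/-- Minkowski's inequality in `s`. The hypothesis on `u(s)` bounds `e^{lΔ}(u(s)^p)`, so the
smoothing estimate applies to `opS` at time `t-s` and reduces the claim to the scalar integral of
`(t-s)^(α(1-1/p)-1) s^(-α)`. -/
theorem lintegral_duhamel_rpow_le (h0 : 1 / 2 ≤ α) (h1 : α < 1) (hp : 1 < p)
    (hpN : (N : ℝ) / 2 * (p - 1) = 1) {l t K : ℝ} (ht : 0 < t) (htl : t ^ α ≤ l) (hK0 : 0 < K)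
    {u : ℝ → Space N → ℝ≥0∞} (hu : Measurable (Function.uncurry u))
    (hub : ∀ s ∈ Ioo 0 t, ∀ z, ∫⁻ x, u s x ^ p ∂(gaussWeight l z) ≤
      ENNReal.ofReal (K ^ p * l * s ^ (-α))) (z : Space N) :
    ∫⁻ x, (∫⁻ s in Ioo 0 t, ENNReal.ofReal ((t - s) ^ (α - 1)) *
        opS α (t - s) (volume.withDensity fun y => u s y ^ p) x) ^ p ∂(gaussWeight l z) ≤
      ENNReal.ofReal (5 * (2 + 4 / (1 - 1 / p)) * K ^ p * l / (1 - α) *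
        (l / t ^ α) ^ (1 / p)) ^ p := by
  have hp0 : 0 < p := by linarith
  have hα0 : 0 < α := by linarith
  have h1' : 0 < 1 - α := by linarith
  have hta : 0 < t ^ α := rpow_pos_of_pos ht α
  have hl : 0 < l := hta.trans_le htl
  have hpi : 1 / p < 1 := (div_lt_one hp0).2 hp
  have hpi0 : 0 < 1 / p := by positivity
  have hup : Measurable (Function.uncurry fun s y => u s y ^ p) := measurable_uncurry_rpow hu
  set b : ℝ → ℝ≥0∞ := fun s => ENNReal.ofReal ((t - s) ^ (α - 1)) *
    (ENNReal.ofReal (K ^ p * l * s ^ (-α) * (l / (t - s) ^ α) ^ (1 / p)) * ENNReal.ofReal 5) with hb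
  have hbm : Measurable b := by simp only [hb]; fun_prop
  have main := lintegral_lintegral_rpow_le (ν := volume.restrict (Ioo 0 t)) (γ := gaussWeight l z) hp
    (E := fun s x => ENNReal.ofReal ((t - s) ^ (α - 1)) *
        opS α (t - s) (volume.withDensity fun y => u s y ^ p) x) (measurable_opS_lag hup t) hbm
    ?_ ?_ ?_
  · refine main.trans (ENNReal.rpow_le_rpow ?_ hp0.le)
    have e : ∀ s ∈ Ioo 0 t, b s = ENNReal.ofReal (5 * K ^ p * l * l ^ (1 / p)) *
        ENNReal.ofReal ((t - s) ^ (α * (1 - 1 / p) - 1) * s ^ (-α)) := by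
      intro s hs
      have hs0 : 0 < s := hs.1
      have hts : 0 < t - s := sub_pos.2 hs.2
      simp only [hb]
      rw [← ENNReal.ofReal_mul (by positivity), ← ENNReal.ofReal_mul (by positivity),
        ← ENNReal.ofReal_mul (by positivity)]
      congr 1
      have e1 : (t - s) ^ (α * (1 - 1 / p) - 1) = (t - s) ^ (α - 1) / ((t - s) ^ α) ^ (1 / p) := by
        rw [← rpow_mul hts.le, ← rpow_sub hts]; congr 1; ring
      rw [e1, div_rpow hl.le (by positivity)]
      field_simp
    rw [setLIntegral_congr_fun measurableSet_Ioo e, lintegral_const_mul _ (by fun_prop)]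
    refine (mul_le_mul_right (lintegral_time_le h0 h1 (by linarith : 0 < 1 - 1 / p) (by linarith) ht)
      _).trans (le_of_eq ?_)
    rw [← ENNReal.ofReal_mul (by positivity)]
    congr 1
    rw [div_rpow hl.le hta.le, ← rpow_mul ht.le, sub_sub_cancel, rpow_neg ht.le]
    field_simp
  · filter_upwards [ae_restrict_mem measurableSet_Ioo] with s hs
    have hs0 : 0 < s := hs.1
    have hts : 0 < t - s := sub_pos.2 hs.2
    refine mul_ne_zero ?_ (mul_ne_zero ?_ ?_) <;>
    · simp only [ne_eq, ENNReal.ofReal_eq_zero, not_le]; positivity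
  · exact .of_forall fun s => ENNReal.mul_ne_top ENNReal.ofReal_ne_top
      (ENNReal.mul_ne_top ENNReal.ofReal_ne_top ENNReal.ofReal_ne_top)
  · filter_upwards [ae_restrict_mem measurableSet_Ioo] with s hs
    have hs0 : 0 < s := hs.1
    have hts : 0 < t - s := sub_pos.2 hs.2
    have hups : Measurable fun y => u s y ^ p := hup.comp measurable_prodMk_left
    have hms : Measurable (opS α (t - s) (volume.withDensity fun y => u s y ^ p)) :=
      (measurable_opS_withDensity (α := α) hup).comp (f := fun x : Space N => (s, t - s, x))
        (by fun_prop)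
    simp_rw [ENNReal.mul_rpow_of_nonneg _ _ hp0.le]
    rw [lintegral_const_mul _ (hms.pow_const p)]
    simp only [hb]
    rw [ENNReal.mul_rpow_of_nonneg _ _ hp0.le]
    gcongr 1
    have hs1 : (t - s) ^ α ≤ l :=
      (rpow_le_rpow hts.le (by linarith) hα0.le).trans htl
    have hd := measurable_subDensity α
    refine (lintegral_weight_rpow_le hp hpN hts hs1 (volume.withDensity fun y => u s y ^ p)
      (A := K ^ p * l * s ^ (-α)) (by positivity) ?_
      (w := fun θ => ENNReal.ofReal (θ * subDensity α θ)) (by fun_prop) z).trans ?_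
    · intro z'
      rw [← lintegral_gaussWeight l z' hups]
      exact hub s hs z'
    · refine ENNReal.rpow_le_rpow ?_ hp0.le
      gcongr 1
      exact lintegral_mul_subDensity_mul_le h0 h1 (by linarith) (by linarith)

/-- The class of functions with this weighted bound is stable under the integral equation. By
Minkowski the norm is at most `(AC + D)(l/t^α)^(1/p)`, where `AC` is the linear contribution and `D`
the Duhamel one, and `hK` says that `AC + D ≤ K`. -/
theorem lintegral_mildRHS_rpow_le (h0 : 1 / 2 ≤ α) (h1 : α < 1) (hp : 1 < p)
    (hpN : (N : ℝ) / 2 * (p - 1) = 1) {l t K A C : ℝ} (ht : 0 < t) (htl : t ^ α ≤ l) (hK0 : 0 < K)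
    (hA0 : 0 < A) (hC0 : 0 ≤ C) (μ : Measure (Space N)) [SFinite μ]
    (hA : ∀ z, heatSemigroup l μ z ≤ ENNReal.ofReal A)
    (hC : ∫⁻ θ in Ioi (0 : ℝ), ENNReal.ofReal (subDensity α θ) *
      ENNReal.ofReal (1 + θ ^ (-(1 / p))) ≤ ENNReal.ofReal C)
    (hK : A * C + 5 * (2 + 4 / (1 - 1 / p)) * K ^ p * l / (1 - α) ≤ K)
    {u : ℝ → Space N → ℝ≥0∞} (hu : Measurable (Function.uncurry u))
    (hub : ∀ s ∈ Ioo 0 t, ∀ z, ∫⁻ x, u s x ^ p ∂(gaussWeight l z) ≤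
      ENNReal.ofReal (K ^ p * l * s ^ (-α))) (z : Space N) :
    ∫⁻ x, mildRHS α p μ u t x ^ p ∂(gaussWeight l z) ≤ ENNReal.ofReal (K ^ p * l * t ^ (-α)) := by
  have hp0 : 0 < p := by linarith
  have h1' : 0 < 1 - α := by linarith
  have hta : 0 < t ^ α := rpow_pos_of_pos ht α
  have hl : 0 < l := hta.trans_le htl
  have hpi : 0 < 1 - 1 / p := sub_pos.2 ((div_lt_one hp0).2 hp)
  have hd := measurable_subDensity α
  set Q := (l / t ^ α) ^ (1 / p) with hQ
  have hQ0 : 0 < Q := by positivity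
  set D := 5 * (2 + 4 / (1 - 1 / p)) * K ^ p * l / (1 - α) with hD
  have hD0 : 0 < D := by positivity
  obtain ⟨g, hg⟩ : ∃ g : Space N → ℝ≥0∞, ∀ x, g x = ∫⁻ s in Ioo 0 t,
    ENNReal.ofReal ((t - s) ^ (α - 1)) *
      opS α (t - s) (volume.withDensity fun y => u s y ^ p) x := ⟨_, fun _ => rfl⟩
  have hgm : Measurable g := by
    rw [funext hg]
    have := (measurable_opS_lag (α := α) (measurable_uncurry_rpow (p := p) hu) t).comp
      (measurable_swap (α := Space N) (β := ℝ))
    exact this.lintegral_prod_right'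
  have hfm : Measurable (opP α t μ) :=
    (measurable_opP (α := α) μ).comp (f := fun x : Space N => (t, x)) (by fun_prop)
  have hf : ∫⁻ x, opP α t μ x ^ p ∂(gaussWeight l z) ≤ ENNReal.ofReal (A * C * Q) ^ p := by
    refine (lintegral_weight_rpow_le hp hpN ht htl μ hA0 hA
      (w := fun θ => ENNReal.ofReal (subDensity α θ)) (by fun_prop) z).trans
      (ENNReal.rpow_le_rpow ((mul_le_mul_right hC _).trans (le_of_eq ?_)) hp0.le)
    rw [← ENNReal.ofReal_mul (by positivity)]
    congr 1; ring
  have hg2 : ∫⁻ x, g x ^ p ∂(gaussWeight l z) ≤ ENNReal.ofReal (D * Q) ^ p := by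
    simp_rw [hg]
    exact lintegral_duhamel_rpow_le h0 h1 hp hpN ht htl hK0 hu hub z
  have hle : ∀ x, mildRHS α p μ u t x ≤ (opP α t μ + g) x := by
    intro x
    rw [mildRHS, Pi.add_apply, hg]
    gcongr 1
    refine mul_le_of_le_one_left (zero_le) ?_
    rw [← ENNReal.ofReal_one]
    exact ENNReal.ofReal_le_ofReal h1.le
  have root : ∀ {a b : ℝ≥0∞}, a ≤ b ^ p → a ^ (1 / p) ≤ b := by
    intro a b h
    have := ENNReal.rpow_le_rpow h (by positivity : 0 ≤ 1 / p)
    rwa [← ENNReal.rpow_mul, mul_one_div_cancel hp0.ne', ENNReal.rpow_one] at this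
  have hsum := ENNReal.lintegral_Lp_add_le (μ := gaussWeight l z) hfm.aemeasurable
    hgm.aemeasurable hp.le
  have hsum2 := hsum.trans (add_le_add (root hf) (root hg2))
  rw [← ENNReal.ofReal_add (by positivity) (by positivity)] at hsum2
  have hsum3 := hsum2.trans (ENNReal.ofReal_le_ofReal (show A * C * Q + D * Q ≤ K * Q by nlinarith))
  have hsum4 := ENNReal.rpow_le_rpow hsum3 hp0.le
  rw [← ENNReal.rpow_mul, one_div_mul_cancel hp0.ne', ENNReal.rpow_one] at hsum4
  refine (lintegral_mono fun x => ENNReal.rpow_le_rpow (hle x) hp0.le).trans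
    (hsum4.trans (le_of_eq ?_))
  rw [ENNReal.ofReal_rpow_of_pos (by positivity), mul_rpow hK0.le hQ0.le, hQ,
    ← rpow_mul (by positivity), one_div_mul_cancel hp0.ne', rpow_one, rpow_neg ht.le]
  congr 1
  field_simp

/-! ### Monotone convergence and the Picard iteration -/

theorem heatSemigroup_iSup (t : ℝ) {g : ℕ → Space N → ℝ≥0∞} (hg : ∀ n, Measurable (g n))
    (hmono : Monotone g) (x : Space N) :
    heatSemigroup t (volume.withDensity fun y => ⨆ n, g n y) x =
      ⨆ n, heatSemigroup t (volume.withDensity (g n)) x := by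
  have hk : Measurable fun y : Space N => ENNReal.ofReal (heatKernel t (x - y)) :=
    measurable_heatKernel_sub t x
  rw [heatSemigroup_withDensity _ (Measurable.iSup hg)]
  simp_rw [heatSemigroup_withDensity _ (hg _), ENNReal.iSup_mul]
  rw [lintegral_iSup]
  · exact fun n => (hg n).mul hk
  · exact fun m n hmn y => mul_le_mul_left (hmono hmn y) _

theorem opS_iSup (t : ℝ) {g : ℕ → Space N → ℝ≥0∞} (hg : ∀ n, Measurable (g n))
    (hmono : Monotone g) (x : Space N) :
    opS α t (volume.withDensity fun y => ⨆ n, g n y) x =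
      ⨆ n, opS α t (volume.withDensity (g n)) x := by
  have hd := measurable_subDensity α
  unfold opS
  simp_rw [heatSemigroup_iSup _ hg hmono, ENNReal.mul_iSup]
  rw [lintegral_iSup]
  · intro n
    refine Measurable.mul (by fun_prop) ?_
    exact (measurable_heatSemigroup_uncurry _).comp (f := fun θ : ℝ => (t ^ α * θ, x))
      (by fun_prop)
  · intro m n hmn θ
    exact mul_le_mul_right (heatSemigroup_mono (withDensity_mono (.of_forall (hmono hmn))) _ _) _

/-- Monotone convergence through every integral of the right-hand side; it makes the supremum of the
Picard iterates a fixed point. -/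
theorem mildRHS_iSup (hp : 0 < p) (μ : Measure (Space N)) {u : ℕ → ℝ → Space N → ℝ≥0∞}
    (hu : ∀ n, Measurable (Function.uncurry (u n))) (hmono : Monotone u) (t : ℝ) (x : Space N) :
    mildRHS α p μ (fun s y => ⨆ n, u n s y) t x = ⨆ n, mildRHS α p μ (u n) t x := by
  have hup : ∀ n, Measurable (Function.uncurry fun s y => u n s y ^ p) :=
    fun n => measurable_uncurry_rpow (hu n)
  have hmp : ∀ s, Monotone fun n y => u n s y ^ p :=
    fun s m n hmn y => ENNReal.rpow_le_rpow (hmono hmn s y) hp.le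
  have e : ∀ s y, (⨆ n, u n s y) ^ p = ⨆ n, u n s y ^ p := fun s y =>
    (ENNReal.orderIsoRpow p hp).map_iSup fun n => u n s y
  have hups : ∀ s n, Measurable fun y => u n s y ^ p :=
    fun s n => (hup n).comp measurable_prodMk_left
  unfold mildRHS
  simp_rw [e, fun s => opS_iSup (α := α) (t - s) (hups s) (hmp s) x, ENNReal.mul_iSup]
  rw [lintegral_iSup, ENNReal.mul_iSup, ENNReal.add_iSup]
  · intro n
    exact (measurable_opS_lag (α := α) (hup n) t).comp (f := fun s : ℝ => (s, x)) (by fun_prop)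
  · intro m n hmn s
    exact mul_le_mul_right (opS_mono (withDensity_mono (.of_forall (hmp s hmn))) _ _) _

/-- The Picard iterates, starting from `0`. -/
noncomputable def picard (α p : ℝ) (μ : Measure (Space N)) : ℕ → ℝ → Space N → ℝ≥0∞
  | 0 => fun _ _ => 0
  | n + 1 => mildRHS α p μ (picard α p μ n)

theorem measurable_picard (μ : Measure (Space N)) [SFinite μ] (n : ℕ) :
    Measurable (Function.uncurry (picard α p μ n)) := by
  induction n with
  | zero => exact measurable_const
  | succ n ih => exact measurable_mildRHS μ ih

theorem monotone_picard (hp : 0 < p) (μ : Measure (Space N)) : Monotone (picard α p μ) := by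
  refine monotone_nat_of_le_succ fun n => ?_
  induction n with
  | zero => intro t x; exact zero_le
  | succ n ih =>
    intro t x
    exact mildRHS_mono hp.le μ (.of_forall fun s => .of_forall fun y => ih s y) le_rfl x

/-- Induction from `0` by monotonicity; this is where minimality of the limit comes from. -/
theorem picard_le_of_isSolution (hp : 0 < p) (μ : Measure (Space N)) {T : ℝ}
    {v : ℝ → Space N → ℝ≥0∞} (hv : IsSolution α p μ T v) (n : ℕ) :
    ∀ᵐ t ∂(volume.restrict (Ioc 0 T)), ∀ᵐ x ∂(volume : Measure (Space N)),
      picard α p μ n t x ≤ v t x := by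
  induction n with
  | zero => exact .of_forall fun t => .of_forall fun x => zero_le
  | succ n ih =>
    filter_upwards [hv.2, ae_restrict_mem measurableSet_Ioc] with t ht htT
    filter_upwards [ht] with x hx
    rw [hx.2]
    exact mildRHS_mono hp.le μ ih htT.2 x

/-- The supremum of the iterates satisfies the equation and lies below every solution without
further hypotheses; only finiteness needs the bound. Since the Gaussian weight is positive, a single
centre suffices for finiteness almost everywhere. -/
theorem exists_isMinimalSolution_of_picard_bound (hp : 0 < p) (μ : Measure (Space N)) [SFinite μ]
    {T l : ℝ} (hl : 0 < l) {b : ℝ → ℝ≥0∞} (hb : ∀ t, b t < ∞)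
    (h : ∀ n, ∀ t ∈ Ioc 0 T, ∫⁻ x, picard α p μ n t x ^ p ∂(gaussWeight l 0) ≤ b t) :
    ∃ u, IsMinimalSolution α p μ T u := by
  have hm : Measurable (Function.uncurry fun t x => ⨆ n, picard α p μ n t x) := by
    simp only [Function.uncurry_def]
    exact Measurable.iSup fun n => measurable_picard μ n
  refine ⟨fun t x => ⨆ n, picard α p μ n t x, ⟨hm.aemeasurable, ?_⟩, fun v hv => ?_⟩
  · filter_upwards [ae_restrict_mem measurableSet_Ioc] with t ht
    have hmt : ∀ n, Measurable (picard α p μ n t) :=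
      fun n => (measurable_picard μ n).comp measurable_prodMk_left
    have hfin : ∫⁻ x, (⨆ n, picard α p μ n t x ^ p) ∂(gaussWeight l 0) ≤ b t := by
      rw [lintegral_iSup (fun n => (hmt n).pow_const p)
        (fun m n hmn x => ENNReal.rpow_le_rpow (monotone_picard hp μ hmn t x) hp.le)]
      exact iSup_le fun n => h n t ht
    rw [gaussWeight, lintegral_withDensity_eq_lintegral_mul _ (measurable_heatKernel_sub l 0)
      (Measurable.iSup fun n => (hmt n).pow_const p)] at hfin
    have hae := ae_lt_top ((measurable_heatKernel_sub l (0 : Space N)).mul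
      (Measurable.iSup fun n => (hmt n).pow_const p)) (hfin.trans_lt (hb t)).ne
    filter_upwards [hae] with x hx
    constructor
    · have hG : ENNReal.ofReal (heatKernel l (0 - x)) ≠ 0 := by
        simp only [ne_eq, ENNReal.ofReal_eq_zero, not_le, heatKernel]; positivity
      have h2 : (⨆ n, picard α p μ n t x ^ p) < ∞ :=
        ENNReal.lt_top_of_mul_ne_top_right hx.ne hG
      have e : (⨆ n, picard α p μ n t x) ^ p = ⨆ n, picard α p μ n t x ^ p :=
        (ENNReal.orderIsoRpow p hp).map_iSup fun n => picard α p μ n t x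
      rw [← e] at h2
      exact (ENNReal.rpow_lt_top_iff_of_pos hp).1 h2
    · rw [mildRHS_iSup hp μ (measurable_picard μ) (monotone_picard hp μ)]
      refine le_antisymm (iSup_le fun n => ?_) (iSup_le fun n => ?_)
      · exact (monotone_picard hp μ (Nat.le_succ n) t x).trans
          (le_iSup (fun n => mildRHS α p μ (picard α p μ n) t x) n)
      · exact le_iSup (fun n => picard α p μ n t x) (n + 1)
  · have := ae_all_iff.2 (picard_le_of_isSolution hp μ hv)
    filter_upwards [this] with t ht
    filter_upwards [ae_all_iff.2 ht] with x hx
    exact iSup_le hx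

/-- If `e^{T^α Δ} μ` is small, the minimal solution exists in `[0,T]`. -/
theorem exists_forall_isMinimalSolution (hN : 1 ≤ N) :
    ∃ B : ℝ, 0 < B ∧ ∀ (α : ℝ), 1 / 2 ≤ α → α < 1 → ∀ (μ : Measure (Space N)) [SFinite μ]
      (T A : ℝ), 0 < T → 0 < A → (∀ z, heatSemigroup (T ^ α) μ z ≤ ENNReal.ofReal A) →
      B * A ^ (2 / (N : ℝ)) * T ^ α ≤ 1 - α →
      ∃ u, IsMinimalSolution α (fujitaExponent N) μ T u := by
  set p := fujitaExponent N with hp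
  have hp1 : 1 < p := fujitaExponent_gt_one hN
  have hp0 : 0 < p := by linarith
  have hN0 : 0 < (N : ℝ) := by positivity
  have hpe : p - 1 = 2 / N := by rw [hp, fujitaExponent]; ring
  have hpN : (N : ℝ) / 2 * (p - 1) = 1 := by rw [hpe]; field_simp
  have hpi : 1 / p < 1 := (div_lt_one hp0).2 hp1
  have hpi0 : 0 < 1 / p := by positivity
  -- An upper bound, free of `α`, for `∫ h_α(θ)(1 + θ^(-1/p)) dθ`; it is finite because `1/p < 1`.
  set C' : ℝ≥0∞ := 1 + ENNReal.ofReal (Gamma (1 + -(1 / p)) / π) *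
    ∫⁻ u in Ioo 0 π, ENNReal.ofReal (sin u ^ (-(1 / p))) with hC'
  have hCt : C' ≠ ∞ := ENNReal.add_ne_top.2 ⟨ENNReal.one_ne_top, ENNReal.mul_ne_top
    ENNReal.ofReal_ne_top (lintegral_sin_rpow_lt_top (by linarith) (by linarith)).ne⟩
  have hC0 : 0 < C'.toReal := ENNReal.toReal_pos (by simp [hC']) hCt
  set C := C'.toReal with hC
  set η := 1 - 1 / p with hη
  have hη0 : 0 < η := by linarith
  refine ⟨10 * (2 + 4 / η) * (2 * C) ^ (2 / (N : ℝ)), by positivity, ?_⟩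
  intro α h0 h1 μ _ T A hT hA0 hA hB
  have hα0 : 0 < α := by linarith
  have h1' : 0 < 1 - α := by linarith
  set l := T ^ α with hl
  have hl0 : 0 < l := rpow_pos_of_pos hT α
  -- The linear term takes up exactly `K/2`. As `K^p = K · (2CA)^(2/N)`, the smallness hypothesis is
  -- what keeps the Duhamel term below the other `K/2`.
  set K := 2 * A * C with hK
  have hK0 : 0 < K := by positivity
  have hKp : K ^ p = K * ((2 * C) ^ (2 / (N : ℝ)) * A ^ (2 / (N : ℝ))) := by
    rw [← mul_rpow (by positivity) hA0.le, show 2 * C * A = K by rw [hK]; ring, ← hpe,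
      ← rpow_one_add' hK0.le (by linarith)]
    congr 1; ring
  have hKle : A * C + 5 * (2 + 4 / η) * K ^ p * l / (1 - α) ≤ K := by
    have : 5 * (2 + 4 / η) * K ^ p * l / (1 - α) ≤ K / 2 := by
      rw [div_le_iff₀ h1', hKp]
      calc _ = K / 2 * (10 * (2 + 4 / η) * (2 * C) ^ (2 / (N : ℝ)) * A ^ (2 / (N : ℝ)) * l) := by
            ring
        _ ≤ _ := by gcongr
    rw [hK] at this ⊢
    linarith
  have hCle : ∫⁻ θ in Ioi (0 : ℝ), ENNReal.ofReal (subDensity α θ) *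
      ENNReal.ofReal (1 + θ ^ (-(1 / p))) ≤ ENNReal.ofReal C := by
    rw [hC, ENNReal.ofReal_toReal hCt]
    exact lintegral_subDensity_mul_le hα0 h1 (by linarith) (by linarith)
  have bound : ∀ n, ∀ t ∈ Ioc 0 T, ∀ z, ∫⁻ x, picard α p μ n t x ^ p ∂(gaussWeight l z) ≤
      ENNReal.ofReal (K ^ p * l * t ^ (-α)) := by
    intro n
    induction n with
    | zero => intro t _ z; simp [picard, ENNReal.zero_rpow_of_pos hp0]
    | succ n ih =>
      intro t ht z
      exact lintegral_mildRHS_rpow_le h0 h1 hp1 hpN ht.1 (rpow_le_rpow ht.1.le ht.2 hα0.le) hK0 hA0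
        hC0.le μ hA hCle hKle (measurable_picard μ n)
        (fun s hs z => ih s ⟨hs.1, hs.2.le.trans ht.2⟩ z) z
  exact exists_isMinimalSolution_of_picard_bound hp0 μ hl0
    (b := fun t => ENNReal.ofReal (K ^ p * l * t ^ (-α))) (fun _ => ENNReal.ofReal_lt_top)
    (fun n t ht => bound n t ht 0)

end Existence

/-! ### The life span for the data `κ f_ε` -/

section LifeSpan
variable {N : ℕ} {ε : ℝ}

instance (φ : Space N → ℝ) : SFinite (toMeasure φ) := by
  unfold toMeasure; infer_instance

theorem heatKernel_le_rpow {l : ℝ} (hl : 0 < l) (x : Space N) :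
    heatKernel l x ≤ l ^ (-((N : ℝ) / 2)) := by
  rw [heatKernel, rpow_neg hl.le, ← one_div]
  have h1 : exp (-‖x‖ ^ 2 / (4 * l)) ≤ 1 := by
    rw [exp_le_one_iff, neg_div, neg_nonpos]; positivity
  refine (mul_le_of_le_one_right (by positivity) h1).trans ?_
  gcongr
  nlinarith [pi_gt_three]

/-- Split at `|y| = √l`. Inside, the kernel is at most `l^(-N/2)` and the mass of the ball enters.
Outside, the data are bounded by a quantity of the same order, and the kernel has mass one. -/
theorem exists_heatSemigroup_toMeasure_le (hN : 1 ≤ N) (hε : ε < (N : ℝ) / 2) :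
    ∃ C : ℝ, 0 < C ∧ ∀ κ : ℝ, 0 < κ → ∀ l : ℝ, 0 < l → √l ≤ 1 / exp 1 → ∀ z,
      heatSemigroup l (toMeasure fun x => κ * fData N ε x) z ≤
        ENNReal.ofReal (C * κ * (l ^ (-((N : ℝ) / 2)) * (-log √l) ^ (-((N : ℝ) / 2 - ε)))) := by
  obtain ⟨C₁, hC₁, H₁⟩ := exists_toMeasure_ball_le hN hε
  obtain ⟨C₂, hC₂, H₂⟩ := exists_fData_le hN hε
  refine ⟨C₁ + C₂, by positivity, fun κ hκ l hl hle z => ?_⟩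
  set σ := √l with hσ
  have hσ0 : 0 < σ := by positivity
  have hL : 0 < -log σ := by linarith [one_le_neg_log hσ0 hle]
  have hσN : σ ^ (-(N : ℝ)) = l ^ (-((N : ℝ) / 2)) := by
    rw [hσ, sqrt_eq_rpow, ← rpow_mul hl.le]; congr 1; ring
  have hfm : Measurable fun x : Space N => ENNReal.ofReal (κ * fData N ε x) :=
    ((measurable_fData N ε).const_mul κ).ennreal_ofReal
  set X := l ^ (-((N : ℝ) / 2)) * (-log σ) ^ (-((N : ℝ) / 2 - ε)) with hX
  have hX0 : 0 < X := by positivity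
  have hb : MeasurableSet (Metric.ball (0 : Space N) σ) := Metric.isOpen_ball.measurableSet
  rw [toMeasure, heatSemigroup_withDensity _ hfm, ← lintegral_add_compl _ hb, add_mul, add_mul,
    ENNReal.ofReal_add (by positivity) (by positivity)]
  refine add_le_add ?_ ?_
  · calc _ ≤ ∫⁻ y in Metric.ball (0 : Space N) σ, ENNReal.ofReal (κ * fData N ε y) *
          ENNReal.ofReal (l ^ (-((N : ℝ) / 2))) := by
          refine lintegral_mono fun y => ?_
          gcongr
          exact heatKernel_le_rpow hl _
      _ = toMeasure (fun x => κ * fData N ε x) (Metric.ball 0 σ) *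
          ENNReal.ofReal (l ^ (-((N : ℝ) / 2))) := by
          rw [lintegral_mul_const _ hfm, toMeasure, withDensity_apply _ hb]
      _ ≤ ENNReal.ofReal (C₁ * κ * (-log σ) ^ (-((N : ℝ) / 2 - ε))) *
          ENNReal.ofReal (l ^ (-((N : ℝ) / 2))) := by
          gcongr 1; exact H₁ κ hκ σ hσ0 hle
      _ = _ := by
          rw [← ENNReal.ofReal_mul (by positivity)]
          congr 1; rw [hX]; ring
  · calc _ ≤ ∫⁻ y in (Metric.ball (0 : Space N) σ)ᶜ, ENNReal.ofReal (C₂ * κ * X) *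
          ENNReal.ofReal (heatKernel l (z - y)) := by
          refine setLIntegral_mono' hb.compl fun y hy =>
            mul_le_mul_left (ENNReal.ofReal_le_ofReal ?_) _
          have hy' : σ ≤ ‖y‖ := by simpa using hy
          have := H₂ σ hσ0 hle y hy'
          rw [hσN] at this
          calc κ * fData N ε y ≤ κ * (C₂ * X) := by gcongr
            _ = _ := by ring
      _ ≤ ∫⁻ y : Space N, ENNReal.ofReal (C₂ * κ * X) *
          ENNReal.ofReal (heatKernel l (z - y)) := setLIntegral_le_lintegral _ _
      _ = ENNReal.ofReal (C₂ * κ * X) := by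
          rw [lintegral_const_mul _ (measurable_heatKernel_sub l z)]
          simp_rw [heatKernel_sub_comm l z]
          rw [lintegral_heatKernel hl, mul_one]

/-- The rate `κ^(2/(N-2ε)) (1-α)^(-N/(N-2ε))`. -/
noncomputable def rate (N : ℕ) (ε κ α : ℝ) : ℝ :=
  κ ^ (2 / ((N : ℝ) - 2 * ε)) * (1 - α) ^ (-((N : ℝ) / ((N : ℝ) - 2 * ε)))

theorem rate_pos {κ α : ℝ} (hκ : 0 < κ) (h1 : α < 1) : 0 < rate N ε κ α := by
  have : 0 < 1 - α := by linarith
  unfold rate; positivity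

/-- This characterizes the rate: it is the value `L` of `-log σ` at which `κ L^(-(N/2-ε))`, the
order of the mass of `κ f_ε` in `B(0,σ)`, equals `(1-α)^(N/2)`. -/
theorem rate_rpow {κ α : ℝ} (hε : ε < (N : ℝ) / 2) (hκ : 0 < κ) (h1 : α < 1) :
    rate N ε κ α ^ (-((N : ℝ) / 2 - ε)) = κ⁻¹ * (1 - α) ^ ((N : ℝ) / 2) := by
  have h1' : 0 < 1 - α := by linarith
  have hb : (N : ℝ) - 2 * ε ≠ 0 := by linarith
  rw [rate, mul_rpow (by positivity) (by positivity), ← rpow_mul hκ.le, ← rpow_mul h1'.le,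
    ← rpow_neg_one κ]
  congr 2 <;> · field_simp; try ring

/-- The ratio of the rate to `1/(1-α)` is a constant times `(1-α)^(-2ε/(N-2ε))`, which tends to
infinity because `ε > 0`. This determines the threshold `α(κ,ε)`. -/
theorem exists_forall_le_mul_rate (hε0 : 0 < ε) (hε : ε < (N : ℝ) / 2) {c κ : ℝ} (hc : 0 < c)
    (hκ : 0 < κ) : ∃ α₀ : ℝ, 3 / 4 ≤ α₀ ∧ α₀ < 1 ∧ ∀ α : ℝ, α₀ < α → α < 1 →
      1 / (1 - α) ≤ c * rate N ε κ α := by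
  have hb : 0 < (N : ℝ) - 2 * ε := by linarith
  set e := 2 * ε / ((N : ℝ) - 2 * ε) with he
  have he0 : 0 < e := by positivity
  set d := c * κ ^ (2 / ((N : ℝ) - 2 * ε)) with hd
  have hd0 : 0 < d := by positivity
  refine ⟨1 - min (1 / 4) (d ^ (1 / e)), by linarith [min_le_left (1 / 4) (d ^ (1 / e))], ?_, ?_⟩
  · have : 0 < min (1 / 4) (d ^ (1 / e)) := lt_min (by norm_num) (by positivity)
    linarith
  · intro α h0 h1
    have h1' : 0 < 1 - α := by linarith
    have h2 : 1 - α ≤ d ^ (1 / e) := by linarith [min_le_right (1 / 4) (d ^ (1 / e))]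
    have h3 := rpow_le_rpow h1'.le h2 he0.le
    rw [← rpow_mul hd0.le, one_div_mul_cancel he0.ne', rpow_one] at h3
    have h4 : (1 - α) ^ (-((N : ℝ) / ((N : ℝ) - 2 * ε))) = 1 / (1 - α) / (1 - α) ^ e := by
      rw [one_div, ← rpow_neg_one, ← rpow_sub h1']
      congr 1
      rw [he]; field_simp; ring
    have h5 : 0 < (1 - α) ^ e := by positivity
    rw [rate, h4, ← mul_assoc, ← hd, mul_div_assoc', le_div_iff₀ h5, mul_comm]
    gcongr

/-- A solution living beyond `exp(-cX)`, with `X` the rate, can be restricted to that time. The mass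
of the datum at the resulting radius is then at least twice what the necessary condition allows. -/
theorem exists_lifeSpan_le (hN : 1 ≤ N) (hε : ε < (N : ℝ) / 2) :
    ∃ c : ℝ, 0 < c ∧ ∀ κ α : ℝ, 0 < κ → 3 / 4 ≤ α → α < 1 → 1 / (1 - α) ≤ c * rate N ε κ α →
      lifeSpan α (fujitaExponent N) (toMeasure fun x => κ * fData N ε x) ≤
        ENNReal.ofReal (exp (-(c * rate N ε κ α))) := by
  obtain ⟨C₁, hC₁, H₁⟩ := exists_ball_le_of_isSolution hN
  obtain ⟨c₂, hc₂, H₂⟩ := exists_le_toMeasure_ball hN hε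
  have hb : 0 < (N : ℝ) / 2 - ε := by linarith
  set b := (N : ℝ) / 2 - ε with hbd
  -- Solves `c₂ (3c/2)^(-b) = 2 C₁`, so the lower bound for the mass is twice the admissible upper
  -- bound.
  set c := 2 / 3 * (c₂ / (2 * C₁)) ^ (1 / b) with hc
  have hc0 : 0 < c := by positivity
  have hcb : (3 / 2 * c) ^ (-b) = 2 * C₁ / c₂ := by
    rw [hc, ← mul_assoc, show (3 / 2 * (2 / 3) : ℝ) = 1 by norm_num, one_mul,
      ← rpow_mul (by positivity), one_div_mul_eq_div, neg_div, div_self hb.ne', rpow_neg_one, inv_div]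
  refine ⟨c, hc0, fun κ α hκ h0 h1 hX => ?_⟩
  have h1' : 0 < 1 - α := by linarith
  set X := rate N ε κ α with hXd
  have hX0 : 0 < X := rate_pos hκ h1
  refine sSup_le ?_
  rintro _ ⟨T', ⟨hT', u, hu⟩, rfl⟩
  refine ENNReal.ofReal_le_ofReal ?_
  by_contra hlt
  push Not at hlt
  have hsol := hu.1.mono hlt.le
  have h2 := H₁ α (by linarith) h1 _ _ (exp_pos _) u hsol
  set σ := (exp (-(c * X)) / 2 * exp (-(1 / (1 - α)))) ^ (α / 2) with hσ
  have hσ0 : 0 < σ := by positivity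
  have hlogσ : -log σ = α / 2 * (c * X + log 2 + 1 / (1 - α)) := by
    rw [hσ, log_rpow (by positivity), log_mul (by positivity) (by positivity),
      log_div (by positivity) (by positivity), log_exp, log_exp]
    ring
  have hlog2 : 0 < log 2 := log_pos one_lt_two
  have hlog2' : log 2 ≤ 1 := by linarith [log_le_sub_one_of_pos (two_pos : (0 : ℝ) < 2)]
  have h4 : 4 ≤ 1 / (1 - α) := by rw [le_div_iff₀ h1']; linarith
  have hL1 : 1 ≤ -log σ := by
    rw [hlogσ]
    nlinarith
  have hσ1 : σ ≤ 1 / exp 1 := by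
    rw [one_div, ← exp_neg, ← log_le_iff_le_exp hσ0]; linarith
  -- Both `log 2` and `1/(1-α)` are at most `cX`, and `α/2 ≤ 1/2`: the halving of `T` and the factor
  -- `e^(-1/(1-α))` change only the constant.
  have hL2 : -log σ ≤ 3 / 2 * c * X := by
    rw [hlogσ]
    nlinarith
  have h3 := (H₂ κ hκ σ hσ0 hσ1).trans h2
  rw [ENNReal.ofReal_le_ofReal_iff (by positivity)] at h3
  have h5 : (3 / 2 * c * X) ^ (-b) ≤ (-log σ) ^ (-b) :=
    rpow_le_rpow_of_nonpos (by linarith) hL2 (by linarith)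
  rw [mul_rpow (by positivity) hX0.le, hcb, hXd, rate_rpow hε hκ h1] at h5
  set Y := (1 - α) ^ ((N : ℝ) / 2) with hY
  have hY0 : 0 < Y := by positivity
  have h6 : c₂ * κ * (2 * C₁ / c₂ * (κ⁻¹ * Y)) ≤ C₁ * Y :=
    (mul_le_mul_of_nonneg_left h5 (by positivity)).trans h3
  have h7 : c₂ * κ * (2 * C₁ / c₂ * (κ⁻¹ * Y)) = 2 * (C₁ * Y) := by field_simp
  rw [h7] at h6
  have : 0 < C₁ * Y := by positivity
  linarith

/-- The sufficient condition is checked at `T = exp(-CX)`, with `X` the rate. Then `-log √(T^α) ≥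
CX/4`, and a large `C` makes the datum small at this scale; the assumption `4 ≤ CX` puts the scale
below `1/e`. -/
theorem exists_le_lifeSpan (hN : 1 ≤ N) (hε : ε < (N : ℝ) / 2) :
    ∃ C₀ : ℝ, 0 < C₀ ∧ ∀ C : ℝ, C₀ ≤ C → ∀ κ α : ℝ, 0 < κ → 1 / 2 ≤ α → α < 1 →
      4 ≤ C * rate N ε κ α →
      ENNReal.ofReal (exp (-(C * rate N ε κ α))) ≤
        lifeSpan α (fujitaExponent N) (toMeasure fun x => κ * fData N ε x) := by
  obtain ⟨B, hB, HB⟩ := exists_forall_isMinimalSolution hN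
  obtain ⟨D, hD, HD⟩ := exists_heatSemigroup_toMeasure_le hN hε
  have hN0 : 0 < (N : ℝ) := by positivity
  have hb : 0 < (N : ℝ) / 2 - ε := by linarith
  set b := (N : ℝ) / 2 - ε with hbd
  set e := 2 / (N : ℝ) with he
  have he0 : 0 < e := by positivity
  refine ⟨4 * (B * D ^ e) ^ (1 / (b * e)), by positivity, fun C hC κ α hκ h0 h1 h4 => ?_⟩
  have hC0 : 0 < C := lt_of_lt_of_le (by positivity) hC
  have h1' : 0 < 1 - α := by linarith
  set X := rate N ε κ α with hXd
  have hX0 : 0 < X := rate_pos hκ h1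
  set T := exp (-(C * X)) with hT
  have hT0 : 0 < T := exp_pos _
  set l := T ^ α with hl
  have hl0 : 0 < l := by positivity
  have hlogl : -log √l = α / 2 * (C * X) := by
    rw [log_sqrt hl0.le, hl, log_rpow hT0, hT, log_exp]; ring
  have hL : C / 4 * X ≤ -log √l := by
    rw [hlogl]; nlinarith
  have hle : √l ≤ 1 / exp 1 := by
    rw [one_div, ← exp_neg, ← log_le_iff_le_exp (by positivity)]; linarith
  have hL0 : 0 < -log √l := by linarith
  set A := D * κ * (l ^ (-((N : ℝ) / 2)) * (-log √l) ^ (-b)) with hA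
  have hA0 : 0 < A := by positivity
  refine le_sSup ⟨T, ⟨hT0, HB α h0 h1 _ T A hT0 hA0 (HD κ hκ l hl0 hle) ?_⟩, rfl⟩
  -- Criticality: `A^(2/N)` carries exactly the factor `1/l`, so no power of `T` survives and only
  -- the logarithm decides.
  have hAe : A ^ e * l = (D * κ * (-log √l) ^ (-b)) ^ e := by
    rw [hA, ← mul_assoc, mul_right_comm, mul_rpow (by positivity) (by positivity),
      ← rpow_mul hl0.le, show -((N : ℝ) / 2) * e = -1 by rw [he]; field_simp, rpow_neg_one]
    field_simp
  have h5 : (-log √l) ^ (-b) ≤ (C / 4) ^ (-b) * (κ⁻¹ * (1 - α) ^ ((N : ℝ) / 2)) := by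
    rw [← rate_rpow hε hκ h1, ← mul_rpow (by positivity) hX0.le]
    exact rpow_le_rpow_of_nonpos (by positivity) hL (by linarith)
  have h6 : D * κ * (-log √l) ^ (-b) ≤ D * (C / 4) ^ (-b) * (1 - α) ^ ((N : ℝ) / 2) := by
    calc _ ≤ D * κ * ((C / 4) ^ (-b) * (κ⁻¹ * (1 - α) ^ ((N : ℝ) / 2))) := by gcongr
      _ = _ := by field_simp
  have h7 := rpow_le_rpow (by positivity) h6 he0.le
  rw [mul_rpow (x := D * (C / 4) ^ (-b)) (by positivity) (by positivity), ← rpow_mul h1'.le,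
    show (N : ℝ) / 2 * e = 1 by rw [he]; field_simp, rpow_one,
    mul_rpow (x := D) (y := (C / 4) ^ (-b)) hD.le (by positivity),
    ← rpow_mul (x := C / 4) (by positivity)] at h7
  have h8 : B * D ^ e ≤ (C / 4) ^ (b * e) := by
    have h9 : (B * D ^ e) ^ (1 / (b * e)) ≤ C / 4 := by linarith
    have h10 := rpow_le_rpow (by positivity) h9 (by positivity : 0 ≤ b * e)
    rwa [← rpow_mul (by positivity), one_div_mul_cancel (by positivity), rpow_one] at h10
  rw [mul_assoc, hAe]
  have h11 : 0 < (C / 4) ^ (b * e) := by positivity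
  calc B * (D * κ * (-log √l) ^ (-b)) ^ e ≤ B * (D ^ e * (C / 4) ^ (-b * e) * (1 - α)) := by
        gcongr
    _ = B * D ^ e / (C / 4) ^ (b * e) * (1 - α) := by
        rw [neg_mul, rpow_neg (by positivity)]; field_simp
    _ ≤ 1 * (1 - α) := by
        gcongr
        exact (div_le_one h11).2 h8
    _ = 1 - α := one_mul _

end LifeSpan

end TimeFracHeat

theorem theorem4p2 (N : ℕ) (hN : 1 ≤ N) (ε : ℝ) (hε0 : 0 < ε) (hε : ε < (N : ℝ) / 2) :
    (∃ c C : ℝ, 0 < c ∧ c < C ∧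
      ∀ κ : ℝ, 0 < κ → ∃ α₀ : ℝ, 0 < α₀ ∧ α₀ < 1 ∧ ∀ α : ℝ, α₀ < α → α < 1 →
        ((-(C * (κ ^ (2 / ((N : ℝ) - 2 * ε)) *
            (1 - α) ^ (-((N : ℝ) / ((N : ℝ) - 2 * ε))))) : ℝ) : EReal) ≤
          ENNReal.log (TimeFracHeat.lifeSpan α (TimeFracHeat.fujitaExponent N)
            (TimeFracHeat.toMeasure fun x => κ * TimeFracHeat.fData N ε x)) ∧
        ENNReal.log (TimeFracHeat.lifeSpan α (TimeFracHeat.fujitaExponent N)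
            (TimeFracHeat.toMeasure fun x => κ * TimeFracHeat.fData N ε x)) ≤
          ((-(c * (κ ^ (2 / ((N : ℝ) - 2 * ε)) *
            (1 - α) ^ (-((N : ℝ) / ((N : ℝ) - 2 * ε))))) : ℝ) : EReal)) ∧
    ∀ κ : ℝ, 0 < κ →
      Tendsto (fun α : ℝ => TimeFracHeat.lifeSpan α (TimeFracHeat.fujitaExponent N)
        (TimeFracHeat.toMeasure fun x => κ * TimeFracHeat.fData N ε x)) (𝓝[<] 1) (𝓝 0) := by
  obtain ⟨c, hc, Hc⟩ := TimeFracHeat.exists_lifeSpan_le hN hε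
  obtain ⟨C₀, hC₀, HC⟩ := TimeFracHeat.exists_le_lifeSpan hN hε
  -- The `4c` ensures `c < C` and also `C · rate ≥ 4/(1-α) ≥ 4`, as the lower bound for the life
  -- span requires.
  refine ⟨⟨c, max C₀ (4 * c), hc, lt_max_of_lt_right (by linarith), fun κ hκ => ?_⟩, fun κ hκ => ?_⟩
  · obtain ⟨α₀, h34, hα₀, H⟩ := TimeFracHeat.exists_forall_le_mul_rate hε0 hε hc hκ
    refine ⟨α₀, by linarith, hα₀, fun α h0 h1 => ?_⟩
    have h1' : 0 < 1 - α := by linarith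
    have hr := TimeFracHeat.rate_pos (N := N) (ε := ε) hκ h1
    have hrate := H α h0 h1
    have hone : 1 ≤ 1 / (1 - α) := by rw [le_div_iff₀ h1']; linarith
    constructor
    · have h4 : 4 ≤ max C₀ (4 * c) * TimeFracHeat.rate N ε κ α := by
        have := mul_le_mul_of_nonneg_right (le_max_right C₀ (4 * c)) hr.le
        linarith
      have := ENNReal.log_monotone (HC _ (le_max_left _ _) κ α hκ (by linarith) h1 h4)
      rwa [ENNReal.log_ofReal_of_pos (exp_pos _), log_exp] at this
    · have := ENNReal.log_monotone (Hc κ α hκ (by linarith) h1 hrate)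
      rwa [ENNReal.log_ofReal_of_pos (exp_pos _), log_exp] at this
  · obtain ⟨α₀, h34, hα₀, H⟩ := TimeFracHeat.exists_forall_le_mul_rate hε0 hε hc hκ
    -- Since `c · rate ≥ 1/(1-α)` near `1`, the upper bound for the life span is dominated by
    -- `exp(-1/(1-α))`.
    have hlim : Tendsto (fun α : ℝ => ENNReal.ofReal (exp (-(1 - α)⁻¹))) (𝓝[<] 1) (𝓝 0) := by
      have h2 : Tendsto (fun α : ℝ => 1 - α) (𝓝[<] 1) (𝓝[>] 0) := by
        refine tendsto_nhdsWithin_iff.2 ⟨?_, ?_⟩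
        · have : Continuous fun α : ℝ => 1 - α := by fun_prop
          simpa using (this.tendsto 1).mono_left nhdsWithin_le_nhds
        · filter_upwards [self_mem_nhdsWithin] with α hα using sub_pos.2 (mem_Iio.1 hα)
      have h3 := tendsto_exp_neg_atTop_nhds_zero.comp (tendsto_inv_nhdsGT_zero.comp h2)
      simpa using ENNReal.tendsto_ofReal h3
    refine tendsto_of_tendsto_of_tendsto_of_le_of_le' tendsto_const_nhds hlim
      (.of_forall fun _ => zero_le) ?_
    filter_upwards [Ioo_mem_nhdsLT hα₀] with α hα
    have hrate := H α hα.1 hα.2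
    refine (Hc κ α hκ (by linarith [hα.1]) hα.2 hrate).trans (ENNReal.ofReal_le_ofReal ?_)
    rw [exp_le_exp, neg_le_neg_iff, ← one_div]
    exact hrate
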